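/- Let $d\ge 2$, $1<p<\infty$, let $\Omega\subset\mathbb{R}^d$ be open and bounded, and let $\gamma\in(0,\infty)$ be a known constant. Let $\sigma\colon\Omega\to[0,\infty]$ be measurable, put $D_0=\sigma^{-1}(\{0\})$, $D_\infty=\sigma^{-1}(\{\infty\})$, $D=D_0\cup D_\infty$, and suppose that $\sigma=\gamma$ in $\Omega\setminus D$, that at least one of $D_0$, $D_\infty$ is empty, that $\partial\Omega$, $\overline{D_0}$, $\overline{D_\infty}$ are pairwise disjoint, and that $D$ is an open set with Lipschitz boundary. Let $X=W^{1,p}(\Omega)/W^{1,p}_0(\Omega)$. The Dirichlet to Neumann (DN) map $\Lambda_\sigma$ is given by $\langle\Lambda_\sigma f,g\rangle=\int_\Omega\sigma|\nabla\bar f|^{p-2}\nabla\bar f\cdot\nabla\bar g\,dx$ for $f,g\in X$, where $\bar f\in W^{1,p}(\Omega)$ is any minimizer of $E(u)=\int_\Omega\sigma|\nabla u|^p\,dx$ among the functions with boundary values $f$, and $\bar g\in W^{1,p}(\Omega)$ is any extension of $g$ with $\nabla\bar g=0$ in $D_\infty$. Let $\Lambda_\gamma$ be the DN map of the constant conductivity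 $\gamma$. Let $V(a,b)=\frac{(2p-3)b^2+(p-1)a^2}{(p-1)b^2+a^2}$. Nontrivial solutions $w\colon\mathbb{R}\to\mathbb{R}$ of $w''+V(w,w')w=0$ exist; let $w$ be any of them. For $t\in\mathbb{R}$, $\tau>0$ and orthogonal unit vectors $\rho,\rho^\perp\in\mathbb{R}^d$ define $$I(t,\rho,\rho^\perp,\tau)=\tau^{d-p}\langle\Lambda_\sigma f-\Lambda_\gamma f,f\rangle,\qquad f(x)=e^{\tau(\rho\cdot x-t)}w(\tau\rho^\perp\cdot x).$$ Let $D'$ be what is left of $\mathbb{R}^d$ after removing every half-space $\{x:\rho\cdot x\ge t\}$ for which, for some $\rho^\perp$, there is no $c>0$ with $|I(t,\rho,\rho^\perp,\tau)|\ge c$ for all large $\tau$. Thus $D'$ is found from $\Lambda_\sigma$ (and the known $\Omega$, $p$, $\gamma$, $w$) alone. Then $D'$ is convex, $\operatorname{conv}(D)\subseteq D'\subseteq\overline{\operatorname{conv}(\Omega)}$. Furthermore, the DN map detects the type of the inclusion: for all $t$, $\rho$, $\rho^\perp$, $\tau$ as above, $D_0\ne\emptyset$ if and only if $I(t,\rho,\rho^\perp,\tau)<0$,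 and $D_\infty\neq\emptyset$ if and only if $I(t,\rho,\rho^\perp,\tau)>0$. -/

import Mathlib

open MeasureTheory Filter Topology
open scoped ENNReal ContDiff

noncomputable section

namespace PCalderon

/-- Euclidean `d`-space. -/
abbrev Space (d : ℕ) : Type := EuclideanSpace ℝ (Fin d)

/-! ### Sobolev spaces on an open set -/

/-- Test functions: smooth functions with compact support contained in `Ω`. -/
def IsTest {d : ℕ} (Ω : Set (Space d)) (φ : Space d → ℝ) : Prop :=
  ContDiff ℝ ∞ φ ∧ HasCompactSupport φ ∧ tsupport φ ⊆ Ω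

/-- `G` is a weak (distributional) gradient of `u` in `Ω`. -/
def HasWeakGradient {d : ℕ} (Ω : Set (Space d)) (u : Space d → ℝ) (G : Space d → Space d) :
    Prop :=
  LocallyIntegrableOn u Ω ∧ LocallyIntegrableOn G Ω ∧
    ∀ φ : Space d → ℝ, IsTest Ω φ →
      ∫ x in Ω, u x • gradient φ x = -∫ x in Ω, φ x • G x

open Classical in
/-- A weak gradient of `u` in `Ω` (unique almost everywhere in an open set `Ω` if it exists). -/
def weakGrad {d : ℕ} (Ω : Set (Space d)) (u : Space d → ℝ) : Space d → Space d :=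
  if h : ∃ G, HasWeakGradient Ω u G then h.choose else 0

theorem IsTest.zero {d : ℕ} (Ω : Set (Space d)) : IsTest Ω (fun _ => 0) :=
  ⟨contDiff_const, HasCompactSupport.zero, by
    simp [tsupport, Function.support]⟩

theorem IsTest.add {d : ℕ} {Ω : Set (Space d)} {φ ψ : Space d → ℝ}
    (hφ : IsTest Ω φ) (hψ : IsTest Ω ψ) : IsTest Ω (φ + ψ) :=
  ⟨hφ.1.add hψ.1, hφ.2.1.add hψ.2.1,
    (tsupport_add φ ψ).trans (Set.union_subset hφ.2.2 hψ.2.2)⟩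

theorem IsTest.const_smul {d : ℕ} {Ω : Set (Space d)} {φ : Space d → ℝ}
    (hφ : IsTest Ω φ) (c : ℝ) : IsTest Ω (c • φ) :=
  ⟨contDiff_const.smul hφ.1, hφ.2.1.smul_left (f := fun _ => c),
    (tsupport_smul_subset_right (fun _ => c) φ).trans hφ.2.2⟩

theorem IsTest.continuous_gradient {d : ℕ} {Ω : Set (Space d)} {φ : Space d → ℝ}
    (hφ : IsTest Ω φ) : Continuous (gradient φ) :=
  (LinearIsometryEquiv.continuous _).comp (hφ.1.continuous_fderiv (by simp))

theorem IsTest.gradient_eq_zero {d : ℕ} {Ω : Set (Space d)} {φ : Space d → ℝ}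
    (_hφ : IsTest Ω φ) {x : Space d} (hx : x ∉ tsupport φ) : gradient φ x = 0 := by
  have : fderiv ℝ φ x = 0 := by
    by_contra h
    exact hx (support_fderiv_subset ℝ h)
  simp [gradient, this]

theorem IsTest.integrable_smul_gradient {d : ℕ} {Ω : Set (Space d)} {φ : Space d → ℝ}
    (hφ : IsTest Ω φ) {u : Space d → ℝ} (hu : LocallyIntegrableOn u Ω) :
    IntegrableOn (fun x => u x • gradient φ x) Ω := by
  have hK : IsCompact (tsupport φ) := hφ.2.1
  have h1 : IntegrableOn u (tsupport φ) := hu.integrableOn_compact_subset hφ.2.2 hK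
  have h2 : IntegrableOn (fun x => u x • gradient φ x) (tsupport φ) :=
    h1.smul_continuousOn hφ.continuous_gradient.continuousOn hK
  have h3 : Integrable (fun x => u x • gradient φ x) := by
    rw [← integrableOn_iff_integrable_of_support_subset (s := tsupport φ)]
    · exact h2
    · intro x hx
      by_contra hx'
      exact hx (by simp [hφ.gradient_eq_zero hx'])
  exact h3.integrableOn

theorem IsTest.integrable_smul {d : ℕ} {Ω : Set (Space d)} {φ : Space d → ℝ}
    (hφ : IsTest Ω φ) {G : Space d → Space d} (hG : LocallyIntegrableOn G Ω) :
    IntegrableOn (fun x => φ x • G x) Ω := by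
  have hK : IsCompact (tsupport φ) := hφ.2.1
  have h1 : IntegrableOn G (tsupport φ) := hG.integrableOn_compact_subset hφ.2.2 hK
  have h2 : IntegrableOn (fun x => φ x • G x) (tsupport φ) :=
    h1.continuousOn_smul hφ.1.continuous.continuousOn hK
  have h3 : Integrable (fun x => φ x • G x) := by
    rw [← integrableOn_iff_integrable_of_support_subset (s := tsupport φ)]
    · exact h2
    · intro x hx
      by_contra hx'
      exact hx (by simp [image_eq_zero_of_notMem_tsupport hx'])
  exact h3.integrableOn

theorem HasWeakGradient.zero {d : ℕ} (Ω : Set (Space d)) :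
    HasWeakGradient Ω (0 : Space d → ℝ) 0 :=
  ⟨locallyIntegrableOn_zero, locallyIntegrableOn_zero, by simp⟩

theorem HasWeakGradient.add {d : ℕ} {Ω : Set (Space d)} {u v : Space d → ℝ}
    {G H : Space d → Space d} (hu : HasWeakGradient Ω u G) (hv : HasWeakGradient Ω v H) :
    HasWeakGradient Ω (u + v) (G + H) := by
  refine ⟨hu.1.add hv.1, hu.2.1.add hv.2.1, fun φ hφ => ?_⟩
  simp only [Pi.add_apply, add_smul, smul_add]
  rw [integral_add (hφ.integrable_smul_gradient hu.1) (hφ.integrable_smul_gradient hv.1),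
    integral_add (hφ.integrable_smul hu.2.1) (hφ.integrable_smul hv.2.1),
    hu.2.2 φ hφ, hv.2.2 φ hφ, neg_add]

theorem HasWeakGradient.const_smul {d : ℕ} {Ω : Set (Space d)} {u : Space d → ℝ}
    {G : Space d → Space d} (hu : HasWeakGradient Ω u G) (c : ℝ) :
    HasWeakGradient Ω (c • u) (c • G) := by
  refine ⟨hu.1.smul c, hu.2.1.smul c, fun φ hφ => ?_⟩
  simp only [Pi.smul_apply, smul_assoc, smul_comm _ c]
  rw [integral_smul, integral_smul, hu.2.2 φ hφ, smul_neg]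

/-- The Sobolev space `W^{1,p}(Ω)`, as a space of functions (only their values in `Ω` matter;
functions that agree almost everywhere in `Ω` are identified in the quotient `BdryData`). -/
def W1p {d : ℕ} (Ω : Set (Space d)) (p : ℝ) : Submodule ℝ (Space d → ℝ) where
  carrier := {u | MemLp u (ENNReal.ofReal p) (volume.restrict Ω) ∧
    ∃ G, MemLp G (ENNReal.ofReal p) (volume.restrict Ω) ∧ HasWeakGradient Ω u G}
  zero_mem' := ⟨MemLp.zero, 0, MemLp.zero, HasWeakGradient.zero Ω⟩
  add_mem' := by
    rintro u v ⟨hu, G, hG, huG⟩ ⟨hv, H, hH, hvH⟩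
    exact ⟨hu.add hv, G + H, hG.add hH, huG.add hvH⟩
  smul_mem' := by
    rintro c u ⟨hu, G, hG, huG⟩
    exact ⟨hu.const_smul c, c • G, hG.const_smul c, huG.const_smul c⟩

/-- `W_0^{1,p}(Ω)`: the closure of the test functions in `W^{1,p}(Ω)`. -/
def W1p0 {d : ℕ} (Ω : Set (Space d)) (p : ℝ) : Submodule ℝ (W1p Ω p) where
  carrier := {u | ∃ G, MemLp G (ENNReal.ofReal p) (volume.restrict Ω) ∧
    HasWeakGradient Ω (u : Space d → ℝ) G ∧
    ∃ φ : ℕ → Space d → ℝ, (∀ n, IsTest Ω (φ n)) ∧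
      Tendsto (fun n => eLpNorm ((u : Space d → ℝ) - φ n) (ENNReal.ofReal p)
        (volume.restrict Ω)) atTop (𝓝 0) ∧
      Tendsto (fun n => eLpNorm (G - gradient (φ n)) (ENNReal.ofReal p)
        (volume.restrict Ω)) atTop (𝓝 0)}
  zero_mem' := by
    refine ⟨0, MemLp.zero, HasWeakGradient.zero Ω, fun _ _ => 0, fun _ => IsTest.zero Ω, ?_, ?_⟩
    · simp
    · simp
  add_mem' := by
    rintro u v ⟨G, hG, huG, φ, hφ, h1, h2⟩ ⟨H, hH, hvH, ψ, hψ, h3, h4⟩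
    have hC : ENNReal.LpAddConst (ENNReal.ofReal p) ≠ ⊤ := (ENNReal.LpAddConst_lt_top _).ne
    refine ⟨G + H, hG.add hH, huG.add hvH, fun n => φ n + ψ n, fun n => (hφ n).add (hψ n),
      ?_, ?_⟩
    · have key := ENNReal.Tendsto.const_mul (a := ENNReal.LpAddConst (ENNReal.ofReal p))
        (h1.add h3) (Or.inr hC)
      rw [add_zero, mul_zero] at key
      refine tendsto_of_tendsto_of_tendsto_of_le_of_le tendsto_const_nhds key
        (fun _ => zero_le) (fun n => ?_)
      have : ((u + v : W1p Ω p) : Space d → ℝ) - (φ n + ψ n)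
          = ((u : Space d → ℝ) - φ n) + ((v : Space d → ℝ) - ψ n) := by
        ext; simp; ring
      simp only [this]
      exact eLpNorm_add_le'
        (u.2.1.1.sub (hφ n).1.continuous.aestronglyMeasurable)
        (v.2.1.1.sub (hψ n).1.continuous.aestronglyMeasurable) _
    · have key := ENNReal.Tendsto.const_mul (a := ENNReal.LpAddConst (ENNReal.ofReal p))
        (h2.add h4) (Or.inr hC)
      rw [add_zero, mul_zero] at key
      refine tendsto_of_tendsto_of_tendsto_of_le_of_le tendsto_const_nhds key
        (fun _ => zero_le) (fun n => ?_)
      have : (G + H) - gradient (φ n + ψ n)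
          = (G - gradient (φ n)) + (H - gradient (ψ n)) := by
        ext1 x
        have e : gradient (φ n + ψ n) x = gradient (φ n) x + gradient (ψ n) x := by
          have a := ((hφ n).1.differentiable (by simp)) x
          have b := ((hψ n).1.differentiable (by simp)) x
          simp [gradient, fderiv_add a b]
        simp only [Pi.sub_apply, Pi.add_apply, e]
        abel
      simp only [this]
      exact eLpNorm_add_le'
        (hG.1.sub (hφ n).continuous_gradient.aestronglyMeasurable)
        (hH.1.sub (hψ n).continuous_gradient.aestronglyMeasurable) _
  smul_mem' := by
    rintro c u ⟨G, hG, huG, φ, hφ, h1, h2⟩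
    refine ⟨c • G, hG.const_smul c, huG.const_smul c, fun n => c • φ n,
      fun n => (hφ n).const_smul c, ?_, ?_⟩
    · have key := ENNReal.Tendsto.const_mul (a := ‖c‖ₑ) h1 (Or.inr enorm_ne_top)
      rw [mul_zero] at key
      refine key.congr (fun n => ?_)
      have : ((c • u : W1p Ω p) : Space d → ℝ) - c • φ n
          = c • ((u : Space d → ℝ) - φ n) := by
        ext; simp; ring
      rw [this, eLpNorm_const_smul]
    · have key := ENNReal.Tendsto.const_mul (a := ‖c‖ₑ) h2 (Or.inr enorm_ne_top)
      rw [mul_zero] at key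
      refine key.congr (fun n => ?_)
      have : c • G - gradient (c • φ n) = c • (G - gradient (φ n)) := by
        ext1 x
        have e : gradient (c • φ n) x = c • gradient (φ n) x := by
          have a := ((hφ n).1.differentiable (by simp)) x
          simp [gradient, fderiv_const_smul a]
        simp only [Pi.sub_apply, Pi.smul_apply, e, smul_sub]
      rw [this, eLpNorm_const_smul]

/-- The space of Dirichlet boundary values `X = W^{1,p}(Ω) / W_0^{1,p}(Ω)`. -/
abbrev BdryData {d : ℕ} (Ω : Set (Space d)) (p : ℝ) : Type := W1p Ω p ⧸ W1p0 Ω p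

open Classical in
/-- The boundary values of a function `f`; the default value `0` is taken only if
`f` is not in `W^{1,p}(Ω)`. -/
def bdryValue {d : ℕ} (Ω : Set (Space d)) (p : ℝ) (f : Space d → ℝ) : BdryData Ω p :=
  if h : f ∈ W1p Ω p then Submodule.Quotient.mk ⟨f, h⟩ else 0

/-! ### The forward problem and the Dirichlet to Neumann map -/

/-- The insulating region `D_0`, where the conductivity vanishes. -/
def insulating {d : ℕ} (Ω : Set (Space d)) (σ : Space d → ℝ≥0∞) : Set (Space d) :=
  {x ∈ Ω | σ x = 0}

/-- The perfectly conducting region `D_∞`, where the conductivity is infinite. -/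
def superconducting {d : ℕ} (Ω : Set (Space d)) (σ : Space d → ℝ≥0∞) : Set (Space d) :=
  {x ∈ Ω | σ x = ⊤}

/-- The energy `E(u) = ∫_Ω σ |∇u|^p`, with values in `[0, ∞]` and `∞ · 0 = 0`. -/
def energy {d : ℕ} (Ω : Set (Space d)) (p : ℝ) (σ : Space d → ℝ≥0∞) (u : W1p Ω p) : ℝ≥0∞ :=
  ∫⁻ x in Ω, σ x * ‖weakGrad Ω (u : Space d → ℝ) x‖ₑ ^ p

/-- `u` minimizes the energy among the functions with boundary values `F`. -/
def IsMinimizer {d : ℕ} (Ω : Set (Space d)) (p : ℝ) (σ : Space d → ℝ≥0∞)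
    (F : BdryData Ω p) (u : W1p Ω p) : Prop :=
  Submodule.Quotient.mk u = F ∧
    ∀ v : W1p Ω p, Submodule.Quotient.mk v = F → energy Ω p σ u ≤ energy Ω p σ v

/-- `v` is an extension of the boundary values `G` with zero gradient in `D_∞`. -/
def IsExtension {d : ℕ} (Ω : Set (Space d)) (p : ℝ) (σ : Space d → ℝ≥0∞)
    (G : BdryData Ω p) (v : W1p Ω p) : Prop :=
  Submodule.Quotient.mk v = G ∧
    ∀ᵐ x ∂(volume.restrict (superconducting Ω σ)), weakGrad Ω (v : Space d → ℝ) x = 0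

/-- `∫_Ω σ |∇u|^{p-2} ∇u · ∇v`. The integrand vanishes where `σ = ∞`; for a minimizer `u` of
finite energy and an extension `v` both gradients vanish there. -/
def fluxPairing {d : ℕ} (Ω : Set (Space d)) (p : ℝ) (σ : Space d → ℝ≥0∞) (u v : W1p Ω p) : ℝ :=
  ∫ x in Ω, (σ x).toReal * ‖weakGrad Ω (u : Space d → ℝ) x‖ ^ (p - 2) *
    inner ℝ (weakGrad Ω (u : Space d → ℝ) x) (weakGrad Ω (v : Space d → ℝ) x)

open Classical in
/-- The weak Dirichlet to Neumann map `Λ_σ`, as the pairing `⟨Λ_σ F, G⟩` of boundary values: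
the flux pairing of any energy minimizer with boundary values `F` and any extension of `G` with
zero gradient in `D_∞`. -/
def dnMap {d : ℕ} (Ω : Set (Space d)) (p : ℝ) (σ : Space d → ℝ≥0∞) :
    BdryData Ω p → BdryData Ω p → ℝ := fun F G =>
  if h : ∃ uv : W1p Ω p × W1p Ω p, IsMinimizer Ω p σ F uv.1 ∧ IsExtension Ω p σ G uv.2 then
    fluxPairing Ω p σ h.choose.1 h.choose.2
  else 0

/-! ### Lipschitz boundary -/

/-- `D` is an open set with Lipschitz boundary: near each boundary point, `D` is the part of
space on one side of the graph of a Lipschitz function over the hyperplane orthogonal to some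
unit vector `e`. -/
def HasLipschitzBoundary {d : ℕ} (D : Set (Space d)) : Prop :=
  IsOpen D ∧ ∀ x ∈ frontier D, ∃ (e : Space d) (r : ℝ) (K : NNReal) (φ : Space d → ℝ),
    ‖e‖ = 1 ∧ 0 < r ∧ LipschitzWith K φ ∧
    ∀ y ∈ Metric.ball x r, y ∈ D ↔ φ (y - inner ℝ e y • e) < inner ℝ e y

/-! ### Wolff solutions, the indicator function and the enclosure -/

/-- The coefficient `V(a, b)` of Wolff's differential equation. -/
def wolffV (p a b : ℝ) : ℝ :=
  ((2 * p - 3) * b ^ 2 + (p - 1) * a ^ 2) / ((p - 1) * b ^ 2 + a ^ 2)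

/-- `w` is a nontrivial solution of `w'' + V(w, w') w = 0`. -/
def IsWolffProfile (p : ℝ) (w : ℝ → ℝ) : Prop :=
  ContDiff ℝ 2 w ∧ (w 0, deriv w 0) ≠ (0, 0) ∧
    ∀ s, deriv (deriv w) s + wolffV p (w s) (deriv w s) * w s = 0

/-- The Wolff solution `x ↦ e^{τ(ρ·x - t)} w(τ ρ^⊥·x)`, where `η` stands for `ρ^⊥`. -/
def wolffSolution {d : ℕ} (w : ℝ → ℝ) (t : ℝ) (ρ η : Space d) (τ : ℝ) (x : Space d) : ℝ :=
  Real.exp (τ * (inner ℝ ρ x - t)) * w (τ * inner ℝ η x)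

/-- The indicator function `I(t, ρ, ρ^⊥, τ) = τ^{d-p} ⟨(Λ - Λ_γ) f, f⟩`, where `f` is a Wolff
solution and `γ` is the background conductivity. It is a function of the Dirichlet to Neumann
map `Λ` alone, once `Ω`, `p`, `γ` and the profile `w` are fixed. -/
def indicator {d : ℕ} (Ω : Set (Space d)) (p γ : ℝ) (w : ℝ → ℝ)
    (Λ : BdryData Ω p → BdryData Ω p → ℝ) (t : ℝ) (ρ η : Space d) (τ : ℝ) : ℝ :=
  τ ^ ((d : ℝ) - p) *
    (Λ (bdryValue Ω p (wolffSolution w t ρ η τ)) (bdryValue Ω p (wolffSolution w t ρ η τ)) -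
      dnMap Ω p (fun _ => ENNReal.ofReal γ)
        (bdryValue Ω p (wolffSolution w t ρ η τ)) (bdryValue Ω p (wolffSolution w t ρ η τ)))

/-- The half-space `{x | t ≤ ρ·x}` of high energy is detected by `Λ` with the auxiliary direction
`η = ρ^⊥`: the absolute value of the indicator stays above a positive constant for large `τ`. -/
def Detects {d : ℕ} (Ω : Set (Space d)) (p γ : ℝ) (w : ℝ → ℝ)
    (Λ : BdryData Ω p → BdryData Ω p → ℝ) (t : ℝ) (ρ η : Space d) : Prop :=
  ∃ c : ℝ, 0 < c ∧ ∀ᶠ τ : ℝ in atTop, c ≤ |indicator Ω p γ w Λ t ρ η τ|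

/-- The set `D'` found from the Dirichlet to Neumann map `Λ` by the enclosure method: what is
left of space after removing all half-spaces `{x | t ≤ ρ·x}` that are not detected. -/
def enclosure {d : ℕ} (Ω : Set (Space d)) (p γ : ℝ) (w : ℝ → ℝ)
    (Λ : BdryData Ω p → BdryData Ω p → ℝ) : Set (Space d) :=
  {x | ∀ (t : ℝ) (ρ η : Space d), ‖ρ‖ = 1 → ‖η‖ = 1 → inner ℝ ρ η = 0 →
    ¬ Detects Ω p γ w Λ t ρ η → inner ℝ ρ x < t}

end PCalderon

end

noncomputable section

namespace PCalderon

/-! ### Wolff profiles -/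

/-! The proof is a two-sided energy estimate for ⟨(Λ_σ - Λ_γ)f, f⟩ at a Wolff solution f, valid for
every τ > 0. On the diagonal the DN map is the minimal energy (`HasInclusions.dnMap_self`), by the
Euler-Lagrange equation. Wolff solutions are p-harmonic (`IsWolffProfile.isPHarmonic`), so ⟨Λ_γ f,
f⟩ = γ∫_Ω|∇f|^p.

If D is insulating, f itself is a competitor, and its energy misses the part over D: the difference
is at most -γ∫_D|∇f|^p, and at least -γ∫_Ω|∇f|^p. If D is superconducting, every competitor u has ∇u
= 0 in D. Integrating the tangent inequality |a|^p ≥ |b|^p + p|b|^(p-2) b·(a-b) with a = ∇u, b = ∇f,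
the linear term disappears by p-harmonicity, and the points with a = 0 leave a surplus (p-1)|b|^p:
the difference is at least γ(p-1)∫_D|∇f|^p. From above it is bounded by the energy of (1-χ)f, with a
cutoff χ equal to 1 on D. Since |∇f| = τ e^(τ(ρ·x-t)) √(w²+w'²) never vanishes, the sign of the
indicator reveals the type of the inclusion.

For the enclosure, w²+w'² lies between positive constants (`IsWolffProfile.exists_bounds`). If the
open set D meets {ρ·x ≥ t}, the integral over D is at least a multiple of τ^p, and the factor
τ^(d-p) leaves the indicator bounded below. If Ω stays at positive distance from the half-space, the
upper bounds decay exponentially. Hence no removed half-space meets D, while each point outside the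
closed convex hull of Ω is separated from Ω by a removed one.

These estimates need minimizers to exist, as the DN map is 0 by default otherwise. Closed convex
sets in L^p have elements of minimal norm, by uniform convexity (`exists_minimal_norm`). For
superconductors the constraint is a closed linear one. For insulators the energy sees only the
restriction of ∇u to the complement of D, and such restrictions must be shown to form a closed set
(`isClosed_image_restrictCompl`). This is where the Lipschitz boundary is used: reflecting across
the boundary extends functions into D with a gradient estimate, up to finitely many linear
functionals, which an approximation argument disposes of. -/

/-- The inverse of the phase function of a Wolff profile. -/
def wolffTime (p θ : ℝ) : ℝ :=
  θ * ((1 + 1 / (p - 1)) / 2) + Real.sin (2 * θ) * ((1 / (p - 1) - 1) / 4)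

/-- With w = r cos Θ and w' = -r sin Θ, Wolff's equation gives the autonomous phase equation Θ' =
(sin²Θ + cos²Θ/(p-1))⁻¹, so that time is an explicit antiderivative in the phase. -/
theorem hasDerivAt_wolffTime (p θ : ℝ) :
    HasDerivAt (wolffTime p) (Real.sin θ ^ 2 + 1 / (p - 1) * Real.cos θ ^ 2) θ := by
  have h1 := (hasDerivAt_id θ).mul_const ((1 + 1 / (p - 1)) / 2)
  have h2 := (((hasDerivAt_id θ).const_mul 2).sin).mul_const ((1 / (p - 1) - 1) / 4)
  refine (h1.add h2).congr_deriv ?_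
  simp only [id, Real.cos_two_mul]
  have := Real.sin_sq_add_cos_sq θ
  linear_combination -this

theorem wolffTime_deriv_pos {p : ℝ} (hp : 1 < p) (θ : ℝ) :
    0 < Real.sin θ ^ 2 + 1 / (p - 1) * Real.cos θ ^ 2 := by
  have hq : 0 < 1 / (p - 1) := by have : 0 < p - 1 := by linarith
                                  positivity
  have := Real.sin_sq_add_cos_sq θ
  rcases eq_or_ne (Real.sin θ) 0 with h | h
  · have h2 : Real.cos θ ^ 2 = 1 := by rw [h] at this; linarith
    rw [h, h2]; linarith
  · have := pow_pos (abs_pos.2 h) 2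
    rw [sq_abs] at this
    positivity

/-- A linear term of positive slope plus a bounded oscillation tends to ±∞. -/
theorem wolffTime_surjective {p : ℝ} (hp : 1 < p) : Function.Surjective (wolffTime p) := by
  have hq : 0 < 1 / (p - 1) := by have : 0 < p - 1 := by linarith
                                  positivity
  have hc : Continuous (wolffTime p) :=
    continuous_iff_continuousAt.2 fun θ => (hasDerivAt_wolffTime p θ).continuousAt
  have hk : 0 < (1 + 1 / (p - 1)) / 2 := by linarith
  have hb : ∀ θ : ℝ, |Real.sin (2 * θ) * ((1 / (p - 1) - 1) / 4)| ≤ |(1 / (p - 1) - 1) / 4| := by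
    intro θ
    rw [abs_mul]
    exact mul_le_of_le_one_left (abs_nonneg _) (Real.abs_sin_le_one _)
  refine hc.surjective ?_ ?_
  · refine tendsto_atTop_mono (f := fun θ => θ * ((1 + 1 / (p - 1)) / 2) +
      -|(1 / (p - 1) - 1) / 4|) (fun θ => ?_)
      (tendsto_atTop_add_const_right _ _ (tendsto_id.atTop_mul_const hk))
    have := (abs_le.1 (hb θ)).1
    simp only [wolffTime]; linarith
  · refine tendsto_atBot_mono (g := wolffTime p) (f := fun θ => θ * ((1 + 1 / (p - 1)) / 2) +
      |(1 / (p - 1) - 1) / 4|) (fun θ => ?_)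
      (tendsto_atBot_add_const_right _ _ (tendsto_id.atBot_mul_const hk))
    have := (abs_le.1 (hb θ)).2
    simp only [wolffTime]; linarith

/-- A phase function: a differentiable inverse of `wolffTime`. -/
theorem exists_wolffPhase {p : ℝ} (hp : 1 < p) : ∃ Θ : ℝ → ℝ, ∀ s,
    HasDerivAt Θ (Real.sin (Θ s) ^ 2 + 1 / (p - 1) * Real.cos (Θ s) ^ 2)⁻¹ s := by
  have hmono : StrictMono (wolffTime p) := strictMono_of_hasDerivAt_pos
    (hasDerivAt_wolffTime p) (wolffTime_deriv_pos hp)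
  let e := hmono.orderIsoOfSurjective _ (wolffTime_surjective hp)
  refine ⟨e.symm, fun s => ?_⟩
  refine HasDerivAt.of_local_left_inverse (f := wolffTime p) e.symm.continuous.continuousAt
    (hasDerivAt_wolffTime p _) (wolffTime_deriv_pos hp _).ne' (Eventually.of_forall fun y => ?_)
  exact e.apply_symm_apply y

/-- In polar coordinates of the phase plane the amplitude is an explicit function of the phase, r =
exp(κ sin²Θ). The profile r cos Θ is therefore defined on all of ℝ as soon as Θ is. -/
theorem exists_isWolffProfile {p : ℝ} (hp : 1 < p) : ∃ w : ℝ → ℝ, IsWolffProfile p w := by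
  obtain ⟨Θ, hΘ⟩ := exists_wolffPhase hp
  have hp1 : p - 1 ≠ 0 := by linarith
  set κ := (p - 2) / (2 * (p - 1)) with hκ
  set g : ℝ → ℝ := fun s => (Real.sin (Θ s) ^ 2 + 1 / (p - 1) * Real.cos (Θ s) ^ 2)⁻¹ with hg
  have hΘc : Continuous Θ := continuous_iff_continuousAt.2 fun s => (hΘ s).continuousAt
  have hpos : ∀ s, 0 < Real.sin (Θ s) ^ 2 + 1 / (p - 1) * Real.cos (Θ s) ^ 2 :=
    fun s => wolffTime_deriv_pos hp _
  have hgc : Continuous g := by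
    refine Continuous.inv₀ (by fun_prop) fun s => (hpos s).ne'
  have hΘ1 : ContDiff ℝ 1 Θ := by
    rw [contDiff_one_iff_deriv]
    refine ⟨fun s => (hΘ s).differentiableAt, ?_⟩
    rw [funext fun s => (hΘ s).deriv]
    exact hgc
  set r : ℝ → ℝ := fun s => Real.exp (κ * Real.sin (Θ s) ^ 2) with hr
  have hrd : ∀ s, HasDerivAt r (r s * (κ * (2 * Real.sin (Θ s) * (Real.cos (Θ s) * g s)))) s := by
    intro s
    refine (((hΘ s).sin.pow 2).const_mul κ).exp.congr_deriv ?_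
    simp [hr, hg]
  have hW : ∀ s, HasDerivAt (fun s => r s * Real.cos (Θ s)) (-(r s * Real.sin (Θ s))) s := by
    intro s
    refine ((hrd s).mul (hΘ s).cos).congr_deriv (Eq.symm ?_)
    have h := hpos s
    have hsc := Real.sin_sq_add_cos_sq (Θ s)
    have hgs : g s * (Real.sin (Θ s) ^ 2 + 1 / (p - 1) * Real.cos (Θ s) ^ 2) = 1 :=
      inv_mul_cancel₀ h.ne'
    have hgs' : (Real.sin (Θ s) ^ 2 + 1 / (p - 1) * Real.cos (Θ s) ^ 2)⁻¹ = g s := rfl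
    rw [hgs']
    -- The requirement (r cos Θ)' = -r sin Θ amounts to 2κ cos²Θ · Θ' - Θ' = -1, and this determines
    -- κ.
    have hk : 2 * κ = 1 - 1 / (p - 1) := by rw [hκ]; field_simp; ring
    have : κ * 2 * Real.cos (Θ s) ^ 2 * g s - g s = -1 := by
      linear_combination g s * Real.cos (Θ s) ^ 2 * hk - hgs + g s * hsc
    linear_combination (-(r s) * Real.sin (Θ s)) * this
  have hder : deriv (fun s => r s * Real.cos (Θ s)) = fun s => -(r s * Real.sin (Θ s)) :=
    funext fun s => (hW s).deriv
  have hW' : ∀ s, HasDerivAt (fun s => -(r s * Real.sin (Θ s)))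
      (-(r s * Real.cos (Θ s) * (g s + 2 * κ * Real.sin (Θ s) ^ 2 * g s))) s := by
    intro s
    refine ((hrd s).mul (hΘ s).sin).neg.congr_deriv ?_
    simp only [hg]
    ring
  refine ⟨fun s => r s * Real.cos (Θ s), ?_, ?_, ?_⟩
  · rw [show (2 : WithTop ℕ∞) = 1 + 1 from rfl, contDiff_succ_iff_deriv]
    refine ⟨fun s => (hW s).differentiableAt, by simp, ?_⟩
    rw [hder]
    have : ContDiff ℝ 1 r := by
      simp only [hr]
      exact ((contDiff_const.mul ((Real.contDiff_sin.comp hΘ1).pow 2))).exp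
    exact (this.mul (Real.contDiff_sin.comp hΘ1)).neg
  · rw [hder]
    intro h
    simp only [Prod.mk.injEq] at h
    have hr0 : r 0 ≠ 0 := (Real.exp_pos _).ne'
    have h1 : Real.cos (Θ 0) = 0 := by simpa [hr0] using h.1
    have h2 : Real.sin (Θ 0) = 0 := by simpa [hr0] using h.2
    have := Real.sin_sq_add_cos_sq (Θ 0)
    rw [h1, h2] at this
    norm_num at this
  · intro s
    rw [hder, (hW' s).deriv]
    have hr0 : r s ≠ 0 := (Real.exp_pos _).ne'
    have hsc := Real.sin_sq_add_cos_sq (Θ s)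
    have h := hpos s
    set c := Real.cos (Θ s)
    set n := Real.sin (Θ s)
    have hden : (p - 1) * n ^ 2 + c ^ 2 = (p - 1) * (n ^ 2 + 1 / (p - 1) * c ^ 2) := by
      field_simp
    have hden0 : (p - 1) * n ^ 2 + c ^ 2 ≠ 0 := by
      rw [hden]; exact mul_ne_zero hp1 h.ne'
    have hV : wolffV p (r s * c) (-(r s * n)) =
        ((2 * p - 3) * n ^ 2 + (p - 1) * c ^ 2) / ((p - 1) * n ^ 2 + c ^ 2) := by
      unfold wolffV
      rw [show (2 * p - 3) * (-(r s * n)) ^ 2 + (p - 1) * (r s * c) ^ 2 =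
        r s ^ 2 * ((2 * p - 3) * n ^ 2 + (p - 1) * c ^ 2) by ring,
        show (p - 1) * (-(r s * n)) ^ 2 + (r s * c) ^ 2 =
        r s ^ 2 * ((p - 1) * n ^ 2 + c ^ 2) by ring, mul_div_mul_left _ _ (pow_ne_zero 2 hr0)]
    rw [hV]
    have hgs : g s = (p - 1) / ((p - 1) * n ^ 2 + c ^ 2) := by
      simp only [hg]
      rw [hden, div_mul_cancel_left₀ hp1]
    have : ((2 * p - 3) * n ^ 2 + (p - 1) * c ^ 2) / ((p - 1) * n ^ 2 + c ^ 2) =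
        g s + 2 * κ * n ^ 2 * g s := by
      have hk : 2 * κ * (p - 1) = p - 2 := by rw [hκ]; field_simp
      rw [hgs, mul_div_assoc', ← add_div]
      congr 1
      linear_combination (p - 1) * hsc - n ^ 2 * hk
    rw [this]
    ring

/-! ### Nonvanishing and boundedness of arbitrary Wolff profiles -/

theorem IsWolffProfile.hasDerivAt {p : ℝ} {w : ℝ → ℝ} (hw : IsWolffProfile p w) (s : ℝ) :
    HasDerivAt w (deriv w s) s :=
  (hw.1.differentiable (by simp) s).hasDerivAt

theorem IsWolffProfile.contDiff_deriv {p : ℝ} {w : ℝ → ℝ} (hw : IsWolffProfile p w) :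
    ContDiff ℝ 1 (deriv w) := by
  have := hw.1
  rw [show (2 : WithTop ℕ∞) = 1 + 1 from rfl, contDiff_succ_iff_deriv] at this
  exact this.2.2

theorem IsWolffProfile.hasDerivAt_deriv {p : ℝ} {w : ℝ → ℝ} (hw : IsWolffProfile p w) (s : ℝ) :
    HasDerivAt (deriv w) (-(wolffV p (w s) (deriv w s) * w s)) s := by
  have := (hw.contDiff_deriv.differentiable (by simp) s).hasDerivAt
  rwa [eq_neg_of_add_eq_zero_left (hw.2.2 s)] at this

theorem wolffV_denom_pos {p : ℝ} (hp : 1 < p) {a b : ℝ} (h : 0 < a ^ 2 + b ^ 2) :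
    0 < (p - 1) * b ^ 2 + a ^ 2 := by
  rcases eq_or_ne b 0 with rfl | hb
  · simpa using h
  · have : 0 < b ^ 2 := by positivity
    have : 0 < (p - 1) * b ^ 2 := mul_pos (by linarith) this
    nlinarith [sq_nonneg a]

/-- Here 1 - V = -(p-2)(a²+b²)/((p-1)b²+a²), and the denominator is at least min(1, p-1)(a²+b²). The
quantity estimated is the derivative of w²+w'² along a profile, so this prepares a Gronwall
argument. -/
theorem abs_one_sub_wolffV_le {p : ℝ} (hp : 1 < p) : ∃ M : ℝ, 0 ≤ M ∧ ∀ a b : ℝ,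
    |2 * a * b * (1 - wolffV p a b)| ≤ M * (a ^ 2 + b ^ 2) := by
  set m := min 1 (p - 1)
  have hm : 0 < m := lt_min one_pos (by linarith)
  refine ⟨|p - 2| / m, by positivity, fun a b => ?_⟩
  rcases (add_nonneg (sq_nonneg a) (sq_nonneg b)).eq_or_lt with h | h
  · have ha : a = 0 := by nlinarith [sq_nonneg a, sq_nonneg b]
    simp [ha]
    positivity
  · have hP := wolffV_denom_pos hp h
    have hPm : m * (a ^ 2 + b ^ 2) ≤ (p - 1) * b ^ 2 + a ^ 2 := by
      have h1 : m ≤ 1 := min_le_left _ _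
      have h2 : m ≤ p - 1 := min_le_right _ _
      nlinarith [sq_nonneg a, sq_nonneg b]
    have hV : 1 - wolffV p a b = -(p - 2) * (a ^ 2 + b ^ 2) / ((p - 1) * b ^ 2 + a ^ 2) := by
      unfold wolffV
      rw [eq_div_iff hP.ne', sub_mul, one_mul, div_mul_cancel₀ _ hP.ne']
      ring
    have hV' : |1 - wolffV p a b| ≤ |p - 2| / m := by
      rw [hV, abs_div, abs_mul, abs_neg, abs_of_pos h, abs_of_pos hP, div_le_div_iff₀ hP hm]
      have := mul_le_mul_of_nonneg_left hPm (abs_nonneg (p - 2))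
      linarith
    have hab : |2 * a * b| ≤ a ^ 2 + b ^ 2 := by
      rw [abs_le]; constructor <;> nlinarith [sq_nonneg (a - b), sq_nonneg (a + b)]
    rw [abs_mul, mul_comm]
    exact mul_le_mul hV' hab (abs_nonneg _) (by positivity)

theorem IsWolffProfile.hasDerivAt_sq {p : ℝ} {w : ℝ → ℝ} (hw : IsWolffProfile p w) (s : ℝ) :
    HasDerivAt (fun s => w s ^ 2 + deriv w s ^ 2)
      (2 * w s * deriv w s * (1 - wolffV p (w s) (deriv w s))) s := by
  refine (((hw.hasDerivAt s).pow 2).add ((hw.hasDerivAt_deriv s).pow 2)).congr_deriv ?_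
  simp
  ring

/-- Gronwall in both directions: Q e^(Ms) is nondecreasing and Q e^(-Ms) is nonincreasing, where Q =
w²+w'² is positive at 0. -/
theorem IsWolffProfile.sq_pos {p : ℝ} (hp : 1 < p) {w : ℝ → ℝ} (hw : IsWolffProfile p w) (s : ℝ) :
    0 < w s ^ 2 + deriv w s ^ 2 := by
  obtain ⟨M, hM, hMb⟩ := abs_one_sub_wolffV_le hp
  set Q : ℝ → ℝ := fun s => w s ^ 2 + deriv w s ^ 2 with hQ
  have h0 : 0 < Q 0 := by
    have h := hw.2.1
    simp only [ne_eq, Prod.mk.injEq, not_and_or] at h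
    rcases h with h | h
    · have : 0 < w 0 ^ 2 := by positivity
      simp only [hQ]; positivity
    · have : 0 < deriv w 0 ^ 2 := by positivity
      simp only [hQ]; positivity
  have hd := hw.hasDerivAt_sq
  have hup : Monotone fun s => Q s * Real.exp (M * s) := by
    refine monotone_of_hasDerivAt_nonneg (fun s => (hd s).mul
      (((hasDerivAt_id s).const_mul M).exp)) fun s => ?_
    have := (abs_le.1 (hMb (w s) (deriv w s))).1
    have he := Real.exp_pos (M * s)
    simp only [id, Pi.zero_apply]
    nlinarith
  have hdown : Antitone fun s => Q s * Real.exp (-M * s) := by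
    refine antitone_of_hasDerivAt_nonpos (fun s => (hd s).mul
      (((hasDerivAt_id s).const_mul (-M)).exp)) fun s => ?_
    have := (abs_le.1 (hMb (w s) (deriv w s))).2
    have he := Real.exp_pos (-M * s)
    simp only [id, Pi.zero_apply]
    nlinarith
  rcases le_total 0 s with h | h
  · have := hup h
    simp only [mul_zero, Real.exp_zero, mul_one] at this
    exact pos_of_mul_pos_left (h0.trans_le this) (Real.exp_pos _).le
  · have := hdown h
    simp only [mul_zero, Real.exp_zero, mul_one] at this
    exact pos_of_mul_pos_left (h0.trans_le this) (Real.exp_pos _).le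

/-- A Wolff profile and its derivative are bounded, and bounded away from zero. -/
theorem IsWolffProfile.exists_bounds {p : ℝ} (hp : 1 < p) {w : ℝ → ℝ} (hw : IsWolffProfile p w) :
    ∃ c C : ℝ, 0 < c ∧ ∀ s, c ≤ w s ^ 2 + deriv w s ^ 2 ∧ w s ^ 2 + deriv w s ^ 2 ≤ C := by
  have hp1 : p - 1 ≠ 0 := by linarith
  set κ := (p - 2) / (2 * (p - 1)) with hκ
  set Q : ℝ → ℝ := fun s => w s ^ 2 + deriv w s ^ 2 with hQ
  have hQp : ∀ s, 0 < Q s := hw.sq_pos hp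
  -- The explicit profile has Q = r² = exp(2κ sin²Θ) with sin²Θ = w'²/Q. This suggests a first
  -- integral for every profile; it confines log Q to within 2|κ| of a constant.
  set J : ℝ → ℝ := fun s => Real.log (Q s) - 2 * κ * (deriv w s ^ 2 / Q s) with hJ
  have hJd : ∀ s, HasDerivAt J 0 s := by
    intro s
    have h1 := (hw.hasDerivAt_sq s).log (hQp s).ne'
    have h2 := ((hw.hasDerivAt_deriv s).pow 2).div (hw.hasDerivAt_sq s) (hQp s).ne'
    refine (h1.sub (h2.const_mul (2 * κ))).congr_deriv (Eq.symm ?_)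
    have hP := wolffV_denom_pos hp (hQp s)
    have hq := hQp s
    simp only [hQ] at hq
    have hk : 2 * κ * (p - 1) = p - 2 := by rw [hκ]; field_simp
    simp only [Nat.cast_ofNat, Nat.add_one_sub_one, pow_one, Pi.pow_apply]
    have hV : wolffV p (w s) (deriv w s) * ((p - 1) * deriv w s ^ 2 + w s ^ 2) =
        (2 * p - 3) * deriv w s ^ 2 + (p - 1) * w s ^ 2 := div_mul_cancel₀ _ hP.ne'
    generalize wolffV p (w s) (deriv w s) = V at *
    generalize w s = a at *
    generalize deriv w s = b at *
    refine mul_right_cancel₀ (mul_pos hP (pow_pos hq 2)).ne' ?_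
    have e : (2 * a * b * (1 - V) / (a ^ 2 + b ^ 2) - 2 * κ * ((2 * b * -(V * a) * (a ^ 2 + b ^ 2) -
        b ^ 2 * (2 * a * b * (1 - V))) / (a ^ 2 + b ^ 2) ^ 2)) * (a ^ 2 + b ^ 2) ^ 2 =
        2 * a * b * (1 - V) * (a ^ 2 + b ^ 2) - 2 * κ * (2 * b * -(V * a) * (a ^ 2 + b ^ 2) -
        b ^ 2 * (2 * a * b * (1 - V))) := by
      field_simp
    rw [mul_comm ((p - 1) * b ^ 2 + a ^ 2), zero_mul, ← mul_assoc, e]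
    linear_combination (-2 * a * b * (-(a ^ 2 + b ^ 2) + 2 * κ * a ^ 2)) * hV -
      2 * a * b * (a ^ 2 + b ^ 2) ^ 2 * hk
  have hconst : ∀ s, J s = J 0 := fun s =>
    is_const_of_deriv_eq_zero (fun s => (hJd s).differentiableAt) (fun s => (hJd s).deriv) s 0
  have hb : ∀ s, |Real.log (Q s) - J 0| ≤ 2 * |κ| := by
    intro s
    rw [← hconst s]
    simp only [hJ]
    rw [sub_sub_cancel, abs_mul, abs_mul, abs_two]
    refine mul_le_of_le_one_right (by positivity) ?_
    rw [abs_of_nonneg (div_nonneg (sq_nonneg _) (hQp s).le), div_le_one (hQp s)]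
    simp only [hQ]
    nlinarith [sq_nonneg (w s)]
  refine ⟨Real.exp (J 0 - 2 * |κ|), Real.exp (J 0 + 2 * |κ|), Real.exp_pos _, fun s => ?_⟩
  have := abs_le.1 (hb s)
  constructor
  · rw [← Real.le_log_iff_exp_le (hQp s)]; linarith
  · rw [← Real.log_le_iff_le_exp (hQp s)]; linarith

section

/-! ### Convexity of the `p`-th power of the norm -/

section Pointwise

variable {E : Type*} [NormedAddCommGroup E] [InnerProductSpace ℝ E]

theorem norm_rpow_sub_two_mul_inner_self {p : ℝ} (hp : 1 < p) (b : E) :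
    ‖b‖ ^ (p - 2) * inner ℝ b b = ‖b‖ ^ p := by
  rcases eq_or_ne b 0 with rfl | hb
  · simp [Real.zero_rpow (by linarith : p ≠ 0)]
  · rw [real_inner_self_eq_norm_sq, ← Real.rpow_natCast, ← Real.rpow_add (norm_pos_iff.2 hb)]
    congr 1
    push_cast
    ring

theorem norm_rpow_sub_two_mul_norm {F : Type*} [NormedAddCommGroup F] {p : ℝ} (hp : 1 < p)
    (b : F) :
    ‖b‖ ^ (p - 2) * ‖b‖ = ‖b‖ ^ (p - 1) := by
  rcases eq_or_ne b 0 with rfl | hb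
  · simp [Real.zero_rpow (by linarith : p - 1 ≠ 0)]
  · nth_rw 2 [← Real.rpow_one ‖b‖]
    rw [← Real.rpow_add (norm_pos_iff.2 hb)]
    congr 1
    ring

/-- The `p`-th power of the norm lies above its tangent planes. -/
theorem norm_rpow_add_inner_le {p : ℝ} (hp : 1 < p) (a b : E) :
    ‖b‖ ^ p + p * (‖b‖ ^ (p - 2) * inner ℝ b (a - b)) ≤ ‖a‖ ^ p := by
  have hq := Real.HolderConjugate.conjExponent hp
  -- Young's inequality for ‖a‖ and ‖b‖^(p-1), with exponents p and p/(p-1); Cauchy-Schwarz then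
  -- brings in the inner product.
  have hy := Real.young_inequality_of_nonneg (norm_nonneg a)
    (Real.rpow_nonneg (norm_nonneg b) (p - 1)) hq
  have hp0 : 0 < p := by linarith
  have e1 : (‖b‖ ^ (p - 1)) ^ Real.conjExponent p = ‖b‖ ^ p := by
    rw [← Real.rpow_mul (norm_nonneg b)]
    congr 1
    unfold Real.conjExponent
    rw [mul_div_cancel₀ _ (by linarith)]
  rw [e1] at hy
  have e2 : ‖b‖ ^ p / Real.conjExponent p = (p - 1) / p * ‖b‖ ^ p := by
    unfold Real.conjExponent
    rw [div_div_eq_mul_div]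
    ring
  rw [e2] at hy
  have hy' : p * (‖a‖ * ‖b‖ ^ (p - 1)) ≤ ‖a‖ ^ p + (p - 1) * ‖b‖ ^ p := by
    calc p * (‖a‖ * ‖b‖ ^ (p - 1)) ≤ p * (‖a‖ ^ p / p + (p - 1) / p * ‖b‖ ^ p) := by gcongr
      _ = _ := by field_simp
  have h1 : ‖b‖ ^ (p - 2) * inner ℝ b a ≤ ‖a‖ * ‖b‖ ^ (p - 1) := by
    rw [← norm_rpow_sub_two_mul_norm hp b]
    calc ‖b‖ ^ (p - 2) * inner ℝ b a ≤ ‖b‖ ^ (p - 2) * (‖b‖ * ‖a‖) := by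
          gcongr
          exact real_inner_le_norm b a
      _ = _ := by ring
  rw [inner_sub_right, mul_sub, norm_rpow_sub_two_mul_inner_self hp]
  nlinarith

/-- The convexity gap of the `p`-th power of the norm at a midpoint. -/
def midpointGap (p : ℝ) (a b : E) : ℝ := (‖a‖ ^ p + ‖b‖ ^ p) / 2 - ‖(1 / 2 : ℝ) • (a + b)‖ ^ p

theorem midpointGap_nonneg {p : ℝ} (hp : 1 < p) (a b : E) : 0 ≤ midpointGap p a b := by
  have h := (convexOn_rpow hp.le).2 (norm_nonneg a) (norm_nonneg b) (by norm_num : (0:ℝ) ≤ 1 / 2)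
    (by norm_num : (0:ℝ) ≤ 1 / 2) (by norm_num)
  simp only [smul_eq_mul] at h
  have h2 : ‖(1 / 2 : ℝ) • (a + b)‖ ^ p ≤ (1 / 2 * ‖a‖ + 1 / 2 * ‖b‖) ^ p := by
    refine Real.rpow_le_rpow (norm_nonneg _) ?_ (by linarith)
    rw [norm_smul, Real.norm_of_nonneg (by norm_num)]
    linarith [norm_add_le a b]
  unfold midpointGap
  linarith

/-- For equal norms the triangle inequality is strict, because the vectors are not on the same ray.
For different norms the strict convexity of t ↦ t^p suffices. -/
theorem midpointGap_pos {p : ℝ} (hp : 1 < p) {a b : E} (hab : a ≠ b) : 0 < midpointGap p a b := by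
  have h2 : ‖(1 / 2 : ℝ) • (a + b)‖ = 1 / 2 * ‖a + b‖ := by
    rw [norm_smul, Real.norm_of_nonneg (by norm_num)]
  unfold midpointGap
  rw [h2]
  by_cases h : ‖a‖ = ‖b‖
  · have hlt : ‖a + b‖ < ‖a‖ + ‖b‖ :=
      norm_add_lt_of_not_sameRay fun hs => hab ((sameRay_iff_of_norm_eq h).1 hs)
    have : (1 / 2 * ‖a + b‖) ^ p < ‖a‖ ^ p :=
      Real.rpow_lt_rpow (by positivity) (by linarith) (by linarith)
    rw [← h]
    linarith
  · have hs := (strictConvexOn_rpow hp).2 (norm_nonneg a) (norm_nonneg b) h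
      (by norm_num : (0:ℝ) < 1 / 2) (by norm_num : (0:ℝ) < 1 / 2) (by norm_num)
    simp only [smul_eq_mul] at hs
    have h2 : (1 / 2 * ‖a + b‖) ^ p ≤ (1 / 2 * ‖a‖ + 1 / 2 * ‖b‖) ^ p :=
      Real.rpow_le_rpow (by positivity) (by linarith [norm_add_le a b]) (by linarith)
    linarith

theorem midpointGap_smul {p : ℝ} {r : ℝ} (hr : 0 ≤ r) (a b : E) :
    midpointGap p (r • a) (r • b) = r ^ p * midpointGap p a b := by
  unfold midpointGap
  rw [← smul_add, smul_comm, norm_smul, norm_smul, norm_smul r, Real.norm_of_nonneg hr,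
    Real.mul_rpow hr (norm_nonneg _), Real.mul_rpow hr (norm_nonneg _),
    Real.mul_rpow hr (norm_nonneg _)]
  ring

/-- Compactness: on the part of the sphere where the η-term does not already dominate strictly, the
two components differ, so the gap is positive there and the quotient of ‖a - b‖^p by the gap is
bounded. -/
theorem exists_norm_sub_rpow_le_of_mem_sphere [FiniteDimensional ℝ E] {p : ℝ} (hp : 1 < p) {η : ℝ}
    (hη : 0 < η) : ∃ κ : ℝ, 0 ≤ κ ∧ ∀ z ∈ Metric.sphere (0 : E × E) 1,
      ‖z.1 - z.2‖ ^ p ≤ η * (‖z.1‖ ^ p + ‖z.2‖ ^ p) + κ * midpointGap p z.1 z.2 := by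
  have hp0 : 0 < p := by linarith
  have hcont : ∀ f : E × E → E, Continuous f → Continuous fun z => ‖f z‖ ^ p := fun f hf =>
    hf.norm.rpow_const fun _ => Or.inr hp0.le
  have c1 := hcont (fun z => z.1) continuous_fst
  have c2 := hcont (fun z => z.2) continuous_snd
  have c3 := hcont (fun z => z.1 - z.2) (continuous_fst.sub continuous_snd)
  have c4 := hcont (fun z => (1 / 2 : ℝ) • (z.1 + z.2))
    ((continuous_fst.add continuous_snd).const_smul _)
  have c5 : Continuous fun z : E × E => midpointGap p z.1 z.2 := ((c1.add c2).div_const 2).sub c4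
  have hprop : ProperSpace (E × E) := FiniteDimensional.proper ℝ (E × E)
  have hK : IsCompact (Metric.sphere (0 : E × E) 1 ∩
      {z | η * (‖z.1‖ ^ p + ‖z.2‖ ^ p) ≤ ‖z.1 - z.2‖ ^ p}) :=
    (isCompact_sphere _ _).inter_right (isClosed_le (continuous_const.mul (c1.add c2)) c3)
  have hKne : ∀ z ∈ Metric.sphere (0 : E × E) 1 ∩
      {z | η * (‖z.1‖ ^ p + ‖z.2‖ ^ p) ≤ ‖z.1 - z.2‖ ^ p}, z.1 ≠ z.2 := by
    rintro z ⟨hz, hz2⟩ hab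
    replace hz2 : η * (‖z.1‖ ^ p + ‖z.2‖ ^ p) ≤ ‖z.1 - z.2‖ ^ p := hz2
    rw [mem_sphere_zero_iff_norm, Prod.norm_def, hab, max_self] at hz
    rw [hab, sub_self, norm_zero, Real.zero_rpow hp0.ne', hz, Real.one_rpow] at hz2
    linarith
  obtain ⟨B, hB⟩ : ∃ B, ∀ z ∈ Metric.sphere (0 : E × E) 1 ∩
      {z | η * (‖z.1‖ ^ p + ‖z.2‖ ^ p) ≤ ‖z.1 - z.2‖ ^ p},
      ‖‖z.1 - z.2‖ ^ p / midpointGap p z.1 z.2‖ ≤ B :=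
    hK.exists_bound_of_continuousOn
      (c3.continuousOn.div c5.continuousOn fun z hz => (midpointGap_pos hp (hKne z hz)).ne')
  refine ⟨max B 0, le_max_right _ _, fun z hz => ?_⟩
  have hg := midpointGap_nonneg hp z.1 z.2
  by_cases hzK : η * (‖z.1‖ ^ p + ‖z.2‖ ^ p) ≤ ‖z.1 - z.2‖ ^ p
  · have h1 : ‖z.1 - z.2‖ ^ p / midpointGap p z.1 z.2 ≤ B :=
      (Real.le_norm_self _).trans (hB z ⟨hz, hzK⟩)
    rw [div_le_iff₀ (midpointGap_pos hp (hKne z ⟨hz, hzK⟩))] at h1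
    have h2 : B * midpointGap p z.1 z.2 ≤ max B 0 * midpointGap p z.1 z.2 :=
      mul_le_mul_of_nonneg_right (le_max_left _ _) hg
    have h3 : 0 ≤ η * (‖z.1‖ ^ p + ‖z.2‖ ^ p) := by positivity
    linarith
  · have h3 : 0 ≤ max B 0 * midpointGap p z.1 z.2 := mul_nonneg (le_max_right _ _) hg
    linarith [not_le.1 hzK]

/-- A pointwise form of the uniform convexity of `L^p`. -/
theorem exists_norm_sub_rpow_le [FiniteDimensional ℝ E] {p : ℝ} (hp : 1 < p) {η : ℝ}
    (hη : 0 < η) : ∃ κ : ℝ, 0 ≤ κ ∧ ∀ a b : E,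
      ‖a - b‖ ^ p ≤ η * (‖a‖ ^ p + ‖b‖ ^ p) + κ * midpointGap p a b := by
  obtain ⟨κ, hκ, key⟩ := exists_norm_sub_rpow_le_of_mem_sphere (E := E) hp hη
  refine ⟨κ, hκ, fun a b => ?_⟩
  have hp0 : 0 < p := by linarith
  by_cases h0 : (a, b) = (0 : E × E)
  · obtain ⟨rfl, rfl⟩ := Prod.mk.inj h0
    simp [Real.zero_rpow hp0.ne', midpointGap]
  have hr0 : 0 < ‖((a, b) : E × E)‖ := norm_pos_iff.2 h0
  generalize hr : ‖((a, b) : E × E)‖ = r at hr0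
  -- Both sides are homogeneous of degree p, so the unit sphere suffices.
  have hz : (r⁻¹ • a, r⁻¹ • b) ∈ Metric.sphere (0 : E × E) 1 := by
    have : ((r⁻¹ • a, r⁻¹ • b) : E × E) = r⁻¹ • (a, b) := rfl
    rw [mem_sphere_zero_iff_norm, this, norm_smul, Real.norm_of_nonneg (by positivity), hr,
      inv_mul_cancel₀ hr0.ne']
  have h := key _ hz
  have hri : 0 ≤ r⁻¹ := by positivity
  rw [midpointGap_smul hri, ← smul_sub, norm_smul, norm_smul, norm_smul, Real.norm_of_nonneg hri,
    Real.mul_rpow hri (norm_nonneg _), Real.mul_rpow hri (norm_nonneg _),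
    Real.mul_rpow hri (norm_nonneg _)] at h
  have hrp : 0 < r⁻¹ ^ p := Real.rpow_pos_of_pos (by positivity) p
  refine le_of_mul_le_mul_left ?_ hrp
  linarith

end Pointwise

/-! ### Elements of minimal norm and the Euler-Lagrange equation in `L^p` -/

section Lp

variable {E : Type*} [NormedAddCommGroup E] {α : Type*} [MeasurableSpace α] {μ : Measure α}

theorem integrable_norm_rpow_of_memLp {p : ℝ} (hp : 0 < p) {f : α → E}
    (hf : MemLp f (ENNReal.ofReal p) μ) : Integrable (fun x => ‖f x‖ ^ p) μ := by
  have := hf.integrable_norm_rpow (by simpa using hp) ENNReal.ofReal_ne_top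
  rwa [ENNReal.toReal_ofReal hp.le] at this

theorem lp_norm_rpow_eq_integral {p : ℝ} (hp : 0 < p) (f : Lp E (ENNReal.ofReal p) μ) :
    ‖f‖ ^ p = ∫ x, ‖f x‖ ^ p ∂μ := by
  have h := (Lp.memLp f).eLpNorm_eq_integral_rpow_norm (by simpa using hp) ENNReal.ofReal_ne_top
  rw [ENNReal.toReal_ofReal hp.le] at h
  have hnn : 0 ≤ ∫ x, ‖f x‖ ^ p ∂μ := integral_nonneg fun x => by positivity
  rw [Lp.norm_def, h, ENNReal.toReal_ofReal (by positivity), ← Real.rpow_mul hnn,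
    inv_mul_cancel₀ hp.ne', Real.rpow_one]

theorem integrable_add_norm_rpow {p : ℝ} (hp : 0 < p) {f g : α → E}
    (hf : MemLp f (ENNReal.ofReal p) μ) (hg : MemLp g (ENNReal.ofReal p) μ) :
    Integrable (fun x => (‖f x‖ + ‖g x‖) ^ p) μ := by
  refine (integrable_norm_rpow_of_memLp hp (hf.norm.add hg.norm)).congr
    (Eventually.of_forall fun x => ?_)
  simp only [Pi.add_apply]
  rw [Real.norm_of_nonneg (by positivity)]

variable [InnerProductSpace ℝ E]

/-- The pointwise inequality integrates term by term. The result involves only the norms of f, g and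
their midpoint, all of which are known along a minimizing sequence in a convex set. -/
theorem lp_norm_sub_rpow_le {p : ℝ} (hp : 1 < p) {η κ : ℝ}
    (h : ∀ a b : E, ‖a - b‖ ^ p ≤ η * (‖a‖ ^ p + ‖b‖ ^ p) + κ * midpointGap p a b)
    [Fact (1 ≤ ENNReal.ofReal p)] (f g : Lp E (ENNReal.ofReal p) μ) :
    ‖f - g‖ ^ p ≤ η * (‖f‖ ^ p + ‖g‖ ^ p) +
      κ * ((‖f‖ ^ p + ‖g‖ ^ p) / 2 - ‖(1 / 2 : ℝ) • (f + g)‖ ^ p) := by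
  have hp0 : 0 < p := by linarith
  have If := integrable_norm_rpow_of_memLp hp0 (Lp.memLp f)
  have Ig := integrable_norm_rpow_of_memLp hp0 (Lp.memLp g)
  have Id := integrable_norm_rpow_of_memLp hp0 (Lp.memLp (f - g))
  have Im := integrable_norm_rpow_of_memLp hp0 (Lp.memLp ((1 / 2 : ℝ) • (f + g)))
  have Ifg : Integrable (fun x => ‖f x‖ ^ p + ‖g x‖ ^ p) μ := If.add Ig
  have Igap : Integrable (fun x => (‖f x‖ ^ p + ‖g x‖ ^ p) / 2 -
      ‖((1 / 2 : ℝ) • (f + g) : Lp E (ENNReal.ofReal p) μ) x‖ ^ p) μ := (Ifg.div_const 2).sub Im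
  rw [lp_norm_rpow_eq_integral hp0, lp_norm_rpow_eq_integral hp0, lp_norm_rpow_eq_integral hp0,
    lp_norm_rpow_eq_integral hp0, ← integral_add If Ig, ← integral_const_mul,
    ← integral_div, ← integral_sub (Ifg.div_const 2) Im, ← integral_const_mul,
    ← integral_add (Ifg.const_mul η) (Igap.const_mul κ)]
  refine integral_mono_ae Id ((Ifg.const_mul η).add (Igap.const_mul κ)) ?_
  filter_upwards [Lp.coeFn_sub f g, Lp.coeFn_smul (1 / 2 : ℝ) (f + g), Lp.coeFn_add f g]
    with x h1 h2 h3
  have := h (f x) (g x)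
  simp only [h1, h2, h3, Pi.sub_apply, Pi.smul_apply, Pi.add_apply]
  exact this

/-- A nonempty closed convex subset of `L^p`, `1 < p < ∞`, has an element of minimal norm. -/
theorem exists_minimal_norm [FiniteDimensional ℝ E] {p : ℝ} (hp : 1 < p)
    [Fact (1 ≤ ENNReal.ofReal p)] {K : Set (Lp E (ENNReal.ofReal p) μ)} (hc : IsClosed K)
    (hconv : Convex ℝ K) (hne : K.Nonempty) : ∃ f ∈ K, ∀ g ∈ K, ‖f‖ ≤ ‖g‖ := by
  have hp0 : 0 < p := by linarith
  have hbdd : BddBelow (norm '' K) := ⟨0, by rintro _ ⟨f, -, rfl⟩; exact norm_nonneg f⟩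
  set m := sInf (norm '' K) with hm
  have hmle : ∀ f ∈ K, m ≤ ‖f‖ := fun f hf => csInf_le hbdd ⟨f, hf, rfl⟩
  have hm0 : 0 ≤ m := le_csInf (hne.image _) (by rintro _ ⟨f, -, rfl⟩; exact norm_nonneg f)
  have hex : ∀ n : ℕ, ∃ f ∈ K, ‖f‖ < m + 1 / ((n : ℝ) + 1) := by
    intro n
    obtain ⟨_, ⟨f, hf, rfl⟩, h⟩ := exists_lt_of_csInf_lt (hne.image norm)
      (show sInf (norm '' K) < m + 1 / ((n : ℝ) + 1) by
        rw [← hm]; have : 0 < 1 / ((n : ℝ) + 1) := by positivity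
        linarith)
    exact ⟨f, hf, h⟩
  choose x hxK hx using hex
  have ht : Tendsto (fun n : ℕ => m + 1 / ((n : ℝ) + 1)) atTop (𝓝 m) := by
    simpa using tendsto_one_div_add_atTop_nhds_zero_nat.const_add m
  have hanti : ∀ {n k : ℕ}, n ≤ k → ‖x k‖ ≤ m + 1 / ((n : ℝ) + 1) := by
    intro n k hnk
    refine (hx k).le.trans ?_
    gcongr
  have hcau : CauchySeq x := by
    rw [Metric.cauchySeq_iff]
    intro ε hε
    have hεp : 0 < ε ^ p := Real.rpow_pos_of_pos hε p
    -- With this η the first term of the estimate tends to 2η m^p < ε^p. The term with κ tends to 0,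
    -- since midpoints stay in K and so have norm at least m.
    set η := ε ^ p / (4 * (m ^ p + 1)) with hη
    have hmp : 0 ≤ m ^ p := Real.rpow_nonneg hm0 p
    have hη0 : 0 < η := by positivity
    obtain ⟨κ, hκ, hineq⟩ := exists_norm_sub_rpow_le (E := E) hp hη0
    have hlim : Tendsto (fun n : ℕ => η * (2 * (m + 1 / ((n : ℝ) + 1)) ^ p) +
        κ * ((m + 1 / ((n : ℝ) + 1)) ^ p - m ^ p)) atTop
        (𝓝 (η * (2 * m ^ p) + κ * (m ^ p - m ^ p))) := by
      have h := ht.rpow_const (p := p) (Or.inr hp0.le)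
      exact ((h.const_mul 2).const_mul η).add ((h.sub_const _).const_mul κ)
    have hlt : η * (2 * m ^ p) + κ * (m ^ p - m ^ p) < ε ^ p := by
      rw [sub_self, mul_zero, add_zero, hη, div_mul_eq_mul_div, div_lt_iff₀ (by positivity)]
      nlinarith
    obtain ⟨N, hN⟩ := (hlim.eventually_lt_const hlt).exists
    refine ⟨N, fun a ha b hb => ?_⟩
    have hA : ‖x a‖ ^ p ≤ (m + 1 / ((N : ℝ) + 1)) ^ p :=
      Real.rpow_le_rpow (norm_nonneg _) (hanti ha) hp0.le
    have hB : ‖x b‖ ^ p ≤ (m + 1 / ((N : ℝ) + 1)) ^ p :=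
      Real.rpow_le_rpow (norm_nonneg _) (hanti hb) hp0.le
    have hmid : m ^ p ≤ ‖(1 / 2 : ℝ) • (x a + x b)‖ ^ p := by
      refine Real.rpow_le_rpow hm0 (hmle _ ?_) hp0.le
      rw [smul_add]
      exact hconv (hxK a) (hxK b) (by norm_num) (by norm_num) (by norm_num)
    have h := lp_norm_sub_rpow_le hp hineq (x a) (x b)
    rw [dist_eq_norm, ← Real.rpow_lt_rpow_iff (norm_nonneg _) hε.le hp0]
    refine h.trans_lt (lt_of_le_of_lt ?_ hN)
    have h1 : η * (‖x a‖ ^ p + ‖x b‖ ^ p) ≤ η * (2 * (m + 1 / ((N : ℝ) + 1)) ^ p) := by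
      refine mul_le_mul_of_nonneg_left ?_ hη0.le
      linarith
    have h2 : κ * ((‖x a‖ ^ p + ‖x b‖ ^ p) / 2 - ‖(1 / 2 : ℝ) • (x a + x b)‖ ^ p) ≤
        κ * ((m + 1 / ((N : ℝ) + 1)) ^ p - m ^ p) := by
      refine mul_le_mul_of_nonneg_left ?_ hκ
      linarith
    linarith
  obtain ⟨f, hf⟩ := cauchySeq_tendsto_of_complete hcau
  refine ⟨f, hc.mem_of_tendsto hf (Eventually.of_forall hxK), fun g hg => ?_⟩
  have : ‖f‖ ≤ m := le_of_tendsto_of_tendsto hf.norm ht (Eventually.of_forall fun n => (hx n).le)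
  exact this.trans (hmle g hg)

/-- The flux density `|a|^{p-2} ⟨a, b⟩` is bounded by `|a|^{p-1} |b|`. -/
theorem abs_norm_rpow_mul_inner_le {p : ℝ} (hp : 1 < p) (a b : E) :
    |‖a‖ ^ (p - 2) * inner ℝ a b| ≤ ‖a‖ ^ (p - 1) * ‖b‖ := by
  rw [abs_mul, abs_of_nonneg (Real.rpow_nonneg (norm_nonneg _) _),
    ← norm_rpow_sub_two_mul_norm hp, mul_assoc]
  gcongr
  exact abs_real_inner_le_norm a b

theorem abs_norm_rpow_mul_inner_le_add_rpow {p : ℝ} (hp : 1 < p) (a b : E) :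
    |‖a‖ ^ (p - 2) * inner ℝ a b| ≤ (‖a‖ + ‖b‖) ^ p := by
  refine (abs_norm_rpow_mul_inner_le hp a b).trans ?_
  calc ‖a‖ ^ (p - 1) * ‖b‖ ≤ (‖a‖ + ‖b‖) ^ (p - 1) * (‖a‖ + ‖b‖) := by
        have : 0 ≤ p - 1 := by linarith
        gcongr <;> linarith [norm_nonneg a, norm_nonneg b]
    _ = (‖a‖ + ‖b‖) ^ p := by
        -- The exponent p + 1 turns the identity into ‖b‖^(p-1) ‖b‖ = ‖b‖^p.
        have := norm_rpow_sub_two_mul_norm (F := ℝ) (p := p + 1) (by linarith) (‖a‖ + ‖b‖)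
        rw [Real.norm_of_nonneg (by positivity)] at this
        convert this using 2 <;> ring_nf

theorem aestronglyMeasurable_flux {p : ℝ} {f g : α → E} (hf : AEStronglyMeasurable f μ)
    (hg : AEStronglyMeasurable g μ) :
    AEStronglyMeasurable (fun x => ‖f x‖ ^ (p - 2) * inner ℝ (f x) (g x)) μ :=
  ((hf.norm.aemeasurable.pow_const _).aestronglyMeasurable).mul (hf.inner hg)

theorem integrable_flux {p : ℝ} (hp : 1 < p) {f g : α → E}
    (hf : MemLp f (ENNReal.ofReal p) μ) (hg : MemLp g (ENNReal.ofReal p) μ) :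
    Integrable (fun x => ‖f x‖ ^ (p - 2) * inner ℝ (f x) (g x)) μ :=
  (integrable_add_norm_rpow (by linarith) hf hg).mono' (aestronglyMeasurable_flux hf.1 hg.1)
    (Eventually.of_forall fun x => abs_norm_rpow_mul_inner_le_add_rpow hp _ _)

/-- The Euler-Lagrange equation of the `p`-energy along a line. -/
theorem integral_flux_eq_zero_of_minimal {p : ℝ} (hp : 1 < p) {f g : α → E}
    (hf : MemLp f (ENNReal.ofReal p) μ) (hg : MemLp g (ENNReal.ofReal p) μ)
    (hmin : ∀ t : ℝ, ∫ x, ‖f x‖ ^ p ∂μ ≤ ∫ x, ‖f x + t • g x‖ ^ p ∂μ) :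
    ∫ x, ‖f x‖ ^ (p - 2) * inner ℝ (f x) (g x) ∂μ = 0 := by
  have hp0 : 0 < p := by linarith
  have hderiv : ∀ x t, HasDerivAt (fun t : ℝ => ‖f x + t • g x‖ ^ p)
      (p * (‖f x + t • g x‖ ^ (p - 2) * inner ℝ (f x + t • g x) (g x))) t := by
    intro x t
    have h1 : HasDerivAt (fun t : ℝ => f x + t • g x) (g x) t := by
      simpa using ((hasDerivAt_id t).smul_const (g x)).const_add (f x)
    refine ((hasFDerivAt_norm_rpow (f x + t • g x) hp).comp_hasDerivAt t h1).congr_deriv ?_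
    simp [mul_assoc]
    rw [inner_add_left, real_inner_smul_left, real_inner_self_eq_norm_sq]
    ring
  have hmeas : ∀ t : ℝ, AEStronglyMeasurable (fun x => f x + t • g x) μ := fun t =>
    hf.1.add (hg.1.const_smul t)
  -- Differentiation under the integral sign. In the dominating function, ‖f‖ + ‖g‖ bounds ‖f + t g‖
  -- for |t| < 1, and the second ‖g‖ comes from the direction of differentiation.
  have key := hasDerivAt_integral_of_dominated_loc_of_deriv_le (μ := μ)
    (F := fun t x => ‖f x + t • g x‖ ^ p) (x₀ := (0 : ℝ))
    (F' := fun t x => p * (‖f x + t • g x‖ ^ (p - 2) * inner ℝ (f x + t • g x) (g x)))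
    (s := Metric.ball 0 1) (bound := fun x => p * (‖f x‖ + ‖g x‖ + ‖g x‖) ^ p)
    (Metric.ball_mem_nhds 0 one_pos)
    (Eventually.of_forall fun t =>
      ((hmeas t).norm.aemeasurable.pow_const _).aestronglyMeasurable)
    (by simpa using integrable_norm_rpow_of_memLp hp0 hf)
    ((aestronglyMeasurable_flux (hmeas 0) hg.1).const_mul p)
    (Eventually.of_forall fun x t ht => by
      rw [Real.norm_eq_abs, abs_mul, abs_of_pos hp0]
      refine mul_le_mul_of_nonneg_left
        ((abs_norm_rpow_mul_inner_le_add_rpow hp _ _).trans ?_) hp0.le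
      refine Real.rpow_le_rpow (by positivity) ?_ hp0.le
      have ht' : ‖t‖ ≤ 1 := by simpa using (Metric.mem_ball.1 ht).le
      have : ‖f x + t • g x‖ ≤ ‖f x‖ + ‖g x‖ := by
        refine (norm_add_le _ _).trans ?_
        rw [norm_smul]
        gcongr
        exact mul_le_of_le_one_left (norm_nonneg _) ht'
      linarith)
    (by
      have h := integrable_norm_rpow_of_memLp hp0 ((hf.norm.add hg.norm).add hg.norm)
      refine (h.const_mul p).congr (Eventually.of_forall fun x => ?_)
      simp only [Pi.add_apply]
      rw [Real.norm_of_nonneg (by positivity)])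
    (Eventually.of_forall fun x t _ => hderiv x t)
  have hloc : IsLocalMin (fun t : ℝ => ∫ x, ‖f x + t • g x‖ ^ p ∂μ) 0 :=
    Eventually.of_forall fun t => by simpa using hmin t
  have h0 := hloc.hasDerivAt_eq_zero key.2
  simp only [zero_smul, add_zero] at h0
  rw [integral_const_mul] at h0
  exact (mul_eq_zero.1 h0).resolve_left hp0.ne'

end Lp

end

section

/-! ### Weak gradients -/

variable {d : ℕ}

theorem inner_gradient (φ : Space d → ℝ) (x v : Space d) :
    inner ℝ (gradient φ x) v = fderiv ℝ φ x v := by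
  simp [gradient]

theorem norm_gradient (φ : Space d → ℝ) (x : Space d) : ‖gradient φ x‖ = ‖fderiv ℝ φ x‖ := by
  simp [gradient]

theorem continuous_gradient_of_contDiff {u : Space d → ℝ} (hu : ContDiff ℝ 1 u) :
    Continuous (gradient u) :=
  (LinearIsometryEquiv.continuous _).comp (hu.continuous_fderiv (by simp))

theorem IsTest.setIntegral_smul {E : Type*} [NormedAddCommGroup E] [NormedSpace ℝ E]
    {Ω : Set (Space d)} {φ : Space d → ℝ} (hφ : IsTest Ω φ) (F : Space d → E) :
    ∫ x in Ω, φ x • F x = ∫ x, φ x • F x := by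
  refine setIntegral_eq_integral_of_forall_compl_eq_zero fun x hx => ?_
  rw [image_eq_zero_of_notMem_tsupport fun h => hx (hφ.2.2 h), zero_smul]

theorem IsTest.setIntegral_smul_gradient {Ω : Set (Space d)} {φ : Space d → ℝ}
    (hφ : IsTest Ω φ) (u : Space d → ℝ) :
    ∫ x in Ω, u x • gradient φ x = ∫ x, u x • gradient φ x := by
  refine setIntegral_eq_integral_of_forall_compl_eq_zero fun x hx => ?_
  rw [hφ.gradient_eq_zero fun h => hx (hφ.2.2 h), smul_zero]

/-- Weak gradients are unique almost everywhere. -/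
theorem HasWeakGradient.ae_eq {Ω : Set (Space d)} (hΩ : IsOpen Ω) {u : Space d → ℝ}
    {G H : Space d → Space d} (hG : HasWeakGradient Ω u G) (hH : HasWeakGradient Ω u H) :
    G =ᵐ[volume.restrict Ω] H := by
  have h := hΩ.ae_eq_zero_of_integral_contDiff_smul_eq_zero (μ := volume) (f := G - H)
    (hG.2.1.sub hH.2.1) fun φ h1 h2 h3 => by
      have hφ : IsTest Ω φ := ⟨h1, h2, h3⟩
      rw [← hφ.setIntegral_smul]
      simp only [Pi.sub_apply, smul_sub]
      rw [integral_sub (hφ.integrable_smul hG.2.1) (hφ.integrable_smul hH.2.1), sub_eq_zero]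
      exact neg_injective ((hG.2.2 φ hφ).symm.trans (hH.2.2 φ hφ))
  rw [EventuallyEq, ae_restrict_iff' hΩ.measurableSet]
  filter_upwards [h] with x hx hxΩ
  exact sub_eq_zero.1 (hx hxΩ)

theorem HasWeakGradient.weakGrad {Ω : Set (Space d)} {u : Space d → ℝ} {G : Space d → Space d}
    (hG : HasWeakGradient Ω u G) : HasWeakGradient Ω u (weakGrad Ω u) := by
  have h : ∃ G, HasWeakGradient Ω u G := ⟨G, hG⟩
  unfold PCalderon.weakGrad
  rw [dif_pos h]
  exact h.choose_spec

theorem HasWeakGradient.weakGrad_ae_eq {Ω : Set (Space d)} (hΩ : IsOpen Ω) {u : Space d → ℝ}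
    {G : Space d → Space d} (hG : HasWeakGradient Ω u G) :
    PCalderon.weakGrad Ω u =ᵐ[volume.restrict Ω] G :=
  hG.weakGrad.ae_eq hΩ hG

/-- A continuously differentiable function has its gradient as weak gradient. -/
theorem hasWeakGradient_of_contDiff (Ω : Set (Space d)) {u : Space d → ℝ} (hu : ContDiff ℝ 1 u) :
    HasWeakGradient Ω u (gradient u) := by
  have hlu : LocallyIntegrableOn u Ω := hu.continuous.locallyIntegrable.locallyIntegrableOn _
  have hlg : LocallyIntegrableOn (gradient u) Ω :=
    (continuous_gradient_of_contDiff hu).locallyIntegrable.locallyIntegrableOn _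
  refine ⟨hlu, hlg, fun φ hφ => ?_⟩
  have hφ' : IsTest Set.univ φ := ⟨hφ.1, hφ.2.1, Set.subset_univ _⟩
  have i1 : Integrable fun x => u x • gradient φ x := by
    simpa using hφ'.integrable_smul_gradient
      (hu.continuous.locallyIntegrable.locallyIntegrableOn Set.univ)
  have i2 : Integrable fun x => φ x • gradient u x := by
    simpa using hφ'.integrable_smul
      ((continuous_gradient_of_contDiff hu).locallyIntegrable.locallyIntegrableOn Set.univ)
  rw [hφ.setIntegral_smul_gradient, hφ.setIntegral_smul]
  refine ext_inner_right ℝ fun v => ?_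
  have e1 : ∀ x, inner ℝ v (u x • gradient φ x) = u x * fderiv ℝ φ x v := fun x => by
    rw [inner_smul_right, real_inner_comm, inner_gradient]
  have e2 : ∀ x, inner ℝ v (φ x • gradient u x) = φ x * fderiv ℝ u x v := fun x => by
    rw [inner_smul_right, real_inner_comm, inner_gradient]
  rw [inner_neg_left, real_inner_comm, real_inner_comm _ (∫ x, φ x • gradient u x),
    ← integral_inner i1, ← integral_inner i2]
  simp only [e1, e2]
  rw [integral_mul_fderiv_eq_neg_fderiv_mul_of_integrable]
  · simp only [mul_comm]
  · simpa only [e2, mul_comm] using i2.const_inner (𝕜 := ℝ) v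
  · simpa only [e1] using i1.const_inner (𝕜 := ℝ) v
  · exact (hu.continuous.mul hφ.1.continuous).integrable_of_hasCompactSupport hφ.2.1.mul_left
  · exact fun x _ => hu.differentiable (by simp) x
  · exact fun x _ => hφ.1.differentiable (by simp) x

theorem memLp_of_continuous {E : Type*} [NormedAddCommGroup E] {Ω : Set (Space d)}
    (hΩb : Bornology.IsBounded Ω) {q : ℝ≥0∞} {f : Space d → E} (hf : Continuous f) :
    MemLp f q (volume.restrict Ω) := by
  have hK : IsCompact (closure Ω) := hΩb.isCompact_closure
  obtain ⟨C, hC⟩ := hK.exists_bound_of_continuousOn hf.continuousOn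
  have : IsFiniteMeasure (volume.restrict (closure Ω)) := ⟨by
    rw [Measure.restrict_apply_univ]; exact hK.measure_lt_top⟩
  refine (MemLp.of_bound (μ := volume.restrict (closure Ω)) (p := q) hf.aestronglyMeasurable C
    ?_).mono_measure (Measure.restrict_mono subset_closure le_rfl)
  exact ae_restrict_of_forall_mem isClosed_closure.measurableSet hC

theorem isFiniteMeasure_restrict {Ω : Set (Space d)} (hΩb : Bornology.IsBounded Ω) :
    IsFiniteMeasure (volume.restrict Ω : Measure (Space d)) :=
  ⟨by rw [Measure.restrict_apply_univ]; exact hΩb.measure_lt_top⟩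

theorem mem_W1p_of_contDiff {Ω : Set (Space d)} (hΩb : Bornology.IsBounded Ω) (p : ℝ)
    {u : Space d → ℝ} (hu : ContDiff ℝ 1 u) : u ∈ W1p Ω p :=
  ⟨memLp_of_continuous hΩb hu.continuous, gradient u,
    memLp_of_continuous hΩb (continuous_gradient_of_contDiff hu), hasWeakGradient_of_contDiff Ω hu⟩

theorem IsTest.contDiff_one {Ω : Set (Space d)} {φ : Space d → ℝ} (hφ : IsTest Ω φ) :
    ContDiff ℝ 1 φ := hφ.1.of_le (by norm_cast)

theorem hasWeakGradient_weakGrad {Ω : Set (Space d)} {p : ℝ} (u : W1p Ω p) :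
    HasWeakGradient Ω u (weakGrad Ω u) := by
  obtain ⟨G, -, hG⟩ := u.2.2
  exact hG.weakGrad

theorem memLp_weakGrad {Ω : Set (Space d)} (hΩ : IsOpen Ω) {p : ℝ} (u : W1p Ω p) :
    MemLp (weakGrad Ω u) (ENNReal.ofReal p) (volume.restrict Ω) := by
  obtain ⟨G, hG, hG'⟩ := u.2.2
  exact hG.ae_eq (hG'.weakGrad_ae_eq hΩ).symm

theorem weakGrad_add_ae_eq {Ω : Set (Space d)} (hΩ : IsOpen Ω) {p : ℝ} (u v : W1p Ω p) :
    weakGrad Ω (u + v : W1p Ω p) =ᵐ[volume.restrict Ω] weakGrad Ω u + weakGrad Ω v :=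
  ((hasWeakGradient_weakGrad u).add (hasWeakGradient_weakGrad v)).weakGrad_ae_eq hΩ

theorem weakGrad_smul_ae_eq {Ω : Set (Space d)} (hΩ : IsOpen Ω) {p : ℝ} (c : ℝ) (u : W1p Ω p) :
    weakGrad Ω (c • u : W1p Ω p) =ᵐ[volume.restrict Ω] c • weakGrad Ω u :=
  ((hasWeakGradient_weakGrad u).const_smul c).weakGrad_ae_eq hΩ

theorem weakGrad_sub_ae_eq {Ω : Set (Space d)} (hΩ : IsOpen Ω) {p : ℝ} (u v : W1p Ω p) :
    weakGrad Ω (u - v : W1p Ω p) =ᵐ[volume.restrict Ω] weakGrad Ω u - weakGrad Ω v := by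
  have h1 := weakGrad_add_ae_eq hΩ u ((-1 : ℝ) • v)
  have h2 := weakGrad_smul_ae_eq hΩ (-1) v
  have : u - v = u + (-1 : ℝ) • v := by
    apply Subtype.ext
    funext x
    simp [sub_eq_add_neg]
  rw [this]
  filter_upwards [h1, h2] with x h1 h2
  rw [h1, Pi.add_apply, h2]
  simp [sub_eq_add_neg]

theorem weakGrad_of_contDiff_ae_eq {Ω : Set (Space d)} (hΩ : IsOpen Ω) {u : Space d → ℝ}
    (hu : ContDiff ℝ 1 u) : weakGrad Ω u =ᵐ[volume.restrict Ω] gradient u :=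
  (hasWeakGradient_of_contDiff Ω hu).weakGrad_ae_eq hΩ

/-- Convergence in `L^p` of a finite measure implies convergence of the integrals against a
bounded function. -/
theorem tendsto_integral_smul_of_eLpNorm {α E : Type*} [MeasurableSpace α] {ν : Measure α}
    [IsFiniteMeasure ν] [NormedAddCommGroup E] [NormedSpace ℝ E] {F : Type*} [NormedAddCommGroup F]
    [NormedSpace ℝ F] {W : Type*} [NormedAddCommGroup W] [NormedSpace ℝ W] (B : E →L[ℝ] F →L[ℝ] W)
    {q : ℝ≥0∞} (hq : 1 ≤ q)
    {f : ℕ → α → E} {f₀ : α → E} (hf : ∀ n, MemLp (f n) q ν) (hf₀ : MemLp f₀ q ν)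
    (h : Tendsto (fun n => eLpNorm (f₀ - f n) q ν) atTop (𝓝 0)) {g : α → F}
    (hg : AEStronglyMeasurable g ν) {C : ℝ} (hC : ∀ᵐ x ∂ν, ‖g x‖ ≤ C) :
    Tendsto (fun n => ∫ x, B (f n x) (g x) ∂ν) atTop (𝓝 (∫ x, B (f₀ x) (g x) ∂ν)) := by
  have hint : ∀ u : α → E, MemLp u q ν → Integrable (fun x => B (u x) (g x)) ν := by
    intro u hu
    refine ((hu.integrable hq).norm.const_mul (‖B‖ * C)).mono'
      (B.aestronglyMeasurable_comp₂ hu.1 hg) ?_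
    filter_upwards [hC] with x hx
    calc ‖B (u x) (g x)‖ ≤ ‖B‖ * ‖u x‖ * ‖g x‖ := B.le_opNorm₂ _ _
      _ ≤ ‖B‖ * ‖u x‖ * C := by gcongr
      _ = ‖B‖ * C * ‖u x‖ := by ring
  refine tendsto_integral_of_L1' _ (hint f₀ hf₀).1 (Eventually.of_forall fun n => hint _ (hf n)) ?_
  have hbound : ∀ n, eLpNorm ((fun x => B (f n x) (g x)) - fun x => B (f₀ x) (g x)) 1 ν ≤
      ENNReal.ofReal (‖B‖ * C) *
        (eLpNorm (f₀ - f n) q ν * ν Set.univ ^ (1 / (1 : ℝ≥0∞).toReal - 1 / q.toReal)) := by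
    intro n
    refine le_trans ?_ (mul_le_mul_right (eLpNorm_le_eLpNorm_mul_rpow_measure_univ hq
      (hf₀.1.sub (hf n).1)) _)
    refine eLpNorm_le_mul_eLpNorm_of_ae_le_mul ?_ 1
    filter_upwards [hC] with x hx
    simp only [Pi.sub_apply]
    rw [← sub_apply, ← map_sub, ← norm_neg (f₀ x - f n x), neg_sub]
    calc ‖B (f n x - f₀ x) (g x)‖ ≤ ‖B‖ * ‖f n x - f₀ x‖ * ‖g x‖ := B.le_opNorm₂ _ _
      _ ≤ ‖B‖ * ‖f n x - f₀ x‖ * C := by gcongr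
      _ = ‖B‖ * C * ‖f n x - f₀ x‖ := by ring
  refine tendsto_of_tendsto_of_tendsto_of_le_of_le tendsto_const_nhds ?_ (fun _ => zero_le) hbound
  have hfin : ν Set.univ ^ (1 / (1 : ℝ≥0∞).toReal - 1 / q.toReal) ≠ ⊤ := by
    refine (ENNReal.rpow_lt_top_of_nonneg ?_ (measure_ne_top ν _)).ne
    rcases eq_or_ne q ⊤ with rfl | hq'
    · simp
    · have : 1 ≤ q.toReal := by
        rw [← ENNReal.toReal_one]; exact ENNReal.toReal_mono hq' hq
      have := div_le_one_of_le₀ this (by positivity)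
      simpa using this
  have h1 := ENNReal.Tendsto.mul_const h (Or.inr hfin)
  rw [zero_mul] at h1
  simpa using ENNReal.Tendsto.const_mul h1 (Or.inr ENNReal.ofReal_ne_top)

/-- Weak gradients pass to limits in `L^p`. -/
theorem hasWeakGradient_of_tendsto {Ω : Set (Space d)} (hΩb : Bornology.IsBounded Ω)
    {q : ℝ≥0∞} (hq : 1 ≤ q) {u : ℕ → Space d → ℝ} {G : ℕ → Space d → Space d}
    {u₀ : Space d → ℝ} {G₀ : Space d → Space d}
    (hu : ∀ n, MemLp (u n) q (volume.restrict Ω)) (hG : ∀ n, MemLp (G n) q (volume.restrict Ω))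
    (hu₀ : MemLp u₀ q (volume.restrict Ω)) (hG₀ : MemLp G₀ q (volume.restrict Ω))
    (hw : ∀ n, HasWeakGradient Ω (u n) (G n))
    (h1 : Tendsto (fun n => eLpNorm (u₀ - u n) q (volume.restrict Ω)) atTop (𝓝 0))
    (h2 : Tendsto (fun n => eLpNorm (G₀ - G n) q (volume.restrict Ω)) atTop (𝓝 0)) :
    HasWeakGradient Ω u₀ G₀ := by
  have := isFiniteMeasure_restrict hΩb
  refine ⟨IntegrableOn.locallyIntegrableOn (hu₀.integrable hq),
    IntegrableOn.locallyIntegrableOn (hG₀.integrable hq),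
    fun φ hφ => ?_⟩
  obtain ⟨C₁, hC₁⟩ := hφ.1.continuous.bounded_above_of_compact_support hφ.2.1
  obtain ⟨C₂, hC₂⟩ := hφ.continuous_gradient.bounded_above_of_compact_support
    (HasCompactSupport.intro hφ.2.1 fun x hx => hφ.gradient_eq_zero hx)
  have t1 := tendsto_integral_smul_of_eLpNorm (ContinuousLinearMap.lsmul ℝ ℝ) hq hu hu₀ h1
    hφ.continuous_gradient.aestronglyMeasurable (Eventually.of_forall hC₂)
  have t2 := tendsto_integral_smul_of_eLpNorm (ContinuousLinearMap.lsmul ℝ ℝ).flip hq hG hG₀ h2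
    hφ.1.continuous.aestronglyMeasurable (Eventually.of_forall hC₁)
  simp only [ContinuousLinearMap.lsmul_apply, ContinuousLinearMap.flip_apply] at t1 t2
  refine tendsto_nhds_unique t1 ?_
  simp_rw [fun n => (hw n).2.2 φ hφ]
  exact t2.neg

end

section

variable {d : ℕ}

/-! ### Poincaré inequalities -/

/-- Jensen's inequality for the power `p` and a finite measure. -/
theorem lintegral_rpow_le_mul {α : Type*} [MeasurableSpace α] {ν : Measure α} {p : ℝ} (hp : 1 < p)
    {h : α → ℝ≥0∞} (hh : AEMeasurable h ν) :
    (∫⁻ x, h x ∂ν) ^ p ≤ ν Set.univ ^ (p - 1) * ∫⁻ x, h x ^ p ∂ν := by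
  have hp0 : 0 < p := by linarith
  have hq := Real.HolderConjugate.conjExponent hp
  have key := ENNReal.lintegral_mul_le_Lp_mul_Lq ν hq hh (g := fun _ => 1) aemeasurable_const
  simp only [Pi.mul_apply, mul_one, ENNReal.one_rpow, lintegral_const, one_mul] at key
  calc (∫⁻ x, h x ∂ν) ^ p ≤ ((∫⁻ x, h x ^ p ∂ν) ^ (1 / p) *
        ν Set.univ ^ (1 / Real.conjExponent p)) ^ p := ENNReal.rpow_le_rpow key hp0.le
    _ = ν Set.univ ^ (p - 1) * ∫⁻ x, h x ^ p ∂ν := by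
      rw [ENNReal.mul_rpow_of_nonneg _ _ hp0.le, ← ENNReal.rpow_mul, ← ENNReal.rpow_mul,
        one_div_mul_cancel hp0.ne', ENNReal.rpow_one, mul_comm]
      congr 2
      unfold Real.conjExponent
      have : p - 1 ≠ 0 := by linarith
      field_simp

/-- The fundamental theorem of calculus along the segment, followed by Jensen's inequality on [0,1],
which has measure one. -/
theorem enorm_sub_rpow_le_lintegral {p : ℝ} (hp : 1 < p) {v : Space d → ℝ} (hv : ContDiff ℝ 1 v)
    (y e : Space d) : ‖v (y + e) - v y‖ₑ ^ p ≤
      ‖e‖ₑ ^ p * ∫⁻ t in Set.Icc (0 : ℝ) 1, ‖gradient v (y + t • e)‖ₑ ^ p := by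
  have hp0 : 0 < p := by linarith
  have hg := continuous_gradient_of_contDiff hv
  have hline : Continuous fun t : ℝ => y + t • e := by fun_prop
  have hd : ∀ t : ℝ, HasDerivAt (fun t : ℝ => v (y + t • e))
      (inner ℝ (gradient v (y + t • e)) e) t := by
    intro t
    have h1 : HasDerivAt (fun t : ℝ => y + t • e) e t := by
      simpa using ((hasDerivAt_id t).smul_const e).const_add y
    rw [inner_gradient]
    exact (hv.differentiable (by simp) _).hasFDerivAt.comp_hasDerivAt t h1
  have hcont : Continuous fun t : ℝ => inner ℝ (gradient v (y + t • e)) e :=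
    (hg.comp hline).inner continuous_const
  have hftc := intervalIntegral.integral_eq_sub_of_hasDerivAt (a := 0) (b := 1)
    (fun t _ => hd t) (hcont.intervalIntegrable 0 1)
  simp only [one_smul, zero_smul, add_zero] at hftc
  have hm : Measurable fun t : ℝ => ‖gradient v (y + t • e)‖ₑ := (hg.comp hline).enorm.measurable
  have h1 : ‖v (y + e) - v y‖ₑ ≤
      ∫⁻ t in Set.Icc (0 : ℝ) 1, ‖gradient v (y + t • e)‖ₑ * ‖e‖ₑ := by
    rw [← hftc, intervalIntegral.integral_of_le zero_le_one, ← integral_Icc_eq_integral_Ioc]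
    refine (enorm_integral_le_lintegral_enorm _).trans (lintegral_mono fun t => ?_)
    simp only [← ofReal_norm]
    rw [← ENNReal.ofReal_mul (norm_nonneg _)]
    exact ENNReal.ofReal_le_ofReal (norm_inner_le_norm _ _)
  calc ‖v (y + e) - v y‖ₑ ^ p
      ≤ (∫⁻ t in Set.Icc (0 : ℝ) 1, ‖gradient v (y + t • e)‖ₑ * ‖e‖ₑ) ^ p :=
        ENNReal.rpow_le_rpow h1 hp0.le
    _ ≤ (volume.restrict (Set.Icc (0 : ℝ) 1)) Set.univ ^ (p - 1) *
        ∫⁻ t in Set.Icc (0 : ℝ) 1, (‖gradient v (y + t • e)‖ₑ * ‖e‖ₑ) ^ p :=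
        lintegral_rpow_le_mul hp (hm.mul_const _).aemeasurable
    _ = _ := by
      simp only [ENNReal.mul_rpow_of_nonneg _ _ hp0.le]
      rw [lintegral_mul_const _ (hm.pow_const _)]
      simp [mul_comm]

/-- A dilation costs r^(-d) ≤ 2^d. The condition r ≥ 1/2 is met by the maps y ↦ (1 - t/2)y + (t/2)z,
which move y only up to the midpoint of y and z; moving all the way to z would make the factor
unbounded. -/
theorem lintegral_comp_smul_add_le {g : Space d → ℝ≥0∞} (hg : Measurable g) {r : ℝ}
    (hr : 1 / 2 ≤ r) (c : Space d) : ∫⁻ y, g (r • y + c) ≤ 2 ^ d * ∫⁻ y, g y := by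
  have hr0 : 0 < r := by linarith
  have h1 : ∫⁻ y, g (r • y + c) = ∫⁻ y, g (y + c) ∂(Measure.map (fun x : Space d => r • x) volume) :=
    (lintegral_map (hg.comp (measurable_add_const c)) (measurable_const_smul r)).symm
  rw [h1, Measure.map_addHaar_smul _ hr0.ne', lintegral_smul_measure, lintegral_add_right_eq_self,
    finrank_euclideanSpace_fin, smul_eq_mul]
  gcongr
  rw [abs_of_pos (by positivity), ← inv_pow, ENNReal.ofReal_pow (by positivity)]
  gcongr
  rw [← ENNReal.ofReal_ofNat]
  refine ENNReal.ofReal_le_ofReal ?_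
  rw [inv_le_comm₀ hr0 (by norm_num)]
  linarith

/-- For fixed z the half segments from y towards z stay in the ball by convexity and have length at
most s. After exchanging the integrals, each t contributes one dilation of ratio 1 - t/2 ≥ 1/2. -/
theorem lintegral_sub_midpoint_rpow_le {p : ℝ} (hp : 1 < p) {v : Space d → ℝ}
    (hv : ContDiff ℝ 1 v) (x : Space d) (s : ℝ) {z : Space d} (hz : z ∈ Metric.ball x s) :
    ∫⁻ y in Metric.ball x s, ‖v (y + (1 / 2 : ℝ) • (z - y)) - v y‖ₑ ^ p ≤
      ENNReal.ofReal s ^ p * (2 ^ d * ∫⁻ y in Metric.ball x s, ‖gradient v y‖ₑ ^ p) := by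
  have hp0 : 0 < p := by linarith
  have hB : MeasurableSet (Metric.ball x s) := measurableSet_ball
  have hg := continuous_gradient_of_contDiff hv
  set g : Space d → ℝ≥0∞ := (Metric.ball x s).indicator fun y => ‖gradient v y‖ₑ ^ p with hgdef
  have hgm : Measurable g := (hg.enorm.measurable.pow_const p).indicator hB
  have hpt : ∀ y ∈ Metric.ball x s, ‖v (y + (1 / 2 : ℝ) • (z - y)) - v y‖ₑ ^ p ≤
      ENNReal.ofReal s ^ p * ∫⁻ t in Set.Icc (0 : ℝ) 1, g (y + t • (1 / 2 : ℝ) • (z - y)) := by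
    intro y hy
    refine (enorm_sub_rpow_le_lintegral hp hv y _).trans ?_
    gcongr ?_ ^ p * ?_
    · rw [← ofReal_norm]
      refine ENNReal.ofReal_le_ofReal ?_
      rw [norm_smul, Real.norm_of_nonneg (by norm_num)]
      rw [Metric.mem_ball, dist_eq_norm] at hy hz
      have : ‖z - y‖ ≤ ‖z - x‖ + ‖y - x‖ := by
        rw [← norm_neg (y - x), show z - y = (z - x) + -(y - x) by abel]
        exact norm_add_le _ _
      linarith
    · refine setLIntegral_mono' measurableSet_Icc fun t ht => ?_
      have : y + t • (1 / 2 : ℝ) • (z - y) ∈ Metric.ball x s := by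
        have h := (convex_ball x s).add_smul_sub_mem hy hz (t := t * (1 / 2))
          ⟨by linarith [ht.1], by linarith [ht.2]⟩
        rwa [mul_smul] at h
      rw [hgdef, Set.indicator_of_mem this]
  calc ∫⁻ y in Metric.ball x s, ‖v (y + (1 / 2 : ℝ) • (z - y)) - v y‖ₑ ^ p
      ≤ ∫⁻ y in Metric.ball x s, ENNReal.ofReal s ^ p *
          ∫⁻ t in Set.Icc (0 : ℝ) 1, g (y + t • (1 / 2 : ℝ) • (z - y)) :=
        setLIntegral_mono' hB hpt
    _ ≤ ∫⁻ y, ENNReal.ofReal s ^ p *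
          ∫⁻ t in Set.Icc (0 : ℝ) 1, g (y + t • (1 / 2 : ℝ) • (z - y)) := setLIntegral_le_lintegral _ _
    _ = ENNReal.ofReal s ^ p *
          ∫⁻ y, ∫⁻ t in Set.Icc (0 : ℝ) 1, g (y + t • (1 / 2 : ℝ) • (z - y)) := by
        rw [lintegral_const_mul']
        exact ENNReal.rpow_ne_top_of_nonneg hp0.le ENNReal.ofReal_ne_top
    _ = ENNReal.ofReal s ^ p *
          ∫⁻ t in Set.Icc (0 : ℝ) 1, ∫⁻ y, g (y + t • (1 / 2 : ℝ) • (z - y)) := by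
        congr 1
        refine lintegral_lintegral_swap (Measurable.aemeasurable ?_)
        refine hgm.comp (Continuous.measurable ?_)
        fun_prop
    _ ≤ ENNReal.ofReal s ^ p * ∫⁻ t in Set.Icc (0 : ℝ) 1, 2 ^ d * ∫⁻ y, g y := by
        gcongr ENNReal.ofReal s ^ p * ?_
        refine setLIntegral_mono' measurableSet_Icc fun t ht => ?_
        have := lintegral_comp_smul_add_le hgm (r := 1 - t * (1 / 2)) (by linarith [ht.2])
          ((t * (1 / 2)) • z)
        refine le_trans (le_of_eq (lintegral_congr fun y => ?_)) this
        congr 1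
        rw [sub_smul, one_smul, ← mul_smul, smul_sub]
        abel
    _ = _ := by
        rw [lintegral_const, hgdef, lintegral_indicator hB]
        simp

theorem add_half_smul_sub (y z : Space d) :
    y + (1 / 2 : ℝ) • (z - y) = z + (1 / 2 : ℝ) • (y - z) := by
  ext i
  simp
  ring

/-- The difference is split at the common midpoint of y and z; each half can then be integrated over
its own starting point with the other point fixed. -/
theorem enorm_sub_rpow_le_midpoint {p : ℝ} (hp : 1 < p) (v : Space d → ℝ) (y z : Space d) :
    ‖v y - v z‖ₑ ^ p ≤ 2 ^ (p - 1) * (‖v (y + (1 / 2 : ℝ) • (z - y)) - v y‖ₑ ^ p +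
      ‖v (z + (1 / 2 : ℝ) • (y - z)) - v z‖ₑ ^ p) := by
  have h1 : ‖v y - v z‖ₑ ≤ ‖v (y + (1 / 2 : ℝ) • (z - y)) - v y‖ₑ +
      ‖v (z + (1 / 2 : ℝ) • (y - z)) - v z‖ₑ := by
    rw [add_half_smul_sub y z, ← enorm_neg (v (z + (1 / 2 : ℝ) • (y - z)) - v y)]
    refine le_trans (le_of_eq ?_) (enorm_add_le _ _)
    congr 1
    ring
  exact (ENNReal.rpow_le_rpow h1 (by linarith)).trans
    (ENNReal.rpow_add_le_mul_rpow_add_rpow _ _ hp.le)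

/-- The oscillation of a function over a ball is controlled by its gradient. -/
theorem lintegral_lintegral_sub_rpow_le {p : ℝ} (hp : 1 < p) (x : Space d) (s : ℝ) :
    ∃ C : ℝ≥0∞, C ≠ ⊤ ∧ ∀ v : Space d → ℝ, ContDiff ℝ 1 v →
      ∫⁻ y in Metric.ball x s, ∫⁻ z in Metric.ball x s, ‖v y - v z‖ₑ ^ p ≤
        C * ∫⁻ y in Metric.ball x s, ‖gradient v y‖ₑ ^ p := by
  have hp0 : 0 < p := by linarith
  have hB : MeasurableSet (Metric.ball x s) := measurableSet_ball
  have hBf : volume (Metric.ball x s) ≠ ⊤ := measure_ball_lt_top.ne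
  set A : ℝ≥0∞ := ENNReal.ofReal s ^ p * 2 ^ d with hA
  have hAf : A ≠ ⊤ := ENNReal.mul_ne_top
    (ENNReal.rpow_ne_top_of_nonneg hp0.le ENNReal.ofReal_ne_top) (by simp)
  refine ⟨2 ^ (p - 1) * (A * volume (Metric.ball x s) + A * volume (Metric.ball x s)),
    ENNReal.mul_ne_top (ENNReal.rpow_ne_top_of_nonneg (by linarith) (by simp))
      (by simp [ENNReal.mul_ne_top hAf hBf]), fun v hv => ?_⟩
  set I := ∫⁻ y in Metric.ball x s, ‖gradient v y‖ₑ ^ p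
  have hvc := hv.continuous
  set f : Space d → Space d → ℝ≥0∞ := fun y z => ‖v (y + (1 / 2 : ℝ) • (z - y)) - v y‖ₑ ^ p
  have hfm : Measurable (Function.uncurry f) := by
    refine (Continuous.measurable ?_).pow_const p
    fun_prop
  have hbound : ∀ z ∈ Metric.ball x s, ∫⁻ y in Metric.ball x s, f y z ≤ A * I := fun z hz => by
    rw [hA, mul_assoc]; exact lintegral_sub_midpoint_rpow_le hp hv x s hz
  have hpt : ∀ y z, ‖v y - v z‖ₑ ^ p ≤ 2 ^ (p - 1) * (f y z + f z y) := by
    intro y z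
    exact enorm_sub_rpow_le_midpoint hp v y z
  have hm1 : ∀ y, Measurable (f y) := fun y => hfm.of_uncurry_left
  have hm3 : Measurable fun y => ∫⁻ z in Metric.ball x s, f y z :=
    Measurable.lintegral_prod_right' (f := Function.uncurry f) hfm
  calc ∫⁻ y in Metric.ball x s, ∫⁻ z in Metric.ball x s, ‖v y - v z‖ₑ ^ p
      ≤ ∫⁻ y in Metric.ball x s, ∫⁻ z in Metric.ball x s, 2 ^ (p - 1) * (f y z + f z y) :=
        lintegral_mono fun y => lintegral_mono fun z => hpt y z
    _ = 2 ^ (p - 1) * (∫⁻ y in Metric.ball x s, ∫⁻ z in Metric.ball x s, f y z) +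
        2 ^ (p - 1) * ∫⁻ y in Metric.ball x s, ∫⁻ z in Metric.ball x s, f z y := by
        have h2 : (2 : ℝ≥0∞) ^ (p - 1) ≠ ⊤ :=
          ENNReal.rpow_ne_top_of_nonneg (by linarith) (by simp)
        simp only [lintegral_const_mul' _ _ h2, lintegral_add_left (hm1 _)]
        rw [lintegral_add_left hm3, mul_add]
    _ ≤ 2 ^ (p - 1) * (A * I * volume (Metric.ball x s)) +
        2 ^ (p - 1) * (A * I * volume (Metric.ball x s)) := by
        gcongr
        · rw [lintegral_lintegral_swap hfm.aemeasurable]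
          refine (setLIntegral_mono' hB hbound).trans ?_
          simp
        · refine (setLIntegral_mono' hB hbound).trans ?_
          simp
    _ = _ := by ring

/-- Averaging over z in the ball B gives |B| v(y) = ∫(v(y) - v(z)) dz + ∫v; Jensen's inequality
reduces the first term to the oscillation estimate. -/
theorem lintegral_rpow_le_of_mean {p : ℝ} (hp : 1 < p) (x : Space d) {s : ℝ} (hs : 0 < s) :
    ∃ C : ℝ≥0∞, C ≠ ⊤ ∧ ∀ v : Space d → ℝ, ContDiff ℝ 1 v →
      ∫⁻ y in Metric.ball x s, ‖v y‖ₑ ^ p ≤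
        C * ((∫⁻ y in Metric.ball x s, ‖gradient v y‖ₑ ^ p) +
          ‖∫ y in Metric.ball x s, v y‖ₑ ^ p) := by
  have hp0 : 0 < p := by linarith
  obtain ⟨C, hC, h⟩ := lintegral_lintegral_sub_rpow_le (d := d) hp x s
  set m := volume (Metric.ball x s) with hm
  have hmf : m ≠ ⊤ := measure_ball_lt_top.ne
  have hm0 : m ≠ 0 := (Metric.measure_ball_pos _ _ hs).ne'
  have hmp0 : m ^ p ≠ 0 := by simp [hm0, hmf]
  have hmpf : m ^ p ≠ ⊤ := ENNReal.rpow_ne_top_of_nonneg hp0.le hmf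
  have hmp1 : m ^ (p - 1) ≠ ⊤ := ENNReal.rpow_ne_top_of_nonneg (by linarith) hmf
  have h2 : (2 : ℝ≥0∞) ^ (p - 1) ≠ ⊤ := ENNReal.rpow_ne_top_of_nonneg (by linarith) (by simp)
  refine ⟨(m ^ p)⁻¹ * (2 ^ (p - 1) * (m ^ (p - 1) * C + m)), ?_, fun v hv => ?_⟩
  · exact ENNReal.mul_ne_top (ENNReal.inv_ne_top.2 hmp0) (ENNReal.mul_ne_top h2
      (ENNReal.add_ne_top.2 ⟨ENNReal.mul_ne_top hmp1 hC, hmf⟩))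
  have hvc := hv.continuous
  have hint : IntegrableOn v (Metric.ball x s) :=
    (hvc.locallyIntegrable.integrableOn_isCompact (isCompact_closedBall x s)).mono_set
      Metric.ball_subset_closedBall
  set c := ∫ y in Metric.ball x s, v y with hc
  have hpt : ∀ y, m ^ p * ‖v y‖ₑ ^ p ≤ 2 ^ (p - 1) *
      (m ^ (p - 1) * (∫⁻ z in Metric.ball x s, ‖v y - v z‖ₑ ^ p) + ‖c‖ₑ ^ p) := by
    intro y
    have h1 : m * ‖v y‖ₑ ≤ (∫⁻ z in Metric.ball x s, ‖v y - v z‖ₑ) + ‖c‖ₑ := by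
      have e : (m.toReal * v y) = (∫ z in Metric.ball x s, (v y - v z)) + c := by
        have hi : Integrable (fun _ => v y) (volume.restrict (Metric.ball x s)) :=
          integrableOn_const hmf
        rw [integral_sub hi hint, hc]
        simp [Measure.real, hm]
      have e2 : m * ‖v y‖ₑ = ‖m.toReal * v y‖ₑ := by
        rw [enorm_mul, Real.enorm_of_nonneg ENNReal.toReal_nonneg, ENNReal.ofReal_toReal hmf]
      rw [e2, e]
      refine (enorm_add_le _ _).trans ?_
      gcongr
      exact enorm_integral_le_lintegral_enorm _
    rw [← ENNReal.mul_rpow_of_nonneg _ _ hp0.le]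
    refine (ENNReal.rpow_le_rpow h1 hp0.le).trans
      ((ENNReal.rpow_add_le_mul_rpow_add_rpow _ _ hp.le).trans ?_)
    gcongr
    refine (lintegral_rpow_le_mul hp ?_).trans (le_of_eq ?_)
    · exact (continuous_const.sub hvc).enorm.measurable.aemeasurable
    · simp [hm]
  have hint2 : m ^ p * ∫⁻ y in Metric.ball x s, ‖v y‖ₑ ^ p ≤ 2 ^ (p - 1) *
      (m ^ (p - 1) * (C * ∫⁻ y in Metric.ball x s, ‖gradient v y‖ₑ ^ p) + ‖c‖ₑ ^ p * m) := by
    rw [← lintegral_const_mul' _ _ hmpf]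
    refine (lintegral_mono hpt).trans ?_
    rw [lintegral_const_mul' _ _ h2, lintegral_add_right _ measurable_const,
      lintegral_const_mul' _ _ hmp1]
    gcongr
    · exact h v hv
    · simp [hm]
  calc ∫⁻ y in Metric.ball x s, ‖v y‖ₑ ^ p
      = (m ^ p)⁻¹ * (m ^ p * ∫⁻ y in Metric.ball x s, ‖v y‖ₑ ^ p) := by
        rw [← mul_assoc, ENNReal.inv_mul_cancel hmp0 hmpf, one_mul]
    _ ≤ (m ^ p)⁻¹ * (2 ^ (p - 1) * (m ^ (p - 1) *
        (C * ∫⁻ y in Metric.ball x s, ‖gradient v y‖ₑ ^ p) + ‖c‖ₑ ^ p * m)) := by gcongr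
    _ ≤ (m ^ p)⁻¹ * (2 ^ (p - 1) * ((m ^ (p - 1) * C + m) *
        ((∫⁻ y in Metric.ball x s, ‖gradient v y‖ₑ ^ p) + ‖c‖ₑ ^ p))) := by
        gcongr
        rw [add_mul, mul_add, mul_add, ← mul_assoc, mul_comm _ m]
        exact add_le_add le_self_add le_add_self
    _ = _ := by ring

/-- Poincaré's inequality for functions that vanish outside a bounded set. -/
theorem lintegral_rpow_le_of_eq_zero (hd : 1 ≤ d) {p : ℝ} (hp : 1 < p) {Ω : Set (Space d)}
    (hΩb : Bornology.IsBounded Ω) :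
    ∃ C : ℝ≥0∞, C ≠ ⊤ ∧ ∀ v : Space d → ℝ, ContDiff ℝ 1 v → (∀ y ∉ Ω, v y = 0) →
      ∫⁻ y in Ω, ‖v y‖ₑ ^ p ≤ C * ∫⁻ y, ‖gradient v y‖ₑ ^ p := by
  have hp0 : 0 < p := by linarith
  obtain ⟨r, hr⟩ := hΩb.subset_closedBall (0 : Space d)
  have : Nonempty (Fin d) := ⟨⟨0, hd⟩⟩
  set s := |r| + 2
  obtain ⟨C, hC, h⟩ := lintegral_lintegral_sub_rpow_le (d := d) hp 0 s
  -- A shell of positive measure outside Ω. There v vanishes, so |v(y)|^p |Z| is part of the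
  -- oscillation integral over the large ball.
  set Z : Set (Space d) := Metric.ball 0 s ∩ (Metric.closedBall 0 r)ᶜ
  have hZo : IsOpen Z := Metric.isOpen_ball.inter Metric.isClosed_closedBall.isOpen_compl
  have hZne : Z.Nonempty := by
    obtain ⟨e, he⟩ := exists_norm_eq (Space d) (show 0 ≤ |r| + 1 by positivity)
    refine ⟨e, ?_, ?_⟩
    · simp [s, he]
    · simp only [Set.mem_compl_iff, mem_closedBall_zero_iff, he, not_le]
      linarith [le_abs_self r]
  have hZ0 : volume Z ≠ 0 := (hZo.measure_pos _ hZne).ne'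
  have hZf : volume Z ≠ ⊤ := ((measure_mono Set.inter_subset_left).trans_lt
    measure_ball_lt_top).ne
  refine ⟨(volume Z)⁻¹ * C, ENNReal.mul_ne_top (ENNReal.inv_ne_top.2 hZ0) hC,
    fun v hv hv0 => ?_⟩
  have hΩs : Ω ⊆ Metric.ball 0 s := hr.trans (Metric.closedBall_subset_ball (by
    simp only [s]; linarith [le_abs_self r]))
  have h1 : ∀ y, ‖v y‖ₑ ^ p * volume Z ≤ ∫⁻ z in Metric.ball 0 s, ‖v y - v z‖ₑ ^ p := by
    intro y
    rw [← setLIntegral_const]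
    refine le_trans ?_ (lintegral_mono_set (Set.inter_subset_left : Z ⊆ _))
    refine setLIntegral_mono' hZo.measurableSet fun z hz => ?_
    rw [hv0 z fun hzΩ => hz.2 (hr hzΩ), sub_zero]
  have h2 : (∫⁻ y in Ω, ‖v y‖ₑ ^ p) * volume Z ≤ C * ∫⁻ y, ‖gradient v y‖ₑ ^ p := by
    rw [← lintegral_mul_const' _ _ hZf]
    calc ∫⁻ y in Ω, ‖v y‖ₑ ^ p * volume Z
        ≤ ∫⁻ y in Metric.ball 0 s, ‖v y‖ₑ ^ p * volume Z := lintegral_mono_set hΩs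
      _ ≤ ∫⁻ y in Metric.ball 0 s, ∫⁻ z in Metric.ball 0 s, ‖v y - v z‖ₑ ^ p :=
          lintegral_mono h1
      _ ≤ C * ∫⁻ y in Metric.ball 0 s, ‖gradient v y‖ₑ ^ p := h v hv
      _ ≤ _ := by gcongr; exact Measure.restrict_le_self
  calc ∫⁻ y in Ω, ‖v y‖ₑ ^ p = (∫⁻ y in Ω, ‖v y‖ₑ ^ p) * volume Z * (volume Z)⁻¹ := by
        rw [mul_assoc, ENNReal.mul_inv_cancel hZ0 hZf, mul_one]
    _ ≤ (C * ∫⁻ y, ‖gradient v y‖ₑ ^ p) * (volume Z)⁻¹ := by gcongr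
    _ = _ := by ring

end

section

variable {d : ℕ}

/-! ### The space of gradients of functions with zero boundary values -/

theorem eLpNorm_ofReal_eq {α E : Type*} [MeasurableSpace α] {ν : Measure α} [NormedAddCommGroup E]
    {p : ℝ} (hp : 0 < p) (f : α → E) :
    eLpNorm f (ENNReal.ofReal p) ν = (∫⁻ x, ‖f x‖ₑ ^ p ∂ν) ^ (1 / p) := by
  rw [eLpNorm_eq_lintegral_rpow_enorm_toReal (by simpa using hp) ENNReal.ofReal_ne_top,
    ENNReal.toReal_ofReal hp.le]

theorem gradient_add {φ ψ : Space d → ℝ} {x : Space d} (hφ : DifferentiableAt ℝ φ x)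
    (hψ : DifferentiableAt ℝ ψ x) : gradient (φ + ψ) x = gradient φ x + gradient ψ x := by
  simp [gradient, fderiv_add hφ hψ]

theorem gradient_const_smul {φ : Space d → ℝ} {x : Space d} (c : ℝ)
    (hφ : DifferentiableAt ℝ φ x) : gradient (c • φ) x = c • gradient φ x := by
  simp [gradient, fderiv_const_smul hφ]

theorem gradient_sub {φ ψ : Space d → ℝ} {x : Space d} (hφ : DifferentiableAt ℝ φ x)
    (hψ : DifferentiableAt ℝ ψ x) : gradient (φ - ψ) x = gradient φ x - gradient ψ x := by
  simp [gradient, fderiv_sub hφ hψ]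

theorem IsTest.differentiable {Ω : Set (Space d)} {φ : Space d → ℝ} (hφ : IsTest Ω φ) :
    Differentiable ℝ φ := hφ.1.differentiable (by simp)

theorem IsTest.sub {Ω : Set (Space d)} {φ ψ : Space d → ℝ} (hφ : IsTest Ω φ)
    (hψ : IsTest Ω ψ) : IsTest Ω (φ - ψ) := by
  have h := hφ.add (hψ.const_smul (-1))
  rwa [neg_one_smul, ← sub_eq_add_neg] at h

/-- The test functions in `Ω`. -/
def testSpace (Ω : Set (Space d)) : Submodule ℝ (Space d → ℝ) where
  carrier := {φ | IsTest Ω φ}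
  zero_mem' := IsTest.zero Ω
  add_mem' := IsTest.add
  smul_mem' c _ hφ := IsTest.const_smul hφ c

/-- The gradients of test functions, as elements of `L^p`. -/
def testGrad (Ω : Set (Space d)) (p : ℝ) :
    Submodule ℝ (Lp (Space d) (ENNReal.ofReal p) (volume.restrict Ω)) where
  carrier := {x | ∃ φ, IsTest Ω φ ∧ x =ᵐ[volume.restrict Ω] gradient φ}
  zero_mem' := by
    refine ⟨fun _ => 0, IsTest.zero Ω, (Lp.coeFn_zero _ _ _).trans ?_⟩
    exact Eventually.of_forall fun x => by simp [gradient]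
  add_mem' := by
    rintro x y ⟨φ, hφ, hx⟩ ⟨ψ, hψ, hy⟩
    refine ⟨φ + ψ, hφ.add hψ, ?_⟩
    filter_upwards [Lp.coeFn_add x y, hx, hy] with z h1 h2 h3
    rw [h1, Pi.add_apply, h2, h3, gradient_add (hφ.differentiable z) (hψ.differentiable z)]
  smul_mem' := by
    rintro c x ⟨φ, hφ, hx⟩
    refine ⟨c • φ, hφ.const_smul c, ?_⟩
    filter_upwards [Lp.coeFn_smul c x, hx] with z h1 h2
    rw [h1, Pi.smul_apply, h2, gradient_const_smul c (hφ.differentiable z)]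

theorem IsTest.toLp_mem_testGrad {Ω : Set (Space d)} (hΩb : Bornology.IsBounded Ω) {p : ℝ}
    {φ : Space d → ℝ} (hφ : IsTest Ω φ) :
    (memLp_of_continuous hΩb hφ.continuous_gradient).toLp (gradient φ) ∈ testGrad Ω p :=
  ⟨φ, hφ, MemLp.coeFn_toLp _⟩

/-- Poincaré's inequality for test functions. -/
theorem exists_eLpNorm_le_eLpNorm_gradient (hd : 1 ≤ d) {p : ℝ} (hp : 1 < p) {Ω : Set (Space d)}
    (hΩb : Bornology.IsBounded Ω) : ∃ C : ℝ≥0∞, C ≠ ⊤ ∧ ∀ φ : Space d → ℝ, IsTest Ω φ →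
      eLpNorm φ (ENNReal.ofReal p) (volume.restrict Ω) ≤
        C * eLpNorm (gradient φ) (ENNReal.ofReal p) (volume.restrict Ω) := by
  have hp0 : 0 < p := by linarith
  obtain ⟨C, hC, h⟩ := lintegral_rpow_le_of_eq_zero hd hp hΩb
  refine ⟨C ^ (1 / p), ENNReal.rpow_ne_top_of_nonneg (by positivity) hC, fun φ hφ => ?_⟩
  rw [eLpNorm_ofReal_eq hp0, eLpNorm_ofReal_eq hp0, ← ENNReal.mul_rpow_of_nonneg _ _ (by positivity)]
  refine ENNReal.rpow_le_rpow ?_ (by positivity)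
  refine (h φ hφ.contDiff_one fun y hy =>
    image_eq_zero_of_notMem_tsupport fun hy' => hy (hφ.2.2 hy')).trans ?_
  gcongr C * ?_
  refine le_of_eq (setLIntegral_eq_of_support_subset ?_).symm
  intro x hx
  by_contra hxΩ
  refine hx ?_
  have : gradient φ x = 0 := hφ.gradient_eq_zero fun h => hxΩ (hφ.2.2 h)
  simp [this, hp0]

/-- Every limit of gradients of test functions is the gradient of a function with zero boundary
values. -/
theorem exists_mem_W1p0_of_mem_closure (hd : 1 ≤ d) {p : ℝ} (hp : 1 < p)
    [Fact (1 ≤ ENNReal.ofReal p)] {Ω : Set (Space d)} (hΩ : IsOpen Ω)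
    (hΩb : Bornology.IsBounded Ω) {x : Lp (Space d) (ENNReal.ofReal p) (volume.restrict Ω)}
    (hx : x ∈ (testGrad Ω p).topologicalClosure) :
    ∃ u : W1p Ω p, u ∈ W1p0 Ω p ∧ weakGrad Ω u =ᵐ[volume.restrict Ω] x := by
  obtain ⟨C, hC, hpoin⟩ := exists_eLpNorm_le_eLpNorm_gradient hd hp hΩb
  obtain ⟨y, hy, hyx⟩ := mem_closure_iff_seq_limit.1 hx
  choose φ hφ hφy using hy
  have hφm : ∀ n, MemLp (φ n) (ENNReal.ofReal p) (volume.restrict Ω) := fun n =>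
    memLp_of_continuous hΩb (hφ n).1.continuous
  have hgm : ∀ n, MemLp (gradient (φ n)) (ENNReal.ofReal p) (volume.restrict Ω) := fun n =>
    memLp_of_continuous hΩb (hφ n).continuous_gradient
  set U : ℕ → Lp ℝ (ENNReal.ofReal p) (volume.restrict Ω) := fun n => (hφm n).toLp with hU
  -- Poincaré's inequality for φ n - φ m: convergence of the gradients makes the functions
  -- themselves a Cauchy sequence.
  have hdist : ∀ n m, dist (U n) (U m) ≤ C.toReal * dist (y n) (y m) := by
    intro n m
    have h := hpoin (φ n - φ m) ((hφ n).sub (hφ m))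
    have e : eLpNorm (gradient (φ n - φ m)) (ENNReal.ofReal p) (volume.restrict Ω) =
        eLpNorm ((y n : Space d → Space d) - (y m : Space d → Space d)) (ENNReal.ofReal p) (volume.restrict Ω) := by
      refine eLpNorm_congr_ae ?_
      filter_upwards [hφy n, hφy m] with z h1 h2
      rw [gradient_sub ((hφ n).differentiable z) ((hφ m).differentiable z), Pi.sub_apply, h1, h2]
    rw [e] at h
    rw [dist_edist, dist_edist (y n), Lp.edist_def, Lp.edist_def, ← ENNReal.toReal_mul]
    refine ENNReal.toReal_mono (ENNReal.mul_ne_top hC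
      (((Lp.memLp (y n)).sub (Lp.memLp (y m))).eLpNorm_ne_top)) (le_trans (le_of_eq ?_) h)
    refine eLpNorm_congr_ae ?_
    filter_upwards [(hφm n).coeFn_toLp, (hφm m).coeFn_toLp] with z h1 h2
    simp only [Pi.sub_apply, hU, h1, h2]
  have hcau : CauchySeq U := by
    have hyc := hyx.cauchySeq
    rw [Metric.cauchySeq_iff] at hyc ⊢
    intro ε hε
    obtain ⟨N, hN⟩ := hyc (ε / (C.toReal + 1)) (by positivity)
    refine ⟨N, fun m hm n hn => (hdist m n).trans_lt ?_⟩
    have h0 : 0 ≤ C.toReal := ENNReal.toReal_nonneg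
    have h1 := hN m hm n hn
    rw [lt_div_iff₀ (by positivity)] at h1
    have h2 : 0 ≤ dist (y m) (y n) := dist_nonneg
    linarith
  obtain ⟨u, hu⟩ := cauchySeq_tendsto_of_complete hcau
  have h1 : Tendsto (fun n => eLpNorm ((u : Space d → ℝ) - φ n) (ENNReal.ofReal p) (volume.restrict Ω)) atTop
      (𝓝 0) := by
    have := (tendsto_iff_edist_tendsto_0.1 hu)
    refine this.congr fun n => ?_
    rw [edist_comm, Lp.edist_def]
    refine eLpNorm_congr_ae ?_
    filter_upwards [(hφm n).coeFn_toLp] with z h1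
    simp only [Pi.sub_apply, hU, h1]
  have h2 : Tendsto (fun n => eLpNorm ((x : Space d → Space d) - gradient (φ n)) (ENNReal.ofReal p)
      (volume.restrict Ω)) atTop (𝓝 0) := by
    have := (tendsto_iff_edist_tendsto_0.1 hyx)
    refine this.congr fun n => ?_
    rw [edist_comm, Lp.edist_def]
    refine eLpNorm_congr_ae ?_
    filter_upwards [hφy n] with z h1
    simp only [Pi.sub_apply, h1]
  have hw : HasWeakGradient Ω u x := hasWeakGradient_of_tendsto hΩb Fact.out hφm hgm (Lp.memLp u)
    (Lp.memLp x) (fun n => hasWeakGradient_of_contDiff Ω (hφ n).contDiff_one) h1 h2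
  exact ⟨⟨u, Lp.memLp u, x, Lp.memLp x, hw⟩, ⟨x, Lp.memLp x, hw, φ, hφ, h1, h2⟩,
    hw.weakGrad_ae_eq hΩ⟩

/-- The weak gradient of a function in `W^{1,p}(Ω)`, as an element of `L^p`. -/
def weakGradLp {Ω : Set (Space d)} (hΩ : IsOpen Ω) {p : ℝ} (u : W1p Ω p) :
    Lp (Space d) (ENNReal.ofReal p) (volume.restrict Ω) :=
  (memLp_weakGrad hΩ u).toLp (weakGrad Ω u)

theorem weakGradLp_ae_eq {Ω : Set (Space d)} (hΩ : IsOpen Ω) {p : ℝ} (u : W1p Ω p) :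
    weakGradLp hΩ u =ᵐ[volume.restrict Ω] weakGrad Ω u := MemLp.coeFn_toLp _

theorem weakGradLp_mem_closure {p : ℝ} [Fact (1 ≤ ENNReal.ofReal p)] {Ω : Set (Space d)}
    (hΩ : IsOpen Ω) (hΩb : Bornology.IsBounded Ω) {u : W1p Ω p} (hu : u ∈ W1p0 Ω p) :
    weakGradLp hΩ u ∈ (testGrad Ω p).topologicalClosure := by
  obtain ⟨G, hG, hw, φ, hφ, -, h2⟩ := hu
  refine mem_closure_of_tendsto (f := fun n =>
    (memLp_of_continuous hΩb (hφ n).continuous_gradient).toLp (gradient (φ n))) (b := atTop) ?_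
    (Eventually.of_forall fun n => (hφ n).toLp_mem_testGrad hΩb)
  rw [tendsto_iff_edist_tendsto_0]
  refine h2.congr fun n => ?_
  rw [edist_comm, Lp.edist_def]
  refine eLpNorm_congr_ae ?_
  filter_upwards [(memLp_of_continuous (q := ENNReal.ofReal p) hΩb
    (hφ n).continuous_gradient).coeFn_toLp, weakGradLp_ae_eq hΩ u, hw.weakGrad_ae_eq hΩ]
    with z h1 h2 h3
  simp only [Pi.sub_apply, h1, h2, h3]

end

section

variable {d : ℕ}

/-! ### Mollification of Lipschitz functions -/

/-- A shrinking sequence of bump functions. -/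
def mollifier (d n : ℕ) : ContDiffBump (0 : Space d) where
  rIn := 1 / (2 * ((n : ℝ) + 1))
  rOut := 1 / ((n : ℝ) + 1)
  rIn_pos := by positivity
  rIn_lt_rOut := by
    rw [div_lt_div_iff_of_pos_left one_pos (by positivity) (by positivity)]
    linarith [(Nat.cast_nonneg n : (0 : ℝ) ≤ n)]

/-- The mollifications of a function. -/
def mollify (u : Space d → ℝ) (n : ℕ) : Space d → ℝ :=
  convolution ((mollifier d n).normed volume) u (ContinuousLinearMap.lsmul ℝ ℝ) volume

theorem contDiff_mollify {u : Space d → ℝ} (hu : Continuous u) (n : ℕ) :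
    ContDiff ℝ ∞ (mollify u n) :=
  (mollifier d n).hasCompactSupport_normed.contDiff_convolution_left _
    (mollifier d n).contDiff_normed hu.locallyIntegrable

theorem dist_mollify_le {u : Space d → ℝ} {K : NNReal} (hu : LipschitzWith K u) (n : ℕ)
    (x : Space d) : dist (mollify u n x) (u x) ≤ K * (1 / ((n : ℝ) + 1)) := by
  refine (mollifier d n).dist_normed_convolution_le hu.continuous.aestronglyMeasurable
    fun y hy => ?_
  refine (hu.dist_le_mul y x).trans ?_
  gcongr
  exact (Metric.mem_ball.1 hy).le

theorem mollify_eq_zero {u : Space d → ℝ} (hu : Continuous u) {n : ℕ} {x : Space d}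
    (h : ∀ y ∈ Metric.ball x (1 / ((n : ℝ) + 1)), u y = 0) : mollify u n x = 0 := by
  have hx : u x = 0 := h x (Metric.mem_ball_self (by positivity))
  have := (mollifier d n).dist_normed_convolution_le (ε := 0) (μ := volume) (g := u) (x₀ := x)
    hu.aestronglyMeasurable fun y hy => by rw [h y hy, hx, dist_self]
  rw [hx, dist_zero_right] at this
  exact norm_le_zero_iff.1 this

theorem ae_differentiableAt_sub {u : Space d → ℝ} {K : NNReal} (hu : LipschitzWith K u)
    (x : Space d) : ∀ᵐ y, DifferentiableAt ℝ u (x - y) :=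
  (Measure.measurePreserving_sub_left volume x).quasiMeasurePreserving.ae hu.ae_differentiableAt

/-- By Rademacher's theorem u is differentiable at x - y for almost every y, and the increments are
dominated by K times the mollifier, so the derivative may fall on u. In this form it inherits the
bound K and converges almost everywhere. -/
theorem hasFDerivAt_mollify {u : Space d → ℝ} {K : NNReal} (hu : LipschitzWith K u) (n : ℕ)
    (x : Space d) : HasFDerivAt (mollify u n)
      (convolution ((mollifier d n).normed volume) (fderiv ℝ u) (ContinuousLinearMap.lsmul ℝ ℝ)
        volume x) x := by
  set η := (mollifier d n).normed volume with hη
  have hηc : Continuous η := (mollifier d n).continuous_normed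
  have hηi : Integrable η := (mollifier d n).integrable_normed
  have hη0 : ∀ y, 0 ≤ η y := fun y => (mollifier d n).nonneg_normed y
  have key := hasFDerivAt_integral_of_dominated_loc_of_lip (𝕜 := ℝ) (μ := volume)
    (F := fun (x : Space d) (y : Space d) => η y • u (x - y)) (x₀ := x) (s := Set.univ)
    (bound := fun y => η y * K) (F' := fun y => η y • fderiv ℝ u (x - y)) univ_mem
    (Eventually.of_forall fun z =>
      (hηc.smul (hu.continuous.comp (continuous_const.sub continuous_id))).aestronglyMeasurable)
    ((hηc.smul (hu.continuous.comp
      (continuous_const.sub continuous_id))).integrable_of_hasCompactSupport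
      ((mollifier d n).hasCompactSupport_normed.smul_right))
    (hηc.aestronglyMeasurable.smul ((measurable_fderiv ℝ u).comp
      (measurable_const.sub measurable_id)).aestronglyMeasurable)
    (Eventually.of_forall fun y => by
      refine LipschitzWith.lipschitzOnWith (LipschitzWith.of_dist_le_mul fun a b => ?_)
      rw [dist_eq_norm, ← smul_sub, norm_smul, Real.norm_of_nonneg (hη0 y)]
      simp only [Real.coe_nnabs]
      rw [abs_of_nonneg (mul_nonneg (hη0 y) K.coe_nonneg), mul_assoc]
      refine mul_le_mul_of_nonneg_left ?_ (hη0 y)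
      have := hu.dist_le_mul (a - y) (b - y)
      rwa [dist_sub_right, dist_eq_norm] at this)
    (hηi.mul_const _)
    (by
      filter_upwards [ae_differentiableAt_sub hu x] with y hy
      have h1 : HasFDerivAt (fun z : Space d => z - y) (ContinuousLinearMap.id ℝ (Space d)) x :=
        (hasFDerivAt_id x).sub_const y
      have h2 := hy.hasFDerivAt.comp x h1
      have h3 := h2.const_smul (η y)
      rw [ContinuousLinearMap.comp_id] at h3
      exact h3)
  exact key.2

theorem norm_fderiv_mollify_le {u : Space d → ℝ} {K : NNReal} (hu : LipschitzWith K u) (n : ℕ)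
    (x : Space d) : ‖fderiv ℝ (mollify u n) x‖ ≤ K := by
  rw [(hasFDerivAt_mollify hu n x).fderiv]
  have hη0 : ∀ y, 0 ≤ (mollifier d n).normed volume y := fun y => (mollifier d n).nonneg_normed y
  unfold convolution
  refine (norm_integral_le_of_norm_le ((mollifier d n).integrable_normed.mul_const (K : ℝ))
    (Eventually.of_forall fun y => ?_)).trans (le_of_eq ?_)
  · simp only [ContinuousLinearMap.lsmul_apply]
    rw [norm_smul, Real.norm_of_nonneg (hη0 y)]
    exact mul_le_mul_of_nonneg_left (norm_fderiv_le_of_lipschitz ℝ hu) (hη0 y)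
  · rw [integral_mul_const, (mollifier d n).integral_normed, one_mul]

theorem ae_tendsto_gradient_mollify {u : Space d → ℝ} {K : NNReal} (hu : LipschitzWith K u) :
    ∀ᵐ x, Tendsto (fun n => gradient (mollify u n) x) atTop (𝓝 (gradient u x)) := by
  have hloc : LocallyIntegrable (fderiv ℝ u) (volume : Measure (Space d)) := by
    refine (memLp_top_of_bound (measurable_fderiv ℝ u).aestronglyMeasurable (K : ℝ)
      (Eventually.of_forall fun x => norm_fderiv_le_of_lipschitz ℝ hu)).locallyIntegrable le_top
  have hlim : Tendsto (fun n => (mollifier d n).rOut) atTop (𝓝 0) :=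
    tendsto_one_div_add_atTop_nhds_zero_nat
  -- Convergence at Lebesgue points of the derivative; K = 2 is the ratio of the outer to the inner
  -- radius of the bumps.
  have := ContDiffBump.ae_convolution_tendsto_right_of_locallyIntegrable (φ := mollifier d)
    (K := 2) hlim (Eventually.of_forall fun n => by
      simp only [mollifier]
      rw [mul_one_div, mul_comm 2, div_mul_cancel_right₀ (by norm_num : (2:ℝ) ≠ 0)]
      simp) hloc
  filter_upwards [this] with x hx
  have h2 := ((InnerProductSpace.toDual ℝ (Space d)).symm.continuous.tendsto _).comp hx
  refine h2.congr fun n => ?_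
  simp only [Function.comp, gradient, (hasFDerivAt_mollify hu n x).fderiv]

theorem norm_gradient_le_of_lipschitz {u : Space d → ℝ} {K : NNReal} (hu : LipschitzWith K u)
    (x : Space d) : ‖gradient u x‖ ≤ K := by
  rw [norm_gradient]; exact norm_fderiv_le_of_lipschitz ℝ hu

theorem measurable_gradient (u : Space d → ℝ) : Measurable (gradient u) :=
  (LinearIsometryEquiv.continuous _).measurable.comp (measurable_fderiv ℝ u)

theorem tendsto_lintegral_gradient_mollify {p : ℝ} (hp : 0 < p) {u : Space d → ℝ} {K : NNReal}
    (hu : LipschitzWith K u) {S : Set (Space d)} (hS : Bornology.IsBounded S) :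
    Tendsto (fun n => ∫⁻ x in S, ‖gradient (mollify u n) x - gradient u x‖ₑ ^ p) atTop (𝓝 0) := by
  have hfin : IsFiniteMeasure (volume.restrict S : Measure (Space d)) := isFiniteMeasure_restrict hS
  have h0 : ∫⁻ x in S, (0 : ℝ≥0∞) = 0 := by simp
  rw [← h0]
  refine tendsto_lintegral_of_dominated_convergence (fun _ => ENNReal.ofReal (K + K) ^ p)
    (fun n => ((measurable_gradient _).sub (measurable_gradient _)).enorm.pow_const p)
    (fun n => Eventually.of_forall fun x => ?_) ?_ ?_
  · refine ENNReal.rpow_le_rpow ?_ hp.le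
    rw [← ofReal_norm]
    refine ENNReal.ofReal_le_ofReal ((norm_sub_le _ _).trans (add_le_add ?_ ?_))
    · rw [norm_gradient]; exact norm_fderiv_mollify_le hu n x
    · exact norm_gradient_le_of_lipschitz hu x
  · rw [lintegral_const]
    exact ENNReal.mul_ne_top (ENNReal.rpow_ne_top_of_nonneg hp.le ENNReal.ofReal_ne_top)
      (measure_ne_top _ _)
  · filter_upwards [ae_restrict_of_ae (ae_tendsto_gradient_mollify hu)] with x hx
    have h1 : Tendsto (fun n => ‖gradient (mollify u n) x - gradient u x‖ₑ) atTop (𝓝 0) := by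
      have := (hx.sub_const (gradient u x)).enorm
      simpa using this
    have h2 := (ENNReal.continuous_rpow_const (y := p)).tendsto 0 |>.comp h1
    rw [ENNReal.zero_rpow_of_pos hp] at h2
    exact h2

/-- A Lipschitz function with compact support in `Ω` is approximated by test functions. -/
theorem exists_isTest_approx {p : ℝ} (hp : 1 < p) {Ω : Set (Space d)} (hΩ : IsOpen Ω)
    (hΩb : Bornology.IsBounded Ω) {u : Space d → ℝ} {K : NNReal} (hu : LipschitzWith K u)
    (hc : IsCompact (tsupport u)) (hsub : tsupport u ⊆ Ω) {ε : ℝ≥0∞} (hε : 0 < ε) :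
    ∃ ζ : Space d → ℝ, IsTest Ω ζ ∧
      eLpNorm (gradient ζ - gradient u) (ENNReal.ofReal p) (volume.restrict Ω) < ε := by
  have hp0 : 0 < p := by linarith
  obtain ⟨δ, hδ, hδΩ⟩ := hc.exists_cthickening_subset_open hΩ hsub
  have h1 := tendsto_lintegral_gradient_mollify hp0 hu hΩb
  have h2 : Tendsto (fun n => eLpNorm (gradient (mollify u n) - gradient u) (ENNReal.ofReal p)
      (volume.restrict Ω)) atTop (𝓝 0) := by
    have := (ENNReal.continuous_rpow_const (y := 1 / p)).tendsto 0 |>.comp h1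
    rw [ENNReal.zero_rpow_of_pos (by positivity)] at this
    refine this.congr fun n => ?_
    rw [eLpNorm_ofReal_eq hp0]
    rfl
  obtain ⟨n, hn1, hn2⟩ := ((h2.eventually_lt_const hε).and
    ((tendsto_one_div_add_atTop_nhds_zero_nat (𝕜 := ℝ)).eventually_lt_const hδ)).exists
  have hts : tsupport (mollify u n) ⊆ Metric.cthickening δ (tsupport u) := by
    refine closure_minimal (fun x hx => ?_) Metric.isClosed_cthickening
    by_contra hcon
    refine hx (mollify_eq_zero hu.continuous fun y hy => ?_)
    refine image_eq_zero_of_notMem_tsupport fun hy' => hcon ?_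
    refine Metric.mem_cthickening_of_dist_le x y δ _ hy' ?_
    rw [dist_comm]
    exact ((Metric.mem_ball.1 hy).trans hn2).le
  refine ⟨mollify u n, ⟨contDiff_mollify hu.continuous n, ?_, hts.trans hδΩ⟩, hn1⟩
  exact hc.cthickening.of_isClosed_subset (isClosed_tsupport _) hts

/-- The Poincaré inequality with a mean value, for Lipschitz functions. -/
theorem lintegral_rpow_le_of_mean_of_lipschitz {p : ℝ} (hp : 1 < p) (x : Space d) {s : ℝ}
    (hs : 0 < s) : ∃ C : ℝ≥0∞, C ≠ ⊤ ∧ ∀ (u : Space d → ℝ) (K : NNReal), LipschitzWith K u →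
      ∫⁻ y in Metric.ball x s, ‖u y‖ₑ ^ p ≤
        C * ((∫⁻ y in Metric.ball x s, ‖gradient u y‖ₑ ^ p) +
          ‖∫ y in Metric.ball x s, u y‖ₑ ^ p) := by
  have hp0 : 0 < p := by linarith
  obtain ⟨C, hC, h⟩ := lintegral_rpow_le_of_mean (d := d) hp x hs
  refine ⟨C, hC, fun u K hu => ?_⟩
  have hfin : IsFiniteMeasure (volume.restrict (Metric.ball x s)) :=
    isFiniteMeasure_restrict Metric.isBounded_ball
  have hbd : ∀ y ∈ Metric.ball x s, ‖u y‖ ≤ ‖u x‖ + K * s := by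
    intro y hy
    have h1 := hu.dist_le_mul y x
    rw [dist_eq_norm] at h1
    have h2 : ‖u y‖ ≤ ‖u x‖ + ‖u y - u x‖ := by
      rw [add_comm]; simpa using norm_add_le (u y - u x) (u x)
    have h3 : (K : ℝ) * dist y x ≤ K * s := by
      gcongr; exact (Metric.mem_ball.1 hy).le
    linarith
  have hmol : ∀ n, ∀ y ∈ Metric.ball x s, ‖mollify u n y‖ ≤ ‖u x‖ + K * s + K := by
    intro n y hy
    have h1 := dist_mollify_le hu n y
    rw [dist_eq_norm] at h1
    have h2 : ‖mollify u n y‖ ≤ ‖mollify u n y - u y‖ + ‖u y‖ := by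
      simpa using norm_add_le (mollify u n y - u y) (u y)
    have h3 : (K : ℝ) * (1 / ((n : ℝ) + 1)) ≤ K := by
      refine mul_le_of_le_one_right K.2 ?_
      rw [div_le_one (by positivity)]
      linarith [(Nat.cast_nonneg n : (0 : ℝ) ≤ n)]
    linarith [hbd y hy]
  have hlim : ∀ y, Tendsto (fun n => mollify u n y) atTop (𝓝 (u y)) := by
    intro y
    rw [tendsto_iff_dist_tendsto_zero]
    refine squeeze_zero (fun _ => dist_nonneg) (fun n => dist_mollify_le hu n y) ?_
    simpa using (tendsto_one_div_add_atTop_nhds_zero_nat (𝕜 := ℝ)).const_mul (K : ℝ)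
  have hae : ∀ P : Space d → Prop, (∀ y ∈ Metric.ball x s, P y) →
      ∀ᵐ y ∂(volume.restrict (Metric.ball x s)), P y := fun P hP =>
    ae_restrict_of_forall_mem measurableSet_ball hP
  have hcm : ∀ n, Continuous (mollify u n) := fun n => (contDiff_mollify hu.continuous n).continuous
  have hrpow : ∀ (E : Type) [NormedAddCommGroup E] (f : ℕ → E) (a : E),
      Tendsto f atTop (𝓝 a) → Tendsto (fun n => ‖f n‖ₑ ^ p) atTop (𝓝 (‖a‖ₑ ^ p)) :=
    fun E _ f a hf => ((ENNReal.continuous_rpow_const (y := p)).tendsto _).comp hf.enorm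
  have hbdrpow : ∀ (E : Type) [NormedAddCommGroup E] (a : E) (B : ℝ), ‖a‖ ≤ B →
      ‖a‖ₑ ^ p ≤ ENNReal.ofReal B ^ p := fun E _ a B ha => by
    refine ENNReal.rpow_le_rpow ?_ hp0.le
    rw [← ofReal_norm]
    exact ENNReal.ofReal_le_ofReal ha
  have hconst : ∀ B : ℝ, ∫⁻ _ in Metric.ball x s, ENNReal.ofReal B ^ p ≠ ⊤ := fun B => by
    rw [lintegral_const]
    exact ENNReal.mul_ne_top (ENNReal.rpow_ne_top_of_nonneg hp0.le ENNReal.ofReal_ne_top)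
      (measure_ne_top _ _)
  have t1 : Tendsto (fun n => ∫⁻ y in Metric.ball x s, ‖mollify u n y‖ₑ ^ p) atTop
      (𝓝 (∫⁻ y in Metric.ball x s, ‖u y‖ₑ ^ p)) :=
    tendsto_lintegral_of_dominated_convergence (fun _ => ENNReal.ofReal (‖u x‖ + K * s + K) ^ p)
      (fun n => (hcm n).enorm.measurable.pow_const p)
      (fun n => hae _ fun y hy => hbdrpow ℝ _ _ (hmol n y hy)) (hconst _)
      (Eventually.of_forall fun y => hrpow ℝ _ _ (hlim y))
  have t2 : Tendsto (fun n => ∫⁻ y in Metric.ball x s, ‖gradient (mollify u n) y‖ₑ ^ p) atTop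
      (𝓝 (∫⁻ y in Metric.ball x s, ‖gradient u y‖ₑ ^ p)) :=
    tendsto_lintegral_of_dominated_convergence (fun _ => ENNReal.ofReal K ^ p)
      (fun n => (measurable_gradient _).enorm.pow_const p)
      (fun n => Eventually.of_forall fun y => hbdrpow (Space d) _ _ (by
        rw [norm_gradient]; exact norm_fderiv_mollify_le hu n y)) (hconst _)
      ((ae_restrict_of_ae (ae_tendsto_gradient_mollify hu)).mono
        fun y hy => hrpow (Space d) _ _ hy)
  have t3 : Tendsto (fun n => ∫ y in Metric.ball x s, mollify u n y) atTop
      (𝓝 (∫ y in Metric.ball x s, u y)) :=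
    tendsto_integral_of_dominated_convergence (fun _ => ‖u x‖ + K * s + K)
      (fun n => (hcm n).aestronglyMeasurable) (integrable_const _)
      (fun n => hae _ fun y hy => hmol n y hy) (Eventually.of_forall hlim)
  refine le_of_tendsto_of_tendsto' t1
    (ENNReal.Tendsto.const_mul (t2.add (hrpow ℝ _ _ t3)) (Or.inr hC)) fun n => ?_
  exact h _ ((contDiff_mollify hu.continuous n).of_le (by norm_cast))

end

section

variable {d : ℕ}

/-! ### Folding a neighbourhood of a boundary point into the exterior -/

/-- A Lipschitz map that folds a ball about `x` into the complement of `D`. -/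
structure FoldChart (D : Set (Space d)) (x : Space d) where
  fold : Space d → Space d
  lip : NNReal
  radius : ℝ
  bound : ℝ≥0∞
  radius_pos : 0 < radius
  lipschitz : LipschitzWith lip fold
  fold_eq : ∀ y ∈ Metric.ball x radius, y ∉ D → fold y = y
  bound_ne_top : bound ≠ ⊤
  lintegral_le : ∀ g : Space d → ℝ≥0∞, Measurable g →
    ∫⁻ y in Metric.ball x radius, g (fold y) ≤ bound * ∫⁻ y in Dᶜ, g y

/-- The signed height of a Lipschitz graph over a point, in the direction `e`. -/
def graphHeight (e : Space d) (h : Space d → ℝ) (y : Space d) : ℝ :=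
  h (y - inner ℝ e y • e) - inner ℝ e y

/-- The reflection across a Lipschitz graph, in the direction `e`. -/
def graphReflection (e : Space d) (h : Space d → ℝ) (y : Space d) : Space d :=
  y + (2 * graphHeight e h y) • e

/-- The map that folds the region above a Lipschitz graph to the region below it. -/
def graphFold (e : Space d) (h : Space d → ℝ) (y : Space d) : Space d :=
  y + (2 * min (graphHeight e h y) 0) • e

/-- The projection orthogonal to e does not see t • e; only the coordinate along e changes. Hence a
displacement by twice the height reverses the sign of the height and is an involution. -/
theorem graphHeight_add_smul {e : Space d} (he : ‖e‖ = 1) (h : Space d → ℝ) (y : Space d) (t : ℝ) :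
    graphHeight e h (y + t • e) = graphHeight e h y - t := by
  have hee : inner ℝ e e = (1 : ℝ) := by rw [real_inner_self_eq_norm_sq, he]; norm_num
  have h1 : inner ℝ e (y + t • e) = inner ℝ e y + t := by
    rw [inner_add_right, inner_smul_right, hee, mul_one]
  unfold graphHeight
  rw [h1, show y + t • e - (inner ℝ e y + t) • e = y - inner ℝ e y • e by rw [add_smul]; abel]
  ring

theorem graphHeight_graphReflection {e : Space d} (he : ‖e‖ = 1) (h : Space d → ℝ) (y : Space d) :
    graphHeight e h (graphReflection e h y) = -graphHeight e h y := by
  unfold graphReflection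
  rw [graphHeight_add_smul he]
  ring

theorem graphReflection_involutive {e : Space d} (he : ‖e‖ = 1) (h : Space d → ℝ) :
    Function.Involutive (graphReflection e h) := by
  intro y
  rw [graphReflection, graphHeight_graphReflection he, graphReflection, add_assoc, ← add_smul]
  simp

theorem lipschitzWith_graphHeight {e : Space d} (he : ‖e‖ = 1) {h : Space d → ℝ} {K : NNReal}
    (hh : LipschitzWith K h) : LipschitzWith (K * 2 + 1) (graphHeight e h) := by
  have hinner : LipschitzWith 1 fun y : Space d => inner ℝ e y := by
    refine LipschitzWith.of_dist_le_mul fun a b => ?_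
    rw [dist_eq_norm, dist_eq_norm, ← inner_sub_right, NNReal.coe_one, one_mul]
    simpa [he] using norm_inner_le_norm (𝕜 := ℝ) e (a - b)
  have hproj : LipschitzWith 2 fun y : Space d => y - inner ℝ e y • e := by
    refine LipschitzWith.of_dist_le_mul fun a b => ?_
    have h1 := hinner.dist_le_mul a b
    rw [dist_eq_norm, NNReal.coe_one, one_mul] at h1
    rw [dist_eq_norm, show a - inner ℝ e a • e - (b - inner ℝ e b • e) =
      (a - b) - (inner ℝ e a - inner ℝ e b : ℝ) • e by rw [sub_smul]; abel]
    refine (norm_sub_le _ _).trans ?_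
    rw [norm_smul, he, mul_one, ← dist_eq_norm, NNReal.coe_ofNat]
    linarith
  exact (hh.comp hproj).sub hinner

theorem lipschitzWith_add_smul {e : Space d} (he : ‖e‖ = 1) {f : Space d → ℝ} {K : NNReal}
    (hf : LipschitzWith K f) : LipschitzWith (1 + 2 * K) fun y => y + (2 * f y) • e := by
  refine LipschitzWith.of_dist_le_mul fun a b => ?_
  have h1 := hf.dist_le_mul a b
  rw [dist_eq_norm] at h1
  rw [dist_eq_norm, show a + (2 * f a) • e - (b + (2 * f b) • e) =
    (a - b) + (2 * (f a - f b)) • e by rw [mul_sub, sub_smul]; abel]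
  refine (norm_add_le _ _).trans ?_
  rw [norm_smul, he, mul_one, norm_mul, ← dist_eq_norm, Real.norm_ofNat]
  push_cast
  linarith

theorem lipschitzWith_graphReflection {e : Space d} (he : ‖e‖ = 1) {h : Space d → ℝ} {K : NNReal}
    (hh : LipschitzWith K h) :
    LipschitzWith (1 + 2 * (K * 2 + 1)) (graphReflection e h) :=
  lipschitzWith_add_smul he (lipschitzWith_graphHeight he hh)

theorem lipschitzWith_graphFold {e : Space d} (he : ‖e‖ = 1) {h : Space d → ℝ} {K : NNReal}
    (hh : LipschitzWith K h) : LipschitzWith (1 + 2 * (K * 2 + 1)) (graphFold e h) :=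
  lipschitzWith_add_smul he ((lipschitzWith_graphHeight he hh).min_const 0)

/-- A Lipschitz involution distorts volumes by a bounded factor. -/
theorem exists_lintegral_comp_le {R : Space d → Space d} {K : NNReal} (hR : LipschitzWith K R)
    (hinv : Function.Involutive R) : ∃ C : ℝ≥0∞, C ≠ ⊤ ∧ ∀ g : Space d → ℝ≥0∞, Measurable g →
      ∫⁻ y, g (R y) ≤ C * ∫⁻ y, g y := by
  -- Volume is a multiple of the top-dimensional Hausdorff measure, which a K-Lipschitz map
  -- increases at most by the factor K^dim. Preimages under an involution are images.
  set H : Measure (Space d) := Measure.hausdorffMeasure (Module.finrank ℝ (Space d)) with hH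
  have hHaar : H.IsAddHaarMeasure := isAddHaarMeasure_hausdorffMeasure
  set c := (volume : Measure (Space d)).addHaarScalarFactor H
  have hvol : (volume : Measure (Space d)) = c • H := Measure.isAddLeftInvariant_eq_smul _ _
  refine ⟨(K : ℝ≥0∞) ^ (Module.finrank ℝ (Space d) : ℝ),
    ENNReal.rpow_ne_top_of_nonneg (by positivity) ENNReal.coe_ne_top, fun g hg => ?_⟩
  have hmap : Measure.map R volume ≤
      (K : ℝ≥0∞) ^ (Module.finrank ℝ (Space d) : ℝ) • (volume : Measure (Space d)) := by
    refine Measure.le_iff.2 fun s hs => ?_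
    rw [Measure.map_apply hR.continuous.measurable hs, Measure.smul_apply, smul_eq_mul,
      ← hinv.image_eq_preimage_symm]
    have := hR.hausdorffMeasure_image_le (d := Module.finrank ℝ (Space d)) (by positivity) s
    rw [hvol, Measure.smul_apply, Measure.smul_apply, ENNReal.smul_def, ENNReal.smul_def,
      smul_eq_mul, smul_eq_mul, mul_left_comm]
    gcongr
  rw [← lintegral_map hg hR.continuous.measurable, ← smul_eq_mul, ← lintegral_smul_measure]
  exact lintegral_mono' hmap le_rfl

/-- Locally D is the set of negative height: a positive height would keep D away from x, and a
negative one would put x into the open set D. -/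
theorem graphHeight_eq_zero_of_mem_frontier {D : Set (Space d)} (hDo : IsOpen D) {x e : Space d}
    {r : ℝ} (hr : 0 < r) {h : Space d → ℝ} (hc : Continuous (graphHeight e h))
    (hx : x ∈ frontier D)
    (hD : ∀ y ∈ Metric.ball x r, y ∈ D ↔ h (y - inner ℝ e y • e) < inner ℝ e y) :
    graphHeight e h x = 0 := by
  have hD' : ∀ y ∈ Metric.ball x r, y ∈ D ↔ graphHeight e h y < 0 := fun y hy => by
    rw [hD y hy, graphHeight, sub_neg]
  refine le_antisymm ?_ ?_
  · by_contra hcon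
    have h1 : ∀ᶠ y in 𝓝 x, 0 < graphHeight e h y := 
      hc.continuousAt.eventually_const_lt (not_le.1 hcon)
    have h2 := (mem_closure_iff_frequently.1 hx.1).and_eventually
      (h1.and (Metric.ball_mem_nhds x hr))
    obtain ⟨y, hyD, hy1, hy2⟩ := h2.exists
    exact absurd ((hD' y hy2).1 hyD) (not_lt.2 hy1.le)
  · by_contra hcon
    have : x ∈ D := (hD' x (Metric.mem_ball_self hr)).2 (not_le.1 hcon)
    rw [hDo.frontier_eq] at hx
    exact hx.2 this

/-- At a boundary point the part in D is reflected across the graph, and the volume distortion is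
that of a Lipschitz involution. Away from the closure of D the identity serves. -/
theorem HasLipschitzBoundary.nonempty_foldChart {D : Set (Space d)} (hD : HasLipschitzBoundary D)
    {x : Space d} (hx : x ∉ D) : Nonempty (FoldChart D x) := by
  by_cases hxc : x ∈ closure D
  · have hxf : x ∈ frontier D := by rw [hD.1.frontier_eq]; exact ⟨hxc, hx⟩
    obtain ⟨e, r, K, h, he, hr, hh, hDy⟩ := hD.2 x hxf
    have hHl := lipschitzWith_graphHeight he hh
    have hRl := lipschitzWith_graphReflection he hh
    have hinv := graphReflection_involutive he h
    have hx0 := graphHeight_eq_zero_of_mem_frontier hD.1 hr hHl.continuous hxf hDy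
    have hD' : ∀ y ∈ Metric.ball x r, y ∈ D ↔ graphHeight e h y < 0 := fun y hy => by
      rw [hDy y hy, graphHeight, sub_neg]
    obtain ⟨C, hC, hCg⟩ := exists_lintegral_comp_le hRl hinv
    set L : NNReal := 1 + 2 * (K * 2 + 1) with hL
    have hL1 : (1 : ℝ) ≤ L := by
      rw [hL]; push_cast; linarith [K.coe_nonneg]
    have hrL : r / L ≤ r := div_le_self hr.le hL1
    have hRx : graphReflection e h x = x := by simp [graphReflection, hx0]
    -- Since the reflection fixes x, the radius r / L keeps reflected points in the ball where the
    -- graph describes D. In 1 + C, the 1 accounts for points left in place and C for reflected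
    -- ones.
    refine ⟨⟨graphFold e h, L, r / L, 1 + C, by positivity, lipschitzWith_graphFold he hh, ?_,
      by simp [hC], ?_⟩⟩
    · intro y hy hyD
      have hy' := Metric.ball_subset_ball hrL hy
      have : 0 ≤ graphHeight e h y := not_lt.1 fun hlt => hyD ((hD' y hy').2 hlt)
      simp [graphFold, min_eq_right this]
    · intro g hg
      have hDm : MeasurableSet Dᶜ := hD.1.measurableSet.compl
      have hgm : Measurable (Dᶜ.indicator g) := hg.indicator hDm
      have hpt : ∀ y ∈ Metric.ball x (r / L), g (graphFold e h y) ≤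
          Dᶜ.indicator g y + Dᶜ.indicator g (graphReflection e h y) := by
        intro y hy
        have hy' := Metric.ball_subset_ball hrL hy
        rcases le_or_gt 0 (graphHeight e h y) with h0 | h0
        · have hyD : y ∈ Dᶜ := fun hyD => absurd ((hD' y hy').1 hyD) (not_lt.2 h0)
          have : graphFold e h y = y := by simp [graphFold, min_eq_right h0]
          rw [this, Set.indicator_of_mem hyD]
          exact le_self_add
        · have hRy : graphReflection e h y ∈ Metric.ball x r := by
            rw [Metric.mem_ball, ← hRx]
            refine (hRl.dist_le_mul y x).trans_lt ?_
            have := Metric.mem_ball.1 hy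
            rwa [lt_div_iff₀ (by positivity), mul_comm] at this
          have hRD : graphReflection e h y ∈ Dᶜ := fun hcon => by
            have := (hD' _ hRy).1 hcon
            rw [graphHeight_graphReflection he] at this
            linarith
          have : graphFold e h y = graphReflection e h y := by
            simp [graphFold, graphReflection, min_eq_left h0.le]
          rw [this, Set.indicator_of_mem hRD]
          exact le_add_self
      calc ∫⁻ y in Metric.ball x (r / L), g (graphFold e h y)
          ≤ ∫⁻ y in Metric.ball x (r / L),
              (Dᶜ.indicator g y + Dᶜ.indicator g (graphReflection e h y)) :=
            setLIntegral_mono' measurableSet_ball hpt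
        _ ≤ ∫⁻ y, (Dᶜ.indicator g y + Dᶜ.indicator g (graphReflection e h y)) :=
            setLIntegral_le_lintegral _ _
        _ = (∫⁻ y, Dᶜ.indicator g y) + ∫⁻ y, Dᶜ.indicator g (graphReflection e h y) :=
            lintegral_add_left hgm _
        _ ≤ (∫⁻ y, Dᶜ.indicator g y) + C * ∫⁻ y, Dᶜ.indicator g y := by
            gcongr; exact hCg _ hgm
        _ = (1 + C) * ∫⁻ y in Dᶜ, g y := by
            rw [lintegral_indicator hDm, add_mul, one_mul]
  · obtain ⟨r, hr, hrD⟩ := Metric.isOpen_iff.1 isClosed_closure.isOpen_compl x hxc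
    refine ⟨⟨id, 1, r, 1, hr, LipschitzWith.id, fun _ _ _ => rfl, by simp, fun g _ => ?_⟩⟩
    rw [one_mul]
    exact lintegral_mono_set fun y hy hyD => hrD hy (subset_closure hyD)

/-- The level sets of the height are translates of each other along e, and only countably many of
them can have positive measure; so none has. -/
theorem volume_graphHeight_eq_zero {e : Space d} (he : ‖e‖ = 1) {h : Space d → ℝ}
    (hm : Measurable (graphHeight e h)) : volume {y | graphHeight e h y = 0} = 0 := by
  have hcount := Measure.countable_meas_level_set_pos (μ := (volume : Measure (Space d))) hm
  obtain ⟨t, ht⟩ : ∃ t, t ∉ {t : ℝ | 0 < volume {y | graphHeight e h y = t}} := by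
    by_contra! hcon
    refine Cardinal.not_countable_real ?_
    exact hcount.mono fun t _ => hcon t
  have h0 : volume {y | graphHeight e h y = t} = 0 := by simpa using ht
  have : {y | graphHeight e h y = 0} = (fun y => y + (-t) • e) ⁻¹' {y | graphHeight e h y = t} := by
    ext y
    simp only [Set.mem_preimage, Set.mem_ofPred_eq, graphHeight_add_smul he]
    constructor <;> intro h <;> linarith
  rw [this, measure_preimage_add_right, h0]

theorem HasLipschitzBoundary.volume_frontier {D : Set (Space d)} (hD : HasLipschitzBoundary D) :
    volume (frontier D) = 0 := by
  refine measure_null_of_locally_null _ fun x hx => ?_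
  obtain ⟨e, r, K, h, he, hr, hh, hDy⟩ := hD.2 x hx
  have hc := (lipschitzWith_graphHeight he hh).continuous
  refine ⟨frontier D ∩ Metric.ball x r,
    inter_mem self_mem_nhdsWithin (mem_nhdsWithin_of_mem_nhds (Metric.ball_mem_nhds x hr)), ?_⟩
  refine measure_mono_null (fun y hy => ?_) (volume_graphHeight_eq_zero he hc.measurable)
  obtain ⟨s, hs, hsub⟩ := Metric.isOpen_iff.1 Metric.isOpen_ball y hy.2
  exact graphHeight_eq_zero_of_mem_frontier hD.1 hs hc hy.1 fun z hz => hDy z (hsub hz)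

end

section

variable {d : ℕ}

/-! ### Extension across a Lipschitz boundary -/

/-- M need not be differentiable, so increments are compared instead of derivatives. Where the
composition is not differentiable its gradient is 0 by convention, and the bound holds at every
point. -/
theorem norm_gradient_comp_le {φ : Space d → ℝ} (hφ : Differentiable ℝ φ) {M : Space d → Space d}
    {K : NNReal} (hM : LipschitzWith K M) (y : Space d) :
    ‖gradient (φ ∘ M) y‖ ≤ K * ‖gradient φ (M y)‖ := by
  rw [norm_gradient, norm_gradient]
  by_cases hd : DifferentiableAt ℝ (φ ∘ M) y
  · refine le_of_forall_pos_le_add fun ε hε => ?_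
    set δ := ε / (K + 1) with hδ
    have hK := K.coe_nonneg
    have hδ0 : 0 < δ := by positivity
    have h1 := (hφ (M y)).hasFDerivAt.isLittleO.def hδ0
    have h2 := hM.continuous.continuousAt.eventually h1
    have hle : K * (‖fderiv ℝ φ (M y)‖ + δ) ≤ K * ‖fderiv ℝ φ (M y)‖ + ε := by
      have : K * δ ≤ ε := by
        rw [hδ, mul_div_assoc', div_le_iff₀ (by positivity)]
        nlinarith
      linarith
    refine le_trans (hd.hasFDerivAt.le_of_lip' (by positivity) ?_) hle
    filter_upwards [h2] with z hz
    have h3 : ‖φ (M z) - φ (M y)‖ ≤ (‖fderiv ℝ φ (M y)‖ + δ) * ‖M z - M y‖ := by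
      have h4 : ‖φ (M z) - φ (M y)‖ ≤ ‖φ (M z) - φ (M y) - fderiv ℝ φ (M y) (M z - M y)‖ +
          ‖fderiv ℝ φ (M y) (M z - M y)‖ := by
        simpa using norm_add_le (φ (M z) - φ (M y) - fderiv ℝ φ (M y) (M z - M y))
          (fderiv ℝ φ (M y) (M z - M y))
      have h5 := (fderiv ℝ φ (M y)).le_opNorm (M z - M y)
      linarith
    have h6 := hM.dist_le_mul z y
    rw [dist_eq_norm, dist_eq_norm] at h6
    calc ‖φ (M z) - φ (M y)‖ ≤ (‖fderiv ℝ φ (M y)‖ + δ) * ‖M z - M y‖ := h3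
      _ ≤ (‖fderiv ℝ φ (M y)‖ + δ) * (K * ‖z - y‖) := by gcongr
      _ = _ := by ring
  · rw [fderiv_zero_of_not_differentiableAt hd, norm_zero]
    positivity

theorem rpow_one_div_add_le {p : ℝ} (hp : 1 < p) (a b : ℝ≥0∞) :
    (a + b ^ p) ^ (1 / p) ≤ a ^ (1 / p) + b := by
  have hp0 : 0 < p := by linarith
  refine (ENNReal.rpow_add_le_add_rpow _ _ (by positivity)
    (by rw [div_le_one hp0]; exact hp.le)).trans (le_of_eq ?_)
  rw [← ENNReal.rpow_mul, mul_one_div_cancel hp0.ne', ENNReal.rpow_one]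

theorem FoldChart.exists_eLpNorm_gradient_le {p : ℝ} (hp : 1 < p) {D : Set (Space d)}
    {x : Space d} (c : FoldChart D x) : ∃ C : ℝ≥0∞, C ≠ ⊤ ∧ ∀ φ : Space d → ℝ, ContDiff ℝ 1 φ →
      eLpNorm (gradient (φ ∘ c.fold)) (ENNReal.ofReal p)
        (volume.restrict (Metric.ball x c.radius)) ≤
      C * eLpNorm (gradient φ) (ENNReal.ofReal p) (volume.restrict Dᶜ) := by
  have hp0 : 0 < p := by linarith
  have hlf : (c.lip : ℝ≥0∞) ^ p ≠ ⊤ := ENNReal.rpow_ne_top_of_nonneg hp0.le ENNReal.coe_ne_top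
  refine ⟨((c.lip : ℝ≥0∞) ^ p * c.bound) ^ (1 / p), ENNReal.rpow_ne_top_of_nonneg (by positivity)
    (ENNReal.mul_ne_top hlf c.bound_ne_top), fun φ hφ => ?_⟩
  rw [eLpNorm_ofReal_eq hp0, eLpNorm_ofReal_eq hp0, ← ENNReal.mul_rpow_of_nonneg _ _ (by positivity)]
  refine ENNReal.rpow_le_rpow ?_ (by positivity)
  have hg := continuous_gradient_of_contDiff hφ
  calc ∫⁻ y in Metric.ball x c.radius, ‖gradient (φ ∘ c.fold) y‖ₑ ^ p
      ≤ ∫⁻ y in Metric.ball x c.radius, (c.lip : ℝ≥0∞) ^ p * ‖gradient φ (c.fold y)‖ₑ ^ p := by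
        refine lintegral_mono fun y => ?_
        rw [← ENNReal.mul_rpow_of_nonneg _ _ hp0.le]
        refine ENNReal.rpow_le_rpow ?_ hp0.le
        have := norm_gradient_comp_le (hφ.differentiable (by simp)) c.lipschitz y
        rw [← ofReal_norm, ← ofReal_norm, ← ENNReal.ofReal_coe_nnreal,
          ← ENNReal.ofReal_mul c.lip.coe_nonneg]
        exact ENNReal.ofReal_le_ofReal this
    _ = (c.lip : ℝ≥0∞) ^ p * ∫⁻ y in Metric.ball x c.radius, ‖gradient φ (c.fold y)‖ₑ ^ p :=
        lintegral_const_mul' _ _ hlf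
    _ ≤ (c.lip : ℝ≥0∞) ^ p * (c.bound * ∫⁻ y in Dᶜ, ‖gradient φ y‖ₑ ^ p) := by
        gcongr
        exact c.lintegral_le (fun y => ‖gradient φ y‖ₑ ^ p) (hg.enorm.measurable.pow_const p)
    _ = _ := by ring

/-- Poincaré's inequality with a mean value for the Lipschitz function φ ∘ fold, whose gradient is
controlled from outside D. The integral is kept because gradients do not see constants. -/
theorem FoldChart.exists_eLpNorm_le {p : ℝ} (hp : 1 < p) {D : Set (Space d)}
    {x : Space d} (c : FoldChart D x) : ∃ C : ℝ≥0∞, C ≠ ⊤ ∧ ∀ (φ : Space d → ℝ) (K : NNReal),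
      ContDiff ℝ 1 φ → LipschitzWith K φ →
      eLpNorm (φ ∘ c.fold) (ENNReal.ofReal p) (volume.restrict (Metric.ball x c.radius)) ≤
      C * (eLpNorm (gradient φ) (ENNReal.ofReal p) (volume.restrict Dᶜ) +
        ‖∫ y in Metric.ball x c.radius, φ (c.fold y)‖ₑ) := by
  have hp0 : 0 < p := by linarith
  obtain ⟨C₁, hC₁, h₁⟩ := c.exists_eLpNorm_gradient_le hp
  obtain ⟨C₂, hC₂, h₂⟩ := lintegral_rpow_le_of_mean_of_lipschitz (d := d) hp x c.radius_pos
  refine ⟨C₂ ^ (1 / p) * (C₁ + 1), ENNReal.mul_ne_top (ENNReal.rpow_ne_top_of_nonneg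
    (by positivity) hC₂) (by simp [hC₁]), fun φ K hφ hK => ?_⟩
  have h := h₂ (φ ∘ c.fold) _ (hK.comp c.lipschitz)
  rw [eLpNorm_ofReal_eq hp0]
  refine (ENNReal.rpow_le_rpow h (by positivity : 0 ≤ 1 / p)).trans ?_
  rw [ENNReal.mul_rpow_of_nonneg _ _ (by positivity), mul_assoc]
  gcongr
  refine (rpow_one_div_add_le hp _ _).trans ?_
  rw [← eLpNorm_ofReal_eq hp0, add_mul, mul_add, mul_add, one_mul, one_mul]
  exact add_le_add ((h₁ φ hφ).trans le_self_add) le_add_self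

theorem gradient_mul {χ u : Space d → ℝ} {x : Space d} (hχ : DifferentiableAt ℝ χ x)
    (hu : DifferentiableAt ℝ u x) :
    gradient (fun y => χ y * u y) x = χ x • gradient u x + u x • gradient χ x := by
  simp [gradient, fderiv_fun_mul hχ hu]

/-- The product rule holds almost everywhere by Rademacher's theorem, and the product has zero
gradient off the support of χ. -/
theorem eLpNorm_gradient_mul_le {q : ℝ≥0∞} (hq : 1 ≤ q) {χ u : Space d → ℝ} (hχ : ContDiff ℝ 1 χ)
    {B : Set (Space d)} (hB : MeasurableSet B) (hχB : tsupport χ ⊆ B) (h1 : ∀ y, ‖χ y‖ ≤ 1) {A : ℝ}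
    (hA : ∀ y, ‖gradient χ y‖ ≤ A) {K : NNReal} (hu : LipschitzWith K u) :
    eLpNorm (gradient fun y => χ y * u y) q volume ≤
      ENNReal.ofReal A * eLpNorm u q (volume.restrict B) +
        eLpNorm (gradient u) q (volume.restrict B) := by
  have hA0 : 0 ≤ A := (norm_nonneg _).trans (hA 0)
  have hgm : Measurable (gradient u) := measurable_gradient u
  have hzero : ∀ y ∉ B, gradient (fun y => χ y * u y) y = 0 := by
    intro y hy
    have : fderiv ℝ (fun y => χ y * u y) y = 0 := by
      by_contra hne
      have h2 : y ∈ tsupport (fun y => χ y * u y) := support_fderiv_subset ℝ hne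
      exact hy (hχB (tsupport_mul_subset_left h2))
    simp [gradient, this]
  have hae : ∀ᵐ y, ‖gradient (fun y => χ y * u y) y‖ ≤
      ‖B.indicator (fun y => A * ‖u y‖ + ‖gradient u y‖) y‖ := by
    filter_upwards [hu.ae_differentiableAt] with y hy
    by_cases hyB : y ∈ B
    · rw [Set.indicator_of_mem hyB, gradient_mul (hχ.differentiable (by simp) y) hy]
      rw [Real.norm_of_nonneg (by positivity)]
      refine (norm_add_le _ _).trans ?_
      rw [norm_smul, norm_smul, add_comm, mul_comm ‖u y‖]
      gcongr
      · exact hA y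
      · exact mul_le_of_le_one_left (norm_nonneg _) (h1 y)
    · rw [hzero y hyB, Set.indicator_of_notMem hyB]
      simp
  refine (eLpNorm_mono_ae hae).trans ?_
  rw [eLpNorm_indicator_eq_eLpNorm_restrict hB]
  refine (eLpNorm_add_le (f := fun y => A * ‖u y‖) (g := fun y => ‖gradient u y‖)
    (continuous_const.mul hu.continuous.norm).aestronglyMeasurable
    hgm.norm.aestronglyMeasurable hq).trans ?_
  rw [eLpNorm_norm]
  gcongr
  have := eLpNorm_const_smul (p := q) A (fun y => ‖u y‖) (volume.restrict B)
  rw [eLpNorm_norm, Real.enorm_of_nonneg hA0] at this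
  exact this.le

theorem LipschitzWith.exists_mul_bounded {χ u : Space d → ℝ} {K L : NNReal}
    (hχ : LipschitzWith K χ) (hu : LipschitzWith L u) {A B : ℝ} (hA : ∀ y, ‖χ y‖ ≤ A)
    (hB : ∀ y, ‖u y‖ ≤ B) : ∃ N : NNReal, LipschitzWith N fun y => χ y * u y := by
  have hA0 : 0 ≤ A := (norm_nonneg _).trans (hA 0)
  have hB0 : 0 ≤ B := (norm_nonneg _).trans (hB 0)
  refine ⟨A.toNNReal * L + B.toNNReal * K, LipschitzWith.of_dist_le_mul fun a b => ?_⟩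
  have h1 := hχ.dist_le_mul a b
  have h2 := hu.dist_le_mul a b
  rw [dist_eq_norm] at h1 h2 ⊢
  rw [show χ a * u a - χ b * u b = χ a * (u a - u b) + u b * (χ a - χ b) by ring]
  refine (norm_add_le _ _).trans ?_
  rw [norm_mul, norm_mul, NNReal.coe_add, NNReal.coe_mul, NNReal.coe_mul, Real.coe_toNNReal A hA0,
    Real.coe_toNNReal B hB0, add_mul]
  refine add_le_add ?_ ?_
  · rw [mul_assoc]; exact mul_le_mul (hA a) h2 (norm_nonneg _) hA0
  · rw [mul_assoc]; exact mul_le_mul (hB b) h1 (norm_nonneg _) hB0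

theorem lipschitzWith_finset_sum {ι : Type*} (s : Finset ι) {f : ι → Space d → ℝ}
    (hf : ∀ i, ∃ K : NNReal, LipschitzWith K (f i)) :
    ∃ K : NNReal, LipschitzWith K fun y => ∑ i ∈ s, f i y := by
  classical
  induction s using Finset.induction_on with
  | empty => exact ⟨0, by simp⟩
  | insert i s hi ih =>
    obtain ⟨K, hK⟩ := ih
    obtain ⟨L, hL⟩ := hf i
    refine ⟨L + K, ?_⟩
    simp only [Finset.sum_insert hi]
    exact hL.add hK

theorem eLpNorm_gradient_sum_le {ι : Type*} [Fintype ι] {q : ℝ≥0∞} (hq : 1 ≤ q)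
    {f : ι → Space d → ℝ} (hf : ∀ i, ∃ K : NNReal, LipschitzWith K (f i)) :
    eLpNorm (gradient fun y => ∑ i, f i y) q volume ≤ ∑ i, eLpNorm (gradient (f i)) q volume := by
  choose K hK using hf
  have hae : gradient (fun y => ∑ i, f i y) =ᵐ[volume] ∑ i, gradient (f i) := by
    have : ∀ᵐ y, ∀ i, DifferentiableAt ℝ (f i) y := ae_all_iff.2 fun i => (hK i).ae_differentiableAt
    filter_upwards [this] with y hy
    rw [Finset.sum_apply]
    simp only [gradient]
    rw [fderiv_fun_sum fun i _ => hy i, map_sum]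
  rw [eLpNorm_congr_ae hae]
  exact eLpNorm_sum_le (fun i _ => (measurable_gradient _).aestronglyMeasurable) hq

/-- The compact set closure Ω \ D is covered by finitely many charts. The sum need not be 1
elsewhere: inside D the extension is free, and outside Ω the test function vanishes. -/
theorem exists_partition {D Ω : Set (Space d)} (hDo : IsOpen D) (hΩb : Bornology.IsBounded Ω)
    (ch : ∀ x, x ∉ D → FoldChart D x) : ∃ (ι : Type) (_ : Fintype ι)
      (x : ι → Space d) (c : ∀ i, FoldChart D (x i)) (χ : ι → Space d → ℝ),
      (∀ i, ContDiff ℝ ∞ (χ i)) ∧ (∀ i, tsupport (χ i) ⊆ Metric.ball (x i) (c i).radius) ∧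
      (∀ i y, ‖χ i y‖ ≤ 1) ∧ ∀ y ∈ closure Ω, y ∉ D → ∑ i, χ i y = 1 := by
  set S : Set (Space d) := closure Ω \ D with hS
  have hSc : IsClosed S := isClosed_closure.sdiff hDo
  have hScpt : IsCompact S := hΩb.isCompact_closure.diff hDo
  obtain ⟨t, ht⟩ := hScpt.elim_nhds_subcover' (fun y hy => Metric.ball y (ch y hy.2).radius)
    fun y hy => Metric.ball_mem_nhds y (ch y hy.2).radius_pos
  have hcov : S ⊆ ⋃ i : t, Metric.ball (i.1 : Space d) (ch i.1 i.1.2.2).radius := by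
    intro y hy
    have := ht hy
    simp only [Set.mem_iUnion] at this ⊢
    obtain ⟨z, hz, hyz⟩ := this
    exact ⟨⟨z, hz⟩, hyz⟩
  obtain ⟨f, hf⟩ := SmoothPartitionOfUnity.exists_isSubordinate (modelWithCornersSelf ℝ (Space d))
    hSc (fun i : t => Metric.ball (i.1 : Space d) (ch i.1 i.1.2.2).radius)
    (fun _ => Metric.isOpen_ball) hcov
  refine ⟨t, inferInstance, fun i => i.1, fun i => ch i.1 i.1.2.2, fun i => f i,
    fun i => (f i).contMDiff.contDiff, hf, fun i y => ?_, fun y hy hyD => ?_⟩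
  · rw [Real.norm_of_nonneg (f.nonneg i y)]
    exact f.le_one i y
  · rw [← finsum_eq_sum_of_fintype]
    exact f.sum_eq_one ⟨hy, hyD⟩

/-- Extension of functions from the complement of a Lipschitz set `D` across `D`, with an estimate
up to finitely many linear functionals. -/
theorem exists_extension {p : ℝ} (hp : 1 < p) {Ω D : Set (Space d)} (hΩb : Bornology.IsBounded Ω)
    (hD : HasLipschitzBoundary D) (hDΩ : closure D ⊆ Ω) :
    ∃ (ι : Type) (_ : Fintype ι) (c : ι → testSpace Ω →ₗ[ℝ] ℝ) (C : ℝ≥0∞), C ≠ ⊤ ∧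
      ∀ φ : testSpace Ω, ∃ (u : Space d → ℝ) (K : NNReal), LipschitzWith K u ∧
        IsCompact (tsupport u) ∧ tsupport u ⊆ Ω ∧ (∀ y ∉ D, u y = (φ : Space d → ℝ) y) ∧
        eLpNorm (gradient u) (ENNReal.ofReal p) volume ≤
          C * (eLpNorm (gradient (φ : Space d → ℝ)) (ENNReal.ofReal p) (volume.restrict Dᶜ) +
            ∑ i, ‖c i φ‖ₑ) := by
  obtain ⟨ι, _, x, ch, χ, hχs, hχt, hχ1, hχsum⟩ := exists_partition hD.1 hΩb
    fun x hx => (hD.nonempty_foldChart hx).some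
  have hq : 1 ≤ ENNReal.ofReal p := by
    rw [← ENNReal.ofReal_one]; exact ENNReal.ofReal_le_ofReal hp.le
  have hχ' : ∀ i, ContDiff ℝ 1 (χ i) := fun i => (hχs i).of_le (by norm_cast)
  have hχc : ∀ i, HasCompactSupport (χ i) := fun i =>
    (isCompact_closedBall (x i) (ch i).radius).of_isClosed_subset (isClosed_tsupport _)
      ((hχt i).trans Metric.ball_subset_closedBall)
  have hχL : ∀ i, ∃ K : NNReal, LipschitzWith K (χ i) := fun i =>
    (hχ' i).lipschitzWith_of_hasCompactSupport (hχc i) (by simp)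
  choose Kχ hKχ using hχL
  have hint : ∀ i (φ : testSpace Ω), IntegrableOn (fun y => (φ : Space d → ℝ) ((ch i).fold y))
      (Metric.ball (x i) (ch i).radius) := fun i φ =>
    ((φ.2.1.continuous.comp (ch i).lipschitz.continuous).locallyIntegrable.integrableOn_isCompact
      (isCompact_closedBall _ _)).mono_set Metric.ball_subset_closedBall
  choose C₁ hC₁ h₁ using fun i => (ch i).exists_eLpNorm_gradient_le hp
  choose C₂ hC₂ h₂ using fun i => (ch i).exists_eLpNorm_le hp
  -- The functionals are the integrals of φ ∘ fold over the chart balls; the extension will be the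
  -- sum of the χ i · (φ ∘ fold i).
  refine ⟨ι, inferInstance, fun i =>
    { toFun := fun φ => ∫ y in Metric.ball (x i) (ch i).radius, (φ : Space d → ℝ) ((ch i).fold y)
      map_add' := fun φ ψ => integral_add (hint i φ) (hint i ψ)
      map_smul' := fun a φ => integral_const_mul a _ },
    ∑ i, (ENNReal.ofReal (Kχ i) * C₂ i + C₁ i),
    (ENNReal.sum_lt_top.2 fun i _ => ENNReal.add_lt_top.2
      ⟨ENNReal.mul_lt_top ENNReal.ofReal_lt_top (hC₂ i).lt_top, (hC₁ i).lt_top⟩).ne,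
    fun φ => ?_⟩
  have hφ : IsTest Ω (φ : Space d → ℝ) := φ.2
  obtain ⟨Kφ, hKφ⟩ := hφ.contDiff_one.lipschitzWith_of_hasCompactSupport hφ.2.1 (by simp)
  obtain ⟨Bφ, hBφ⟩ := hφ.1.continuous.bounded_above_of_compact_support hφ.2.1
  have hterm : ∀ i, ∃ K : NNReal, LipschitzWith K
      fun y => χ i y * ((φ : Space d → ℝ) ∘ (ch i).fold) y := fun i =>
    LipschitzWith.exists_mul_bounded (hKχ i) (hKφ.comp (ch i).lipschitz) (hχ1 i)
      fun y => hBφ _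
  obtain ⟨K, hK⟩ := lipschitzWith_finset_sum Finset.univ hterm
  have heq : ∀ y ∉ D, ∑ i, χ i y * ((φ : Space d → ℝ) ∘ (ch i).fold) y = (φ : Space d → ℝ) y := by
    intro y hyD
    have h1 : ∀ i, χ i y * ((φ : Space d → ℝ) ∘ (ch i).fold) y = χ i y * (φ : Space d → ℝ) y := by
      intro i
      by_cases hy : y ∈ Metric.ball (x i) (ch i).radius
      · rw [Function.comp, (ch i).fold_eq y hy hyD]
      · rw [image_eq_zero_of_notMem_tsupport fun h => hy (hχt i h), zero_mul, zero_mul]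
    rw [Finset.sum_congr rfl fun i _ => h1 i, ← Finset.sum_mul]
    by_cases hy : y ∈ closure Ω
    · rw [hχsum y hy hyD, one_mul]
    · rw [image_eq_zero_of_notMem_tsupport fun h => hy (subset_closure (hφ.2.2 h)), mul_zero]
  -- Outside D the sum agrees with φ, so new support can appear only in the closure of D, which lies
  -- in Ω.
  have hts : tsupport (fun y => ∑ i, χ i y * ((φ : Space d → ℝ) ∘ (ch i).fold) y) ⊆
      closure D ∪ tsupport (φ : Space d → ℝ) := by
    refine closure_minimal (fun y hy => ?_) (isClosed_closure.union (isClosed_tsupport _))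
    by_cases hyD : y ∈ D
    · exact Or.inl (subset_closure hyD)
    · refine Or.inr (subset_tsupport _ ?_)
      rw [Function.mem_support, ← heq y hyD]
      exact hy
  have hDc : IsCompact (closure D) := (hΩb.subset (subset_closure.trans hDΩ)).isCompact_closure
  refine ⟨_, K, hK, (hDc.union hφ.2.1).of_isClosed_subset (isClosed_tsupport _) hts,
    hts.trans (Set.union_subset hDΩ hφ.2.2), heq, ?_⟩
  refine (eLpNorm_gradient_sum_le hq hterm).trans ?_
  rw [Finset.sum_mul]
  refine Finset.sum_le_sum fun i _ => ?_
  refine (eLpNorm_gradient_mul_le hq (hχ' i) measurableSet_ball (hχt i) (hχ1 i)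
    (norm_gradient_le_of_lipschitz (hKχ i)) (hKφ.comp (ch i).lipschitz)).trans ?_
  set a := eLpNorm (gradient (φ : Space d → ℝ)) (ENNReal.ofReal p) (volume.restrict Dᶜ)
  rw [add_mul, mul_assoc]
  gcongr ENNReal.ofReal (Kχ i) * ?_ + ?_
  · refine (h₂ i φ Kφ hφ.contDiff_one hKφ).trans ?_
    gcongr C₂ i * (a + ?_)
    exact Finset.single_le_sum (f := fun i =>
      ‖∫ y in Metric.ball (x i) (ch i).radius, (φ : Space d → ℝ) ((ch i).fold y)‖ₑ)
      (fun _ _ => zero_le) (Finset.mem_univ i)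
  · refine (h₁ i φ hφ.contDiff_one).trans ?_
    gcongr
    exact le_self_add

end

section

variable {d : ℕ}

/-! ### Closedness of the restrictions of gradients to the exterior of a Lipschitz set -/

/-- Up to an arbitrarily small change in the seminorm, finitely many linear functionals are bounded
by the seminorm. -/
theorem exists_approx_of_functionals {V : Type*} [AddCommGroup V] [Module ℝ V] (a : Seminorm ℝ V)
    {ι : Type*} (c : ι → V →ₗ[ℝ] ℝ) (s : Finset ι) : ∀ W : Submodule ℝ V, ∃ C : ℝ, 0 ≤ C ∧
      ∀ φ ∈ W, ∀ ε > 0, ∃ ψ ∈ W, a (φ - ψ) ≤ ε ∧ ∀ i ∈ s, |c i ψ| ≤ C * (a φ + ε) := by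
  classical
  induction s using Finset.induction_on with
  | empty =>
    exact fun W => ⟨0, le_rfl, fun φ hφ ε hε => ⟨φ, hφ, by simpa using hε.le, by simp⟩⟩
  | insert i s hi ih =>
    intro W
    -- A functional bounded by the seminorm on W needs no correction; its constant is added to that
    -- of the others.
    by_cases hB : ∃ C₁, ∀ φ ∈ W, |c i φ| ≤ C₁ * a φ
    · obtain ⟨C₁, hC₁⟩ := hB
      obtain ⟨C, hC, h⟩ := ih W
      refine ⟨C + |C₁|, by positivity, fun φ hφ ε hε => ?_⟩
      obtain ⟨ψ, hψW, hψ, hc⟩ := h φ hφ ε hε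
      have hn : 0 ≤ a φ + ε := add_nonneg (apply_nonneg a φ) hε.le
      refine ⟨ψ, hψW, hψ, fun j hj => ?_⟩
      rw [add_mul]
      rcases Finset.mem_insert.1 hj with rfl | hj
      · have h1 : a ψ ≤ a φ + ε := by
          have := map_add_le_add a φ (ψ - φ)
          rw [add_sub_cancel, map_sub_rev] at this
          linarith
        have h2 : C₁ * a ψ ≤ |C₁| * (a φ + ε) :=
          (mul_le_mul_of_nonneg_right (le_abs_self C₁) (apply_nonneg a ψ)).trans
            (mul_le_mul_of_nonneg_left h1 (abs_nonneg _))
        have h3 : 0 ≤ C * (a φ + ε) := by positivity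
        linarith [hC₁ ψ hψW]
      · have h3 : 0 ≤ |C₁| * (a φ + ε) := by positivity
        linarith [hc j hj]
    · push Not at hB
      -- The kernel of an unbounded functional is dense for the seminorm: a multiple of ξ with
      -- seminorm at most ε/2 cancels c i φ. The induction goes on inside the kernel, and for this
      -- reason it ranges over all subspaces W.
      obtain ⟨C, hC, h⟩ := ih (W ⊓ LinearMap.ker (c i))
      refine ⟨C, hC, fun φ hφ ε hε => ?_⟩
      obtain ⟨ξ, hξW, hξ⟩ := hB (2 * |c i φ| / ε)
      have hξ0 : 0 < |c i ξ| := lt_of_le_of_lt (mul_nonneg (by positivity) (apply_nonneg a ξ)) hξ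
      have hξ1 : c i ξ ≠ 0 := abs_pos.1 hξ0
      have hsmall : a ((c i φ / c i ξ) • ξ) ≤ ε / 2 := by
        rw [map_smul_eq_mul, Real.norm_eq_abs, abs_div, div_mul_eq_mul_div, div_le_iff₀ hξ0]
        rw [div_mul_eq_mul_div, div_lt_iff₀ hε] at hξ
        linarith
      obtain ⟨ψ, hψW, hψ, hc⟩ := h (φ - (c i φ / c i ξ) • ξ)
        ⟨W.sub_mem hφ (W.smul_mem _ hξW), by simp [hξ1]⟩ (ε / 2) (by linarith)
      refine ⟨ψ, hψW.1, ?_, fun j hj => ?_⟩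
      · have := map_add_le_add a (φ - (c i φ / c i ξ) • ξ - ψ) ((c i φ / c i ξ) • ξ)
        rw [show φ - (c i φ / c i ξ) • ξ - ψ + (c i φ / c i ξ) • ξ = φ - ψ by abel] at this
        linarith
      · rcases Finset.mem_insert.1 hj with rfl | hj
        · have : c j ψ = 0 := hψW.2
          rw [this, abs_zero]
          exact mul_nonneg hC (add_nonneg (apply_nonneg a φ) hε.le)
        · refine (hc j hj).trans (mul_le_mul_of_nonneg_left ?_ hC)
          have := map_sub_le_add a φ ((c i φ / c i ξ) • ξ)
          linarith

/-- If images of elements of `V` have preimages in `V` of controlled norm, up to small errors, then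
the image of the closure of `V` is closed. -/
theorem isClosed_image_closure_of_approx {E F : Type*} [NormedAddCommGroup E] [NormedSpace ℝ E]
    [CompleteSpace E] [NormedAddCommGroup F] [NormedSpace ℝ F] (T : E →L[ℝ] F) (V : Submodule ℝ E)
    {C : ℝ} (h : ∀ v ∈ V, ∀ ε > 0, ∃ z ∈ V, ‖T v - T z‖ ≤ ε ∧ ‖z‖ ≤ C * (‖T v‖ + ε)) :
    IsClosed (T '' (V.topologicalClosure : Set E)) := by
  have key : closure (T '' (V : Set E)) ⊆ T '' (V.topologicalClosure : Set E) := by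
    intro y hy
    have hdense : ∀ ε > 0, ∃ v ∈ V, ‖y - T v‖ ≤ ε := by
      intro ε hε
      obtain ⟨_, ⟨v, hv, rfl⟩, hd⟩ := Metric.mem_closure_iff.1 hy ε hε
      exact ⟨v, hv, by rw [← dist_eq_norm]; exact hd.le⟩
    -- Successive approximation: each correction has norm controlled by the current error, and the
    -- error is halved. The tolerance (1/2)^n / 4 is spent twice, on approximating y by T v and on
    -- replacing v - s by z. The corrections sum to a limit in the complete space E.
    have hstep : ∀ (n : ℕ) (s : {s : E // s ∈ V ∧ ‖y - T s‖ ≤ (1 / 2) ^ n}),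
        ∃ s' : {s : E // s ∈ V ∧ ‖y - T s‖ ≤ (1 / 2) ^ (n + 1)},
          ‖(s' : E) - s‖ ≤ 2 * |C| * (1 / 2) ^ n := by
      rintro n ⟨s, hsV, hs⟩
      have he : (0 : ℝ) < (1 / 2) ^ n / 4 := by positivity
      obtain ⟨v, hvV, hv⟩ := hdense _ he
      obtain ⟨z, hzV, hz1, hz2⟩ := h (v - s) (V.sub_mem hvV hsV) _ he
      have hTv : ‖T (v - s)‖ ≤ (1 / 2) ^ n / 4 + (1 / 2) ^ n := by
        rw [map_sub, show T v - T s = (y - T s) - (y - T v) by abel]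
        exact (norm_sub_le _ _).trans (by linarith)
      refine ⟨⟨s + z, V.add_mem hsV hzV, ?_⟩, ?_⟩
      · rw [map_add, show y - (T s + T z) = (y - T v) + (T (v - s) - T z) by
          rw [map_sub]; abel]
        refine (norm_add_le _ _).trans ?_
        rw [pow_succ]
        linarith
      · simp only [add_sub_cancel_left]
        refine hz2.trans ?_
        have h1 : ‖T (v - s)‖ + (1 / 2) ^ n / 4 ≤ 2 * (1 / 2) ^ n := by
          linarith [he]
        calc C * (‖T (v - s)‖ + (1 / 2) ^ n / 4) ≤ |C| * (‖T (v - s)‖ + (1 / 2) ^ n / 4) :=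
              mul_le_mul_of_nonneg_right (le_abs_self C) (by positivity)
          _ ≤ |C| * (2 * (1 / 2) ^ n) := mul_le_mul_of_nonneg_left h1 (abs_nonneg _)
          _ = _ := by ring
    obtain ⟨v₀, hv₀V, hv₀⟩ := hdense 1 one_pos
    choose next hnext using hstep
    let s : (n : ℕ) → {s : E // s ∈ V ∧ ‖y - T s‖ ≤ (1 / 2) ^ n} := fun n =>
      Nat.rec ⟨v₀, hv₀V, by simpa using hv₀⟩ (fun n s => next n s) n
    have hs : ∀ n, ‖((s (n + 1)).1 : E) - (s n).1‖ ≤ 2 * |C| * (1 / 2) ^ n := fun n => hnext n (s n)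
    have hcau : CauchySeq fun n => (s n).1 := by
      refine cauchySeq_of_le_geometric (1 / 2) (2 * |C|) (by norm_num) fun n => ?_
      rw [dist_comm, dist_eq_norm]
      exact hs n
    obtain ⟨x, hx⟩ := cauchySeq_tendsto_of_complete hcau
    refine ⟨x, mem_closure_of_tendsto hx (Eventually.of_forall fun n => (s n).2.1), ?_⟩
    refine tendsto_nhds_unique ((T.continuous.tendsto x).comp hx) ?_
    rw [tendsto_iff_norm_sub_tendsto_zero]
    refine squeeze_zero (fun _ => norm_nonneg _) (fun n => ?_)
      (tendsto_pow_atTop_nhds_zero_of_lt_one (by norm_num : (0 : ℝ) ≤ 1 / 2) (by norm_num))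
    rw [norm_sub_rev]
    exact (s n).2.2
  refine isClosed_of_closure_subset (subset_trans ?_ key)
  refine closure_minimal ?_ isClosed_closure
  exact image_closure_subset_closure_image T.continuous

/-- The gradient of a test function, as a linear map to `L^p`. -/
def gradLp {Ω : Set (Space d)} (hΩb : Bornology.IsBounded Ω) (p : ℝ) :
    testSpace Ω →ₗ[ℝ] Lp (Space d) (ENNReal.ofReal p) (volume.restrict Ω) where
  toFun φ := (memLp_of_continuous hΩb (IsTest.continuous_gradient φ.2)).toLp
    (gradient (φ : Space d → ℝ))
  map_add' φ ψ := by
    rw [← MemLp.toLp_add, MemLp.toLp_eq_toLp_iff]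
    exact Eventually.of_forall fun x =>
      gradient_add (IsTest.differentiable φ.2 x) (IsTest.differentiable ψ.2 x)
  map_smul' c φ := by
    rw [RingHom.id_apply, ← MemLp.toLp_const_smul c
      (memLp_of_continuous hΩb (IsTest.continuous_gradient φ.2)), MemLp.toLp_eq_toLp_iff]
    exact Eventually.of_forall fun x => gradient_const_smul c (IsTest.differentiable φ.2 x)

theorem gradLp_ae_eq {Ω : Set (Space d)} (hΩb : Bornology.IsBounded Ω) (p : ℝ)
    (φ : testSpace Ω) : gradLp hΩb p φ =ᵐ[volume.restrict Ω] gradient (φ : Space d → ℝ) :=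
  MemLp.coeFn_toLp (memLp_of_continuous hΩb (IsTest.continuous_gradient φ.2))

/-- Restriction of `L^p` functions on `Ω` to the complement of `D`. -/
abbrev restrictCompl (Ω D : Set (Space d)) (p : ℝ) [Fact (1 ≤ ENNReal.ofReal p)] :
    Lp (Space d) (ENNReal.ofReal p) (volume.restrict Ω) →L[ℝ]
      Lp (Space d) (ENNReal.ofReal p) ((volume.restrict Ω).restrict Dᶜ) :=
  LpToLpRestrictCLM (Space d) (Space d) ℝ (volume.restrict Ω) (ENNReal.ofReal p) Dᶜ

theorem enorm_restrictCompl {Ω D : Set (Space d)} {p : ℝ} [Fact (1 ≤ ENNReal.ofReal p)]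
    (x : Lp (Space d) (ENNReal.ofReal p) (volume.restrict Ω)) {g : Space d → Space d}
    (hg : x =ᵐ[volume.restrict Ω] g) :
    ‖restrictCompl Ω D p x‖ₑ = eLpNorm g (ENNReal.ofReal p) ((volume.restrict Ω).restrict Dᶜ) := by
  rw [Lp.enorm_def]
  exact eLpNorm_congr_ae ((LpToLpRestrictCLM_coeFn ℝ Dᶜ x).trans (ae_restrict_of_ae hg))

theorem gradient_ae_eq_of_eq_compl {D : Set (Space d)} (hD : HasLipschitzBoundary D)
    {u v : Space d → ℝ} (h : ∀ y ∉ D, u y = v y) :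
    gradient u =ᵐ[volume.restrict Dᶜ] gradient v := by
  rw [EventuallyEq, ae_restrict_iff' hD.1.measurableSet.compl]
  have h0 : ∀ᵐ y, y ∉ frontier D := by
    rw [ae_iff]
    simpa using hD.volume_frontier
  filter_upwards [h0] with y hy hyD
  have hyc : y ∈ (closure D)ᶜ := fun hc => hy (by rw [hD.1.frontier_eq]; exact ⟨hc, hyD⟩)
  have hev : u =ᶠ[𝓝 y] v := by
    filter_upwards [isClosed_closure.isOpen_compl.mem_nhds hyc] with z hz
    exact h z fun hzD => hz (subset_closure hzD)
  simp only [gradient, hev.fderiv_eq]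

/-- The functionals of the extension estimate need not be bounded by the gradient outside D: D may
enclose a hole in which a constant goes unnoticed. So φ is first changed slightly to make them
bounded, then extended across D, and the Lipschitz extension is mollified into a test function. -/
theorem exists_controlled_approx {p : ℝ} (hp : 1 < p) [Fact (1 ≤ ENNReal.ofReal p)]
    {Ω D : Set (Space d)} (hΩ : IsOpen Ω) (hΩb : Bornology.IsBounded Ω)
    (hD : HasLipschitzBoundary D) (hDΩ : closure D ⊆ Ω) :
    ∃ C : ℝ, ∀ φ : testSpace Ω, ∀ ε > 0, ∃ ζ : testSpace Ω,
      ‖restrictCompl Ω D p (gradLp hΩb p φ) - restrictCompl Ω D p (gradLp hΩb p ζ)‖ ≤ ε ∧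
      ‖gradLp hΩb p ζ‖ ≤ C * (‖restrictCompl Ω D p (gradLp hΩb p φ)‖ + ε) := by
  have hp0 : 0 < p := by linarith
  obtain ⟨ι, _, c, C₁, hC₁, hext⟩ := exists_extension hp hΩb hD hDΩ
  set T := restrictCompl Ω D p with hT
  set G := gradLp hΩb p with hG
  set a : Seminorm ℝ (testSpace Ω) :=
    (normSeminorm ℝ (Lp (Space d) (ENNReal.ofReal p) ((volume.restrict Ω).restrict Dᶜ))).comp
      (T.toLinearMap.comp G) with ha
  have haval : ∀ φ, a φ = ‖T (G φ)‖ := fun φ => rfl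
  obtain ⟨C₂, hC₂, happ⟩ := exists_approx_of_functionals a c Finset.univ ⊤
  set C := C₁.toReal * (1 + Fintype.card ι * C₂) + 1 with hC
  refine ⟨C, fun φ ε hε => ?_⟩
  -- One half of ε pays for passing from φ to ψ, the other for mollifying the extension of ψ.
  obtain ⟨ψ, -, hψ, hcψ⟩ := happ φ trivial (ε / 2) (by linarith)
  obtain ⟨u, K, hK, huc, hut, hueq, hun⟩ := hext ψ
  obtain ⟨ζ, hζ, hζu⟩ := exists_isTest_approx hp hΩ hΩb hK huc hut
    (ENNReal.ofReal_pos.2 (show 0 < ε / 2 by linarith))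
  have hmeas : (volume.restrict Ω).restrict Dᶜ ≤ (volume.restrict Ω : Measure (Space d)) :=
    Measure.restrict_le_self
  have hmeas2 : (volume.restrict Ω).restrict Dᶜ ≤ (volume.restrict Dᶜ : Measure (Space d)) := by
    rw [Measure.restrict_restrict hD.1.measurableSet.compl]
    exact Measure.restrict_mono Set.inter_subset_left le_rfl
  have hgrad : gradient u =ᵐ[(volume.restrict Ω).restrict Dᶜ] gradient (ψ : Space d → ℝ) :=
    ae_mono hmeas2 (gradient_ae_eq_of_eq_compl hD hueq)
  have hψa : eLpNorm (gradient (ψ : Space d → ℝ)) (ENNReal.ofReal p) (volume.restrict Dᶜ) =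
      ENNReal.ofReal (a ψ) := by
    rw [haval, ofReal_norm, hT, enorm_restrictCompl _ (gradLp_ae_eq hΩb p ψ), eLpNorm_ofReal_eq hp0,
      eLpNorm_ofReal_eq hp0, Measure.restrict_restrict hD.1.measurableSet.compl, Set.inter_comm,
      ← Measure.restrict_restrict hΩ.measurableSet]
    congr 1
    refine (setLIntegral_eq_of_support_subset ?_).symm
    intro x hx
    by_contra hxΩ
    refine hx ?_
    have : gradient (ψ : Space d → ℝ) x = 0 :=
      IsTest.gradient_eq_zero ψ.2 fun h => hxΩ (ψ.2.2.2 h)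
    simp [this, hp0]
  refine ⟨⟨ζ, hζ⟩, ?_, ?_⟩
  · have h1 : ‖T (G ψ) - T (G ⟨ζ, hζ⟩)‖ ≤ ε / 2 := by
      rw [← map_sub, ← map_sub]
      rw [← ENNReal.ofReal_le_ofReal_iff (by linarith), ofReal_norm, hT,
        enorm_restrictCompl _ (gradLp_ae_eq hΩb p _)]
      refine le_trans (le_of_eq ?_) ((eLpNorm_mono_measure _ hmeas).trans hζu.le)
      rw [eLpNorm_sub_comm]
      refine eLpNorm_congr_ae ?_
      filter_upwards [hgrad] with x hx
      rw [Pi.sub_apply, hx]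
      exact gradient_sub (IsTest.differentiable ψ.2 x) (IsTest.differentiable hζ x)
    have h2 : ‖T (G φ) - T (G ψ)‖ ≤ ε / 2 := by
      rw [← map_sub, ← map_sub]; exact hψ
    have := norm_add_le (T (G φ) - T (G ψ)) (T (G ψ) - T (G ⟨ζ, hζ⟩))
    rw [sub_add_sub_cancel] at this
    linarith
  · have h1 : ‖G ⟨ζ, hζ⟩‖ₑ ≤ ENNReal.ofReal (ε / 2) +
        C₁ * (ENNReal.ofReal (a ψ) + ∑ i, ‖c i ψ‖ₑ) := by
      rw [Lp.enorm_def, eLpNorm_congr_ae (gradLp_ae_eq hΩb p ⟨ζ, hζ⟩)]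
      have hs : gradient ζ = (gradient ζ - gradient u) + gradient u := by simp
      simp only
      rw [hs]
      refine (eLpNorm_add_le ((measurable_gradient _).sub
        (measurable_gradient _)).aestronglyMeasurable
        (measurable_gradient _).aestronglyMeasurable Fact.out).trans ?_
      refine add_le_add hζu.le ?_
      rw [← hψa]
      exact (eLpNorm_mono_measure _ Measure.restrict_le_self).trans hun
    have h2 : ‖G ⟨ζ, hζ⟩‖ ≤ ε / 2 + C₁.toReal * (a ψ + ∑ i, |c i ψ|) := by
      have e : ENNReal.ofReal (ε / 2) + C₁ * (ENNReal.ofReal (a ψ) + ∑ i, ‖c i ψ‖ₑ) =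
          ENNReal.ofReal (ε / 2 + C₁.toReal * (a ψ + ∑ i, |c i ψ|)) := by
        have hs : 0 ≤ ∑ i, |c i ψ| := Finset.sum_nonneg fun i _ => abs_nonneg _
        have ha0 : 0 ≤ a ψ := apply_nonneg a ψ
        rw [ENNReal.ofReal_add (by linarith) (mul_nonneg ENNReal.toReal_nonneg (by linarith)),
          ENNReal.ofReal_mul ENNReal.toReal_nonneg, ENNReal.ofReal_toReal hC₁,
          ENNReal.ofReal_add ha0 hs, ENNReal.ofReal_sum_of_nonneg fun i _ => abs_nonneg _]
        simp only [← Real.norm_eq_abs, ofReal_norm]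
      rw [e, ← ofReal_norm] at h1
      refine (ENNReal.ofReal_le_ofReal_iff ?_).1 h1
      have hs : 0 ≤ ∑ i, |c i ψ| := Finset.sum_nonneg fun i _ => abs_nonneg _
      have ha0 : 0 ≤ a ψ := apply_nonneg a ψ
      have := mul_nonneg (ENNReal.toReal_nonneg (a := C₁)) (add_nonneg ha0 hs)
      linarith
    have h3 : a ψ ≤ a φ + ε / 2 := by
      have := map_add_le_add a φ (ψ - φ)
      rw [add_sub_cancel, map_sub_rev] at this
      linarith
    have h4 : ∑ i, |c i ψ| ≤ Fintype.card ι * (C₂ * (a φ + ε / 2)) := by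
      refine (Finset.sum_le_card_nsmul _ _ _ fun i hi => hcψ i hi).trans (le_of_eq ?_)
      simp
    have ha0 : 0 ≤ a φ := apply_nonneg a φ
    rw [← haval]
    calc ‖G ⟨ζ, hζ⟩‖ ≤ ε / 2 + C₁.toReal * (a ψ + ∑ i, |c i ψ|) := h2
      _ ≤ (a φ + ε) + C₁.toReal * ((a φ + ε) + Fintype.card ι * (C₂ * (a φ + ε))) := by
        have : C₂ * (a φ + ε / 2) ≤ C₂ * (a φ + ε) := by gcongr; linarith
        gcongr
        · linarith
        · linarith
        · refine h4.trans ?_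
          gcongr
      _ = C * (a φ + ε) := by rw [hC]; ring

/-- The restrictions to the exterior of a Lipschitz set of the gradients of functions with zero
boundary values form a closed set. -/
theorem isClosed_image_restrictCompl {p : ℝ} (hp : 1 < p) [Fact (1 ≤ ENNReal.ofReal p)]
    {Ω D : Set (Space d)} (hΩ : IsOpen Ω) (hΩb : Bornology.IsBounded Ω)
    (hD : HasLipschitzBoundary D) (hDΩ : closure D ⊆ Ω) :
    IsClosed (restrictCompl Ω D p '' ((testGrad Ω p).topologicalClosure : Set _)) := by
  obtain ⟨C, hC⟩ := exists_controlled_approx hp hΩ hΩb hD hDΩ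
  have hmem : ∀ φ : testSpace Ω, gradLp hΩb p φ ∈ testGrad Ω p := fun φ =>
    IsTest.toLp_mem_testGrad hΩb φ.2
  refine isClosed_image_closure_of_approx _ _ (C := C) fun v hv ε hε => ?_
  obtain ⟨φ, hφ, hvφ⟩ := hv
  obtain ⟨ζ, h1, h2⟩ := hC ⟨φ, hφ⟩ ε hε
  have e : v = gradLp hΩb p ⟨φ, hφ⟩ := Lp.ext (hvφ.trans (gradLp_ae_eq hΩb p ⟨φ, hφ⟩).symm)
  rw [e]
  exact ⟨_, hmem ζ, h1, h2⟩

end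

section

variable {d : ℕ}

/-! ### Energy minimizers and the Dirichlet to Neumann map -/

/-- The conductivity `σ` in `Ω` is infinite in `A`, zero in the rest of `D`, and constant
outside `D`. -/
structure HasInclusions (Ω : Set (Space d)) (γ : ℝ) (σ : Space d → ℝ≥0∞) (D A : Set (Space d)) :
    Prop where
  measurableSet_domain : MeasurableSet Ω
  measurableSet_inclusion : MeasurableSet D
  measurableSet_conducting : MeasurableSet A
  conducting_subset : A ⊆ D
  inclusion_subset : D ⊆ Ω
  eq_background : ∀ x ∈ Ω, x ∉ D → σ x = ENNReal.ofReal γ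
  eq_zero : ∀ x ∈ D, x ∉ A → σ x = 0
  eq_top : ∀ x ∈ A, σ x = ⊤

/-- Lebesgue measure in `Ω` outside `D`. -/
abbrev outside (Ω D : Set (Space d)) : Measure (Space d) := (volume.restrict Ω).restrict Dᶜ

/-- The energy outside `D` for unit conductivity. -/
def outerEnergy (Ω D : Set (Space d)) {p : ℝ} (u : W1p Ω p) : ℝ :=
  ∫ x, ‖weakGrad Ω (u : Space d → ℝ) x‖ ^ p ∂(outside Ω D)

theorem outerEnergy_nonneg (Ω D : Set (Space d)) {p : ℝ} (u : W1p Ω p) :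
    0 ≤ outerEnergy Ω D u := integral_nonneg fun _ => by positivity

theorem memLp_outside {Ω : Set (Space d)} (hΩ : IsOpen Ω) (D : Set (Space d)) {p : ℝ}
    (u : W1p Ω p) : MemLp (weakGrad Ω (u : Space d → ℝ)) (ENNReal.ofReal p) (outside Ω D) :=
  (memLp_weakGrad hΩ u).mono_measure Measure.restrict_le_self

theorem lintegral_enorm_rpow_eq {α E : Type*} [MeasurableSpace α] {ν : Measure α}
    [NormedAddCommGroup E] {p : ℝ} (hp : 0 < p) {f : α → E} (hf : MemLp f (ENNReal.ofReal p) ν) :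
    ∫⁻ x, ‖f x‖ₑ ^ p ∂ν = ENNReal.ofReal (∫ x, ‖f x‖ ^ p ∂ν) := by
  rw [ofReal_integral_eq_lintegral_ofReal (integrable_norm_rpow_of_memLp hp hf)
    (Eventually.of_forall fun x => by positivity)]
  refine lintegral_congr fun x => ?_
  rw [← ofReal_norm, ENNReal.ofReal_rpow_of_nonneg (norm_nonneg _) hp.le]

namespace HasInclusions

variable {Ω D A : Set (Space d)} {γ p : ℝ} {σ : Space d → ℝ≥0∞}

theorem superconducting_eq (h : HasInclusions Ω γ σ D A) : superconducting Ω σ = A := by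
  ext x
  refine ⟨fun hx => ?_, fun hx => ⟨h.inclusion_subset (h.conducting_subset hx), h.eq_top x hx⟩⟩
  by_contra hA
  have ht : σ x = ⊤ := hx.2
  by_cases hD : x ∈ D
  · rw [h.eq_zero x hD hA] at ht
    exact ENNReal.zero_ne_top ht
  · rw [h.eq_background x hx.1 hD] at ht
    exact ENNReal.ofReal_ne_top ht

theorem lintegral_split (h : HasInclusions Ω γ σ D A) (F : Space d → ℝ≥0∞) :
    ∫⁻ x in Ω, σ x * F x = (∫⁻ x in A, σ x * F x) + ∫⁻ x, ENNReal.ofReal γ * F x ∂(outside Ω D) := by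
  have hAΩ : A ⊆ Ω := h.conducting_subset.trans h.inclusion_subset
  rw [← lintegral_inter_add_sdiff _ Ω h.measurableSet_inclusion,
    Set.inter_eq_self_of_subset_right h.inclusion_subset,
    ← lintegral_inter_add_sdiff _ D h.measurableSet_conducting,
    Set.inter_eq_self_of_subset_right h.conducting_subset]
  have h0 : ∫⁻ x in D \ A, σ x * F x = 0 := by
    rw [setLIntegral_congr_fun (g := fun _ => 0)
      (h.measurableSet_inclusion.diff h.measurableSet_conducting)
      fun x hx => by simp [h.eq_zero x hx.1 hx.2]]
    simp
  rw [h0, add_zero]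
  congr 1
  rw [outside, Measure.restrict_restrict h.measurableSet_inclusion.compl, Set.inter_comm,
    ← Set.sdiff_eq]
  exact setLIntegral_congr_fun (h.measurableSet_domain.diff h.measurableSet_inclusion)
    fun x hx => by simp [h.eq_background x hx.1 hx.2]

theorem energy_eq (h : HasInclusions Ω γ σ D A) (hΩ : IsOpen Ω) (hp : 0 < p) (hγ : 0 ≤ γ)
    {u : W1p Ω p} (hu : ∀ᵐ x ∂(volume.restrict A), weakGrad Ω (u : Space d → ℝ) x = 0) :
    energy Ω p σ u = ENNReal.ofReal (γ * outerEnergy Ω D u) := by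
  rw [energy, h.lintegral_split]
  have h0 : ∫⁻ x in A, σ x * ‖weakGrad Ω (u : Space d → ℝ) x‖ₑ ^ p = 0 := by
    rw [lintegral_congr_ae (g := fun _ => 0)]
    · simp
    · filter_upwards [hu] with x hx
      simp [hx, hp]
  rw [h0, zero_add, lintegral_const_mul' _ _ ENNReal.ofReal_ne_top,
    lintegral_enorm_rpow_eq hp (memLp_outside hΩ D u), ENNReal.ofReal_mul hγ]
  rfl

/-- Since ∞ · 0 = 0, finite energy forces the gradient to vanish almost everywhere in A. Minimizing
the energy is thus minimizing the outer energy among extensions with zero gradient in A. -/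
theorem energy_eq_top (h : HasInclusions Ω γ σ D A) (hΩ : IsOpen Ω) (hp : 0 < p)
    {u : W1p Ω p} (hu : ¬ ∀ᵐ x ∂(volume.restrict A), weakGrad Ω (u : Space d → ℝ) x = 0) :
    energy Ω p σ u = ⊤ := by
  rw [energy, h.lintegral_split]
  have hm : AEMeasurable (fun x => ‖weakGrad Ω (u : Space d → ℝ) x‖ₑ ^ p) (volume.restrict A) :=
    (((memLp_weakGrad hΩ u).1.mono_measure (Measure.restrict_mono
      (h.conducting_subset.trans h.inclusion_subset) le_rfl)).enorm).pow_const p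
  have h0 : ∫⁻ x in A, σ x * ‖weakGrad Ω (u : Space d → ℝ) x‖ₑ ^ p = ⊤ := by
    rw [setLIntegral_congr_fun (g := fun x => ⊤ * ‖weakGrad Ω (u : Space d → ℝ) x‖ₑ ^ p)
      h.measurableSet_conducting fun x hx => by simp only [h.eq_top x hx],
      lintegral_const_mul'' _ hm]
    refine ENNReal.top_mul fun h1 => hu ?_
    filter_upwards [(lintegral_eq_zero_iff' hm).1 h1] with x hx
    simpa [hp, hp.le, hp.not_gt] using hx
  rw [h0, top_add]

/-- Nothing is contributed by D: the conductivity is 0 in D \ A, and in A its real value is 0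
because `⊤.toReal = 0`. -/
theorem fluxPairing_eq (h : HasInclusions Ω γ σ D A) (hγ : 0 ≤ γ) (u v : W1p Ω p) :
    fluxPairing Ω p σ u v = γ * ∫ x, ‖weakGrad Ω (u : Space d → ℝ) x‖ ^ (p - 2) *
      inner ℝ (weakGrad Ω (u : Space d → ℝ) x) (weakGrad Ω (v : Space d → ℝ) x)
        ∂(outside Ω D) := by
  rw [fluxPairing, ← integral_const_mul, outside,
    Measure.restrict_restrict h.measurableSet_inclusion.compl, Set.inter_comm, ← Set.sdiff_eq,
    setIntegral_eq_of_subset_of_forall_sdiff_eq_zero (s := Ω \ D) h.measurableSet_domain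
      Set.sdiff_subset]
  · refine setIntegral_congr_fun (h.measurableSet_domain.diff h.measurableSet_inclusion)
      fun x hx => ?_
    simp only [h.eq_background x hx.1 hx.2, ENNReal.toReal_ofReal hγ, mul_assoc]
  · intro x hx
    have hD : x ∈ D := by
      by_contra hD
      exact hx.2 ⟨hx.1, hD⟩
    by_cases hA : x ∈ A
    · simp [h.eq_top x hA]
    · simp [h.eq_zero x hD hA]

theorem isExtension_iff (h : HasInclusions Ω γ σ D A) {F : BdryData Ω p} {v : W1p Ω p} :
    IsExtension Ω p σ F v ↔ Submodule.Quotient.mk v = F ∧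
      ∀ᵐ x ∂(volume.restrict A), weakGrad Ω (v : Space d → ℝ) x = 0 := by
  rw [IsExtension, h.superconducting_eq]

theorem IsExtension.add_smul_sub (h : HasInclusions Ω γ σ D A) (hΩ : IsOpen Ω)
    {F : BdryData Ω p} {u v : W1p Ω p} (hu : IsExtension Ω p σ F u) (hv : IsExtension Ω p σ F v)
    (t : ℝ) : IsExtension Ω p σ F (u + t • (v - u)) := by
  rw [h.isExtension_iff] at *
  refine ⟨?_, ?_⟩
  · rw [Submodule.Quotient.mk_add, Submodule.Quotient.mk_smul, Submodule.Quotient.mk_sub, hu.1,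
      hv.1, sub_self, smul_zero, add_zero]
  · have hle : (volume.restrict A : Measure (Space d)) ≤ volume.restrict Ω :=
      Measure.restrict_mono (h.conducting_subset.trans h.inclusion_subset) le_rfl
    filter_upwards [hu.2, hv.2, ae_mono hle (weakGrad_add_ae_eq hΩ u (t • (v - u))),
      ae_mono hle (weakGrad_smul_ae_eq hΩ t (v - u)), ae_mono hle (weakGrad_sub_ae_eq hΩ v u)]
      with x h1 h2 h3 h4 h5
    rw [h3, Pi.add_apply, h4, Pi.smul_apply, h5, Pi.sub_apply, h1, h2]
    simp

/-- The Dirichlet to Neumann map on the diagonal is the minimal energy. -/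
theorem dnMap_self (h : HasInclusions Ω γ σ D A) (hΩ : IsOpen Ω) (hp : 1 < p) (hγ : 0 < γ)
    {F : BdryData Ω p} {u₀ : W1p Ω p} (hu₀ : IsExtension Ω p σ F u₀)
    (hmin : ∀ v : W1p Ω p, IsExtension Ω p σ F v → outerEnergy Ω D u₀ ≤ outerEnergy Ω D v) :
    dnMap Ω p σ F F = γ * outerEnergy Ω D u₀ := by
  have hp0 : 0 < p := by linarith
  have hu₀' := h.isExtension_iff.1 hu₀
  have hmin₀ : IsMinimizer Ω p σ F u₀ := by
    refine ⟨hu₀.1, fun v hv => ?_⟩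
    by_cases hA : ∀ᵐ x ∂(volume.restrict A), weakGrad Ω (v : Space d → ℝ) x = 0
    · rw [h.energy_eq hΩ hp0 hγ.le hu₀'.2, h.energy_eq hΩ hp0 hγ.le hA]
      exact ENNReal.ofReal_le_ofReal (mul_le_mul_of_nonneg_left
        (hmin v (h.isExtension_iff.2 ⟨hv, hA⟩)) hγ.le)
    · rw [h.energy_eq_top hΩ hp0 hA]
      exact le_top
  have hex : ∃ uv : W1p Ω p × W1p Ω p, IsMinimizer Ω p σ F uv.1 ∧ IsExtension Ω p σ F uv.2 :=
    ⟨(u₀, u₀), hmin₀, hu₀⟩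
  rw [dnMap, dif_pos hex]
  obtain ⟨hum, hv⟩ := hex.choose_spec
  -- The definition selects an unknown minimizer u and extension v. As the energy of u is at most
  -- that of u₀, it is finite; hence u is an extension too and has the same outer energy as u₀.
  set u := hex.choose.1
  set v := hex.choose.2
  have hle : energy Ω p σ u ≤ ENNReal.ofReal (γ * outerEnergy Ω D u₀) :=
    (hum.2 u₀ hu₀.1).trans_eq (h.energy_eq hΩ hp0 hγ.le hu₀'.2)
  have huA : ∀ᵐ x ∂(volume.restrict A), weakGrad Ω (u : Space d → ℝ) x = 0 := by
    by_contra hA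
    rw [h.energy_eq_top hΩ hp0 hA] at hle
    exact ENNReal.ofReal_ne_top (top_le_iff.1 hle)
  have hu : IsExtension Ω p σ F u := h.isExtension_iff.2 ⟨hum.1, huA⟩
  rw [h.energy_eq hΩ hp0 hγ.le huA, ENNReal.ofReal_le_ofReal_iff
    (mul_nonneg hγ.le (outerEnergy_nonneg _ _ _)), mul_le_mul_iff_right₀ hγ] at hle
  have heq : outerEnergy Ω D u = outerEnergy Ω D u₀ := le_antisymm hle (hmin u hu)
  rw [h.fluxPairing_eq hγ.le, ← heq]
  congr 1
  have hout : ∀ {f g : Space d → Space d}, f =ᵐ[volume.restrict Ω] g →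
      f =ᵐ[outside Ω D] g := fun hfg => ae_restrict_of_ae hfg
  have mu := memLp_outside hΩ D u
  have mvu := memLp_outside hΩ D (v - u)
  -- The line through u and v consists of extensions of F, so the Euler-Lagrange equation
  -- annihilates v - u and allows v to be replaced by u in the pairing.
  have hzero : ∫ x, ‖weakGrad Ω (u : Space d → ℝ) x‖ ^ (p - 2) *
      inner ℝ (weakGrad Ω (u : Space d → ℝ) x) (weakGrad Ω ((v - u : W1p Ω p) : Space d → ℝ) x)
        ∂(outside Ω D) = 0 := by
    refine integral_flux_eq_zero_of_minimal hp mu mvu fun t => ?_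
    have h1 := hmin _ (IsExtension.add_smul_sub h hΩ hu hv t)
    rw [← heq] at h1
    refine h1.trans (le_of_eq (integral_congr_ae ?_))
    filter_upwards [hout (weakGrad_add_ae_eq hΩ u (t • (v - u))),
      hout (weakGrad_smul_ae_eq hΩ t (v - u))] with x h3 h4
    rw [h3, Pi.add_apply, h4, Pi.smul_apply]
  calc _ = ∫ x, (‖weakGrad Ω (u : Space d → ℝ) x‖ ^ (p - 2) *
      inner ℝ (weakGrad Ω (u : Space d → ℝ) x) (weakGrad Ω (u : Space d → ℝ) x) +
      ‖weakGrad Ω (u : Space d → ℝ) x‖ ^ (p - 2) * inner ℝ (weakGrad Ω (u : Space d → ℝ) x)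
        (weakGrad Ω ((v - u : W1p Ω p) : Space d → ℝ) x)) ∂(outside Ω D) := by
        refine integral_congr_ae ?_
        filter_upwards [hout (weakGrad_sub_ae_eq hΩ v u)] with x hx
        rw [hx, Pi.sub_apply, ← mul_add, ← inner_add_right, add_sub_cancel]
    _ = _ := by
      rw [integral_add (integrable_flux hp mu mu) (integrable_flux hp mu mvu), hzero, add_zero]
      exact integral_congr_ae (Eventually.of_forall fun x =>
        norm_rpow_sub_two_mul_inner_self hp _)

end HasInclusions

theorem weakGradLp_add {Ω : Set (Space d)} (hΩ : IsOpen Ω) {p : ℝ} (u v : W1p Ω p) :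
    weakGradLp hΩ (u + v) = weakGradLp hΩ u + weakGradLp hΩ v := by
  refine Lp.ext ?_
  filter_upwards [weakGradLp_ae_eq hΩ (u + v), weakGradLp_ae_eq hΩ u, weakGradLp_ae_eq hΩ v,
    weakGrad_add_ae_eq hΩ u v, Lp.coeFn_add (weakGradLp hΩ u) (weakGradLp hΩ v)]
    with x h1 h2 h3 h4 h5
  rw [h1, h4, h5, Pi.add_apply, Pi.add_apply, h2, h3]

theorem outerEnergy_eq_norm_restrictCompl {Ω : Set (Space d)} (hΩ : IsOpen Ω) (D : Set (Space d))
    {p : ℝ} (hp : 0 < p) [Fact (1 ≤ ENNReal.ofReal p)] (u : W1p Ω p) :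
    outerEnergy Ω D u = ‖restrictCompl Ω D p (weakGradLp hΩ u)‖ ^ p := by
  rw [lp_norm_rpow_eq_integral hp]
  refine integral_congr_ae ?_
  filter_upwards [LpToLpRestrictCLM_coeFn ℝ Dᶜ (weakGradLp hΩ u),
    ae_restrict_of_ae (s := Dᶜ) (weakGradLp_ae_eq hΩ u)] with x h1 h2
  rw [h1, h2]

theorem exists_weakGradLp_eq (hd : 1 ≤ d) {p : ℝ} (hp : 1 < p) [Fact (1 ≤ ENNReal.ofReal p)]
    {Ω : Set (Space d)} (hΩ : IsOpen Ω) (hΩb : Bornology.IsBounded Ω) (f : W1p Ω p)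
    {x : Lp (Space d) (ENNReal.ofReal p) (volume.restrict Ω)}
    (hx : x ∈ (testGrad Ω p).topologicalClosure) :
    ∃ u : W1p Ω p, (Submodule.Quotient.mk u : BdryData Ω p) = Submodule.Quotient.mk f ∧
      weakGradLp hΩ u = weakGradLp hΩ f + x := by
  obtain ⟨u, hu, hux⟩ := exists_mem_W1p0_of_mem_closure hd hp hΩ hΩb hx
  refine ⟨f + u, ?_, ?_⟩
  · rw [Submodule.Quotient.eq]
    simpa using hu
  · rw [weakGradLp_add]
    congr 1
    exact Lp.ext ((weakGradLp_ae_eq hΩ u).trans hux)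

theorem exists_weakGradLp_add {p : ℝ} [Fact (1 ≤ ENNReal.ofReal p)]
    {Ω : Set (Space d)} (hΩ : IsOpen Ω) (hΩb : Bornology.IsBounded Ω) {f v : W1p Ω p}
    (hv : (Submodule.Quotient.mk v : BdryData Ω p) = Submodule.Quotient.mk f) :
    ∃ x ∈ (testGrad Ω p).topologicalClosure, weakGradLp hΩ v = weakGradLp hΩ f + x := by
  refine ⟨weakGradLp hΩ (v - f),
    weakGradLp_mem_closure hΩ hΩb ((Submodule.Quotient.eq _).1 hv), ?_⟩
  rw [← weakGradLp_add, add_sub_cancel]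

/-- Energy minimizers exist outside an insulating Lipschitz inclusion. -/
theorem exists_minimal_outerEnergy (hd : 1 ≤ d) {p : ℝ} (hp : 1 < p) {Ω D : Set (Space d)}
    (hΩ : IsOpen Ω) (hΩb : Bornology.IsBounded Ω) (hD : HasLipschitzBoundary D)
    (hDΩ : closure D ⊆ Ω) (F : BdryData Ω p) :
    ∃ u : W1p Ω p, Submodule.Quotient.mk u = F ∧
      ∀ v : W1p Ω p, Submodule.Quotient.mk v = F → outerEnergy Ω D u ≤ outerEnergy Ω D v := by
  have : Fact (1 ≤ ENNReal.ofReal p) := ⟨by simpa using hp.le⟩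
  have hp0 : 0 < p := by linarith
  obtain ⟨f, rfl⟩ := Submodule.Quotient.mk_surjective _ F
  set T := restrictCompl Ω D p
  set X := (testGrad Ω p).topologicalClosure
  -- The outer energy depends only on the gradient restricted to the complement of D, so the norm is
  -- minimized over these restrictions. Their closedness rests on the extension across D.
  set K : Set (Lp (Space d) (ENNReal.ofReal p) (outside Ω D)) :=
    (fun y => T (weakGradLp hΩ f) + y) '' (T '' (X : Set _)) with hK
  have hKc : IsClosed K :=
    (Homeomorph.addLeft (T (weakGradLp hΩ f))).isClosedMap _
      (isClosed_image_restrictCompl hp hΩ hΩb hD hDΩ)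
  have hKv : Convex ℝ K := ((X.convex).is_linear_image T.toLinearMap.isLinear).translate _
  have hKn : K.Nonempty := ⟨_, _, ⟨0, X.zero_mem, rfl⟩, rfl⟩
  obtain ⟨_, ⟨_, ⟨x, hx, rfl⟩, rfl⟩, hmin⟩ := exists_minimal_norm hp hKc hKv hKn
  obtain ⟨u, hu, hux⟩ := exists_weakGradLp_eq hd hp hΩ hΩb f hx
  refine ⟨u, hu, fun v hv => ?_⟩
  obtain ⟨y, hy, hvy⟩ := exists_weakGradLp_add hΩ hΩb hv
  rw [outerEnergy_eq_norm_restrictCompl hΩ D hp0, outerEnergy_eq_norm_restrictCompl hΩ D hp0, hux,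
    hvy, map_add, map_add]
  exact Real.rpow_le_rpow (norm_nonneg _) (hmin _ ⟨_, ⟨y, hy, rfl⟩, rfl⟩) hp0.le

theorem outerEnergy_eq_norm {Ω D : Set (Space d)} (hΩ : IsOpen Ω) (hD : MeasurableSet D)
    (hDΩ : D ⊆ Ω) {p : ℝ} (hp : 0 < p) {u : W1p Ω p}
    (hu : ∀ᵐ x ∂(volume.restrict D), weakGrad Ω (u : Space d → ℝ) x = 0) :
    outerEnergy Ω D u = ‖weakGradLp hΩ u‖ ^ p := by
  rw [lp_norm_rpow_eq_integral hp, outerEnergy]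
  have h1 : ∫ x in Ω, ‖weakGradLp hΩ u x‖ ^ p =
      ∫ x in Ω, ‖weakGrad Ω (u : Space d → ℝ) x‖ ^ p := by
    refine integral_congr_ae ?_
    filter_upwards [weakGradLp_ae_eq hΩ u] with x hx
    rw [hx]
  rw [h1, ← integral_add_compl hD (integrable_norm_rpow_of_memLp hp (memLp_weakGrad hΩ u)),
    Measure.restrict_restrict hD, Set.inter_eq_self_of_subset_left hDΩ]
  have h0 : ∫ x in D, ‖weakGrad Ω (u : Space d → ℝ) x‖ ^ p = 0 := by
    rw [integral_congr_ae (g := fun _ => 0)]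
    · simp
    · filter_upwards [hu] with x hx
      simp [hx, Real.zero_rpow hp.ne']
  rw [h0, zero_add]

/-- Energy minimizers exist outside a superconducting inclusion. -/
theorem exists_minimal_outerEnergy_of_vanishing (hd : 1 ≤ d) {p : ℝ} (hp : 1 < p)
    {Ω D : Set (Space d)} (hΩ : IsOpen Ω) (hΩb : Bornology.IsBounded Ω) (hD : MeasurableSet D)
    (hDΩ : D ⊆ Ω) {f : W1p Ω p}
    (hf : ∀ᵐ x ∂(volume.restrict D), weakGrad Ω (f : Space d → ℝ) x = 0) :
    ∃ u : W1p Ω p, (Submodule.Quotient.mk u : BdryData Ω p) = Submodule.Quotient.mk f ∧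
      (∀ᵐ x ∂(volume.restrict D), weakGrad Ω (u : Space d → ℝ) x = 0) ∧
      ∀ v : W1p Ω p, (Submodule.Quotient.mk v : BdryData Ω p) = Submodule.Quotient.mk f →
        (∀ᵐ x ∂(volume.restrict D), weakGrad Ω (v : Space d → ℝ) x = 0) →
        outerEnergy Ω D u ≤ outerEnergy Ω D v := by
  have : Fact (1 ≤ ENNReal.ofReal p) := ⟨by simpa using hp.le⟩
  have hp0 : 0 < p := by linarith
  set X := (testGrad Ω p).topologicalClosure
  set R := LpToLpRestrictCLM (Space d) (Space d) ℝ (volume.restrict Ω) (ENNReal.ofReal p) D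
  have hrr : (volume.restrict Ω).restrict D = (volume.restrict D : Measure (Space d)) := by
    rw [Measure.restrict_restrict hD, Set.inter_eq_self_of_subset_left hDΩ]
  have hR : ∀ u : W1p Ω p, R (weakGradLp hΩ u) = 0 ↔
      ∀ᵐ x ∂(volume.restrict D), weakGrad Ω (u : Space d → ℝ) x = 0 := by
    intro u
    have h1 := LpToLpRestrictCLM_coeFn (F := Space d) ℝ D (weakGradLp hΩ u)
    have h2 := ae_restrict_of_ae (s := D) (weakGradLp_ae_eq hΩ u)
    rw [Lp.eq_zero_iff_ae_eq_zero, ← hrr]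
    constructor <;> intro h3 <;> filter_upwards [h1, h2, h3] with x h1 h2 h3
    · rw [← h2, ← h1, h3]; rfl
    · rw [h1, h2, h3]; rfl
  -- Vanishing in D is a closed linear constraint on gradients in Ω, so no regularity of the
  -- boundary of D is involved.
  set K : Set (Lp (Space d) (ENNReal.ofReal p) (volume.restrict Ω)) :=
    ((fun y => weakGradLp hΩ f + y) '' (X : Set _)) ∩ (LinearMap.ker R.toLinearMap : Set _) with hK
  have hKc : IsClosed K :=
    ((Homeomorph.addLeft (weakGradLp hΩ f)).isClosedMap _
      (Submodule.isClosed_topologicalClosure _)).inter R.isClosed_ker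
  have hKv : Convex ℝ K := (X.convex.translate _).inter (Submodule.convex _)
  have hKn : K.Nonempty := ⟨weakGradLp hΩ f, ⟨0, X.zero_mem, add_zero _⟩, (hR f).2 hf⟩
  obtain ⟨_, ⟨⟨x, hx, rfl⟩, hxR⟩, hmin⟩ := exists_minimal_norm hp hKc hKv hKn
  obtain ⟨u, hu, hux⟩ := exists_weakGradLp_eq hd hp hΩ hΩb f hx
  have hu0 := (hR u).1 (by rw [hux]; exact hxR)
  refine ⟨u, hu, hu0, fun v hv hv0 => ?_⟩
  obtain ⟨y, hy, hvy⟩ := exists_weakGradLp_add hΩ hΩb hv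
  rw [outerEnergy_eq_norm hΩ hD hDΩ hp0 hu0, outerEnergy_eq_norm hΩ hD hDΩ hp0 hv0]
  refine Real.rpow_le_rpow (norm_nonneg _) ?_ hp0.le
  rw [hux]
  exact hmin _ ⟨⟨y, hy, hvy.symm⟩, (hR v).2 hv0⟩

end

section

variable {d : ℕ}

/-! ### Comparison of the Dirichlet to Neumann maps at a `p`-harmonic function -/

/-- `f` is continuously differentiable and `p`-harmonic in `Ω`. -/
structure IsPHarmonic (Ω : Set (Space d)) (p : ℝ) (f : Space d → ℝ) : Prop where
  contDiff : ContDiff ℝ 1 f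
  integral_flux : ∀ ψ, IsTest Ω ψ →
    ∫ x in Ω, ‖gradient f x‖ ^ (p - 2) * inner ℝ (gradient f x) (gradient ψ x) = 0

theorem bdryValue_of_contDiff {Ω : Set (Space d)} (hΩb : Bornology.IsBounded Ω) (p : ℝ)
    {f : Space d → ℝ} (hf : ContDiff ℝ 1 f) :
    bdryValue Ω p f = Submodule.Quotient.mk ⟨f, mem_W1p_of_contDiff hΩb p hf⟩ := by
  rw [bdryValue, dif_pos]

/-- Meant for χ f, which is only C¹, so that mollification has to supply the test functions.
Energies depend on gradients alone; v need not be identified with u. -/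
theorem exists_mem_W1p0_weakGrad_eq (hd : 1 ≤ d) {p : ℝ} (hp : 1 < p) {Ω : Set (Space d)}
    (hΩ : IsOpen Ω) (hΩb : Bornology.IsBounded Ω) {u : Space d → ℝ} (hu : ContDiff ℝ 1 u)
    (huc : HasCompactSupport u) (hut : tsupport u ⊆ Ω) :
    ∃ v : W1p Ω p, v ∈ W1p0 Ω p ∧
      weakGrad Ω (v : Space d → ℝ) =ᵐ[volume.restrict Ω] gradient u := by
  have : Fact (1 ≤ ENNReal.ofReal p) := ⟨by simpa using hp.le⟩
  obtain ⟨K, hK⟩ := ContDiff.lipschitzWith_of_hasCompactSupport huc hu (by simp)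
  have hm : MemLp (gradient u) (ENNReal.ofReal p) (volume.restrict Ω) :=
    memLp_of_continuous hΩb (continuous_gradient_of_contDiff hu)
  have hx : hm.toLp (gradient u) ∈ (testGrad Ω p).topologicalClosure := by
    refine EMetric.mem_closure_iff.2 fun ε hε => ?_
    obtain ⟨ζ, hζ, hζu⟩ := exists_isTest_approx hp hΩ hΩb hK huc hut hε
    refine ⟨_, hζ.toLp_mem_testGrad hΩb, ?_⟩
    rwa [edist_comm, Lp.edist_toLp_toLp]
  obtain ⟨v, hv, hvu⟩ := exists_mem_W1p0_of_mem_closure hd hp hΩ hΩb hx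
  exact ⟨v, hv, hvu.trans (MemLp.coeFn_toLp _)⟩

namespace IsPHarmonic

variable {Ω : Set (Space d)} {p : ℝ} {f : Space d → ℝ}

/-- The flux |∇f|^(p-2)∇f is bounded on Ω, since ∇f is continuous on the compact closure. The weak
equation therefore passes to L^p limits of gradients of test functions. -/
theorem integral_flux_eq_zero (h : IsPHarmonic Ω p f) (hΩ : IsOpen Ω)
    (hΩb : Bornology.IsBounded Ω) (hp : 1 < p) {v : W1p Ω p} (hv : v ∈ W1p0 Ω p) :
    ∫ x in Ω, ‖gradient f x‖ ^ (p - 2) *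
      inner ℝ (gradient f x) (weakGrad Ω (v : Space d → ℝ) x) = 0 := by
  obtain ⟨G, hG, hw, φ, hφ, -, hlim⟩ := hv
  have := isFiniteMeasure_restrict hΩb
  have hc := continuous_gradient_of_contDiff h.contDiff
  obtain ⟨C, hC⟩ := hΩb.isCompact_closure.exists_bound_of_continuousOn hc.continuousOn
  have hC' : ∀ᵐ x ∂(volume.restrict Ω),
      ‖‖gradient f x‖ ^ (p - 2) • gradient f x‖ ≤ C ^ (p - 1) := by
    filter_upwards [ae_restrict_mem hΩ.measurableSet] with x hx
    rw [norm_smul, Real.norm_of_nonneg (by positivity), norm_rpow_sub_two_mul_norm hp]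
    exact Real.rpow_le_rpow (norm_nonneg _) (hC x (subset_closure hx)) (by linarith)
  have hm : AEStronglyMeasurable (fun x => ‖gradient f x‖ ^ (p - 2) • gradient f x)
      (volume.restrict Ω) :=
    (hc.measurable.norm.pow_const _).aestronglyMeasurable.smul hc.aestronglyMeasurable
  have ht := tendsto_integral_smul_of_eLpNorm (innerSL ℝ (E := Space d))
    (show 1 ≤ ENNReal.ofReal p by simpa using hp.le)
    (fun n => memLp_of_continuous hΩb (hφ n).continuous_gradient) hG hlim hm hC'
  have he : ∀ V : Space d → Space d, ∫ x in Ω, innerSL ℝ (V x)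
      (‖gradient f x‖ ^ (p - 2) • gradient f x) =
      ∫ x in Ω, ‖gradient f x‖ ^ (p - 2) * inner ℝ (gradient f x) (V x) := by
    intro V
    simp only [innerSL_apply_apply, inner_smul_right, real_inner_comm]
  rw [he] at ht
  simp only [he, h.integral_flux _ (hφ _)] at ht
  rw [tendsto_nhds_unique tendsto_const_nhds ht]
  refine integral_congr_ae ?_
  filter_upwards [hw.weakGrad_ae_eq hΩ] with x hx
  rw [hx]

theorem memLp_gradient (h : IsPHarmonic Ω p f) (hΩb : Bornology.IsBounded Ω) :
    MemLp (gradient f) (ENNReal.ofReal p) (volume.restrict Ω) :=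
  memLp_of_continuous hΩb (continuous_gradient_of_contDiff h.contDiff)

/-- A `p`-harmonic function minimizes the energy, with a gain for competitors whose gradient
vanishes in a set `D`. -/
theorem energy_add_le (h : IsPHarmonic Ω p f) (hΩ : IsOpen Ω) (hΩb : Bornology.IsBounded Ω)
    (hp : 1 < p) {D : Set (Space d)} (hD : MeasurableSet D) (hDΩ : D ⊆ Ω) {u : W1p Ω p}
    (hu : Submodule.Quotient.mk u = bdryValue Ω p f)
    (hu0 : ∀ᵐ x ∂(volume.restrict D), weakGrad Ω (u : Space d → ℝ) x = 0) :
    (∫ x in Ω, ‖gradient f x‖ ^ p) + (p - 1) * ∫ x in D, ‖gradient f x‖ ^ p ≤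
      ∫ x in Ω, ‖weakGrad Ω (u : Space d → ℝ) x‖ ^ p := by
  have hp0 : 0 < p := by linarith
  rw [bdryValue_of_contDiff hΩb p h.contDiff, Submodule.Quotient.eq] at hu
  have h0 := h.integral_flux_eq_zero hΩ hΩb hp hu
  have hm := h.memLp_gradient (p := p) hΩb
  have hint := integrable_norm_rpow_of_memLp hp0 hm
  have hflux := integrable_flux hp hm
    (memLp_weakGrad hΩ (u - ⟨f, mem_W1p_of_contDiff hΩb p h.contDiff⟩))
  have hsum : Integrable (fun x => ‖gradient f x‖ ^ p + p * (‖gradient f x‖ ^ (p - 2) *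
      inner ℝ (gradient f x) (weakGrad Ω ((u - ⟨f, mem_W1p_of_contDiff hΩb p h.contDiff⟩ :
        W1p Ω p) : Space d → ℝ) x))) (volume.restrict Ω) := hint.add (hflux.const_mul p)
  have hind : Integrable (D.indicator fun x => (p - 1) * ‖gradient f x‖ ^ p) (volume.restrict Ω) :=
    (hint.const_mul _).indicator hD
  have e1 : ∫ x in Ω, D.indicator (fun x => (p - 1) * ‖gradient f x‖ ^ p) x =
      (p - 1) * ∫ x in D, ‖gradient f x‖ ^ p := by
    rw [integral_indicator hD, Measure.restrict_restrict hD,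
      Set.inter_eq_self_of_subset_left hDΩ, integral_const_mul]
  have e2 : ∫ x in Ω, ((‖gradient f x‖ ^ p + p * (‖gradient f x‖ ^ (p - 2) *
      inner ℝ (gradient f x) (weakGrad Ω ((u - ⟨f, mem_W1p_of_contDiff hΩb p h.contDiff⟩ :
        W1p Ω p) : Space d → ℝ) x))) + D.indicator (fun x => (p - 1) * ‖gradient f x‖ ^ p) x) =
      (∫ x in Ω, ‖gradient f x‖ ^ p) + (p - 1) * ∫ x in D, ‖gradient f x‖ ^ p := by
    rw [integral_add hsum hind, integral_add hint (hflux.const_mul p),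
      integral_const_mul, h0, e1, mul_zero, add_zero]
  rw [← e2]
  refine integral_mono_ae (hsum.add hind)
    (integrable_norm_rpow_of_memLp hp0 (memLp_weakGrad hΩ u)) ?_
  have hu0' : ∀ᵐ x ∂(volume.restrict Ω), x ∈ D → weakGrad Ω (u : Space d → ℝ) x = 0 :=
    ae_restrict_of_ae ((ae_restrict_iff' hD).1 hu0)
  filter_upwards [hu0', weakGrad_sub_ae_eq hΩ u ⟨f, mem_W1p_of_contDiff hΩb p h.contDiff⟩,
    weakGrad_of_contDiff_ae_eq hΩ h.contDiff] with x h1 h2 h3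
  simp only [h2, Pi.sub_apply, h3]
  -- In D the competitor has zero gradient, and the tangent inequality has slack exactly (p-1)|∇f|^p
  -- there. Elsewhere it is used as it stands.
  by_cases hxD : x ∈ D
  · rw [Set.indicator_of_mem hxD, h1 hxD, zero_sub, inner_neg_right, norm_zero,
      Real.zero_rpow hp0.ne', mul_neg, norm_rpow_sub_two_mul_inner_self hp]
    exact le_of_eq (by ring)
  · rw [Set.indicator_of_notMem hxD, add_zero]
    exact norm_rpow_add_inner_le hp _ _

theorem outerEnergy_eq (hf : ContDiff ℝ 1 f) (hΩ : IsOpen Ω) (hΩb : Bornology.IsBounded Ω)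
    (D : Set (Space d)) :
    outerEnergy Ω D (⟨f, mem_W1p_of_contDiff hΩb p hf⟩ : W1p Ω p) =
      ∫ x, ‖gradient f x‖ ^ p ∂(outside Ω D) := by
  refine integral_congr_ae ?_
  filter_upwards [ae_restrict_of_ae (s := Dᶜ) (weakGrad_of_contDiff_ae_eq hΩ hf)] with x hx
  simp only [hx]

theorem hasInclusions_const (hΩ : IsOpen Ω) (γ : ℝ) :
    HasInclusions Ω γ (fun _ => ENNReal.ofReal γ) ∅ ∅ :=
  ⟨hΩ.measurableSet, .empty, .empty, le_rfl, Set.empty_subset _, fun _ _ _ => rfl,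
    fun _ h => h.elim, fun _ h => h.elim⟩

/-- With no inclusion, f is its own minimizer: this is the energy comparison with D = ∅. -/
theorem dnMap_const (h : IsPHarmonic Ω p f) (hΩ : IsOpen Ω) (hΩb : Bornology.IsBounded Ω)
    (hp : 1 < p) {γ : ℝ} (hγ : 0 < γ) :
    dnMap Ω p (fun _ => ENNReal.ofReal γ) (bdryValue Ω p f) (bdryValue Ω p f) =
      γ * ∫ x in Ω, ‖gradient f x‖ ^ p := by
  have hI := hasInclusions_const hΩ γ
  have ho : outside Ω ∅ = volume.restrict Ω := by simp [outside]
  have hmin : ∀ v : W1p Ω p,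
      IsExtension Ω p (fun _ => ENNReal.ofReal γ) (bdryValue Ω p f) v →
      outerEnergy Ω ∅ (⟨f, mem_W1p_of_contDiff hΩb p h.contDiff⟩ : W1p Ω p) ≤
        outerEnergy Ω ∅ v := by
    intro v hv
    rw [outerEnergy_eq h.contDiff hΩ hΩb, outerEnergy, ho]
    simpa using h.energy_add_le hΩ hΩb hp .empty (Set.empty_subset _) hv.1 (by simp)
  rw [hI.dnMap_self hΩ hp hγ (hI.isExtension_iff.2
    ⟨(bdryValue_of_contDiff hΩb p h.contDiff).symm, by simp⟩) hmin,
    outerEnergy_eq h.contDiff hΩ hΩb, ho]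

theorem integral_outside_add (h : IsPHarmonic Ω p f) (hΩb : Bornology.IsBounded Ω) (hp : 0 < p)
    {D : Set (Space d)} (hD : MeasurableSet D) (hDΩ : D ⊆ Ω) :
    (∫ x in D, ‖gradient f x‖ ^ p) + ∫ x, ‖gradient f x‖ ^ p ∂(outside Ω D) =
      ∫ x in Ω, ‖gradient f x‖ ^ p := by
  rw [← integral_add_compl hD (integrable_norm_rpow_of_memLp hp (h.memLp_gradient hΩb)),
    Measure.restrict_restrict hD, Set.inter_eq_self_of_subset_left hDΩ]

/-- An insulating inclusion lowers the energy. -/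
theorem dnMap_insulating_le (h : IsPHarmonic Ω p f) (hd : 1 ≤ d) (hΩ : IsOpen Ω)
    (hΩb : Bornology.IsBounded Ω) (hp : 1 < p) {γ : ℝ} (hγ : 0 < γ) {σ : Space d → ℝ≥0∞}
    {D : Set (Space d)} (hD : HasLipschitzBoundary D) (hDΩ : closure D ⊆ Ω)
    (hI : HasInclusions Ω γ σ D ∅) :
    0 ≤ dnMap Ω p σ (bdryValue Ω p f) (bdryValue Ω p f) ∧
      dnMap Ω p σ (bdryValue Ω p f) (bdryValue Ω p f) + γ * ∫ x in D, ‖gradient f x‖ ^ p ≤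
        γ * ∫ x in Ω, ‖gradient f x‖ ^ p := by
  obtain ⟨u, hu, hmin⟩ := exists_minimal_outerEnergy hd hp hΩ hΩb hD hDΩ (bdryValue Ω p f)
  rw [hI.dnMap_self hΩ hp hγ (hI.isExtension_iff.2 ⟨hu, by simp⟩) fun v hv => hmin v hv.1]
  refine ⟨mul_nonneg hγ.le (outerEnergy_nonneg _ _ _), ?_⟩
  -- An insulator imposes no constraint, so f itself is a competitor.
  have h1 := hmin _ (bdryValue_of_contDiff hΩb p h.contDiff).symm
  rw [outerEnergy_eq h.contDiff hΩ hΩb] at h1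
  rw [← h.integral_outside_add hΩb (by linarith) hD.1.measurableSet
    (subset_closure.trans hDΩ), ← mul_add, add_comm]
  gcongr

/-- A perfectly conducting inclusion raises the energy. -/
theorem le_dnMap_superconducting (h : IsPHarmonic Ω p f) (hd : 1 ≤ d) (hΩ : IsOpen Ω)
    (hΩb : Bornology.IsBounded Ω) (hp : 1 < p) {γ : ℝ} (hγ : 0 < γ) {σ : Space d → ℝ≥0∞}
    {D : Set (Space d)} (hD : IsOpen D) (hI : HasInclusions Ω γ σ D D) {χ : Space d → ℝ}
    (hχ : IsTest Ω χ) (hχD : ∀ x ∈ D, χ x = 1) :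
    γ * ((∫ x in Ω, ‖gradient f x‖ ^ p) + (p - 1) * ∫ x in D, ‖gradient f x‖ ^ p) ≤
        dnMap Ω p σ (bdryValue Ω p f) (bdryValue Ω p f) ∧
      dnMap Ω p σ (bdryValue Ω p f) (bdryValue Ω p f) ≤
        γ * ∫ x in Ω, ‖gradient (fun y => (1 - χ y) * f y) x‖ ^ p := by
  have hp0 : 0 < p := by linarith
  obtain ⟨v, hv, hvg⟩ := exists_mem_W1p0_weakGrad_eq hd hp hΩ hΩb
    (u := fun y => χ y * f y) (hχ.contDiff_one.mul h.contDiff) hχ.2.1.mul_right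
    ((tsupport_mul_subset_left (g := f)).trans hχ.2.2)
  -- In place of (1 - χ) f: it has the boundary values of f, the gradient of (1 - χ) f, and hence
  -- zero gradient in D. It makes the admissible class nonempty and provides the upper bound.
  set g : W1p Ω p := ⟨f, mem_W1p_of_contDiff hΩb p h.contDiff⟩ - v with hg
  have hgF : Submodule.Quotient.mk g = bdryValue Ω p f := by
    rw [bdryValue_of_contDiff hΩb p h.contDiff, Submodule.Quotient.eq, hg, sub_sub_cancel_left]
    exact Submodule.neg_mem _ hv
  have hgg : weakGrad Ω (g : Space d → ℝ) =ᵐ[volume.restrict Ω]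
      gradient fun y => (1 - χ y) * f y := by
    filter_upwards [weakGrad_sub_ae_eq hΩ ⟨f, mem_W1p_of_contDiff hΩb p h.contDiff⟩ v, hvg,
      weakGrad_of_contDiff_ae_eq hΩ h.contDiff] with x h1 h2 h3
    rw [h1, Pi.sub_apply, h2]
    simp only [h3]
    have e : (fun y => (1 - χ y) * f y) = f - fun y => χ y * f y := by
      funext y
      simp only [Pi.sub_apply]
      ring
    rw [e, gradient_sub (h.contDiff.differentiable (by simp) x)
      ((hχ.contDiff_one.mul h.contDiff).differentiable (by simp) x)]
  have hDΩ := hI.inclusion_subset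
  have hg0 : ∀ᵐ x ∂(volume.restrict D), weakGrad Ω (g : Space d → ℝ) x = 0 := by
    filter_upwards [ae_mono (Measure.restrict_mono hDΩ le_rfl) hgg,
      ae_restrict_mem hD.measurableSet] with x hx hxD
    have hev : (fun y => (1 - χ y) * f y) =ᶠ[𝓝 x] fun _ => 0 := by
      filter_upwards [hD.mem_nhds hxD] with y hy
      rw [hχD y hy, sub_self, zero_mul]
    rw [hx, gradient, hev.fderiv_eq]
    simp
  obtain ⟨u, hu, hu0, hmin⟩ := exists_minimal_outerEnergy_of_vanishing hd hp hΩ hΩb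
    hD.measurableSet hDΩ hg0
  rw [hgF] at hu hmin
  have houter : ∀ z : W1p Ω p, (∀ᵐ x ∂(volume.restrict D), weakGrad Ω (z : Space d → ℝ) x = 0) →
      outerEnergy Ω D z = ∫ x in Ω, ‖weakGrad Ω (z : Space d → ℝ) x‖ ^ p := by
    intro z hz
    rw [outerEnergy_eq_norm hΩ hD.measurableSet hDΩ hp0 hz, lp_norm_rpow_eq_integral hp0]
    refine integral_congr_ae ?_
    filter_upwards [weakGradLp_ae_eq hΩ z] with x hx
    rw [hx]
  rw [hI.dnMap_self hΩ hp hγ (hI.isExtension_iff.2 ⟨hu, hu0⟩)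
    fun w hw => hmin w hw.1 (hI.isExtension_iff.1 hw).2]
  refine ⟨mul_le_mul_of_nonneg_left ?_ hγ.le, mul_le_mul_of_nonneg_left ?_ hγ.le⟩
  · rw [houter u hu0]
    exact h.energy_add_le hΩ hΩb hp hD.measurableSet hDΩ hu hu0
  · refine (hmin g hgF hg0).trans (le_of_eq ?_)
    rw [houter g hg0]
    refine integral_congr_ae ?_
    filter_upwards [hgg] with x hx
    rw [hx]

end IsPHarmonic

end

section

variable {d : ℕ}

/-! ### Wolff solutions -/

theorem hasFDerivAt_exp_mul {h : ℝ → ℝ} {h' : ℝ} {κ t τ : ℝ} {ρ η x : Space d}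
    (hh : HasDerivAt h h' (τ * inner ℝ η x)) :
    HasFDerivAt (fun y : Space d => Real.exp (κ * (inner ℝ ρ y - t)) * h (τ * inner ℝ η y))
      (Real.exp (κ * (inner ℝ ρ x - t)) •
        ((κ * h (τ * inner ℝ η x)) • innerSL ℝ ρ + (τ * h') • innerSL ℝ η)) x := by
  have h1 : HasFDerivAt (fun y : Space d => κ * (inner ℝ ρ y - t)) (κ • innerSL ℝ ρ) x :=
    ((innerSL ℝ ρ).hasFDerivAt.sub_const t).const_mul κ
  have h2 : HasFDerivAt (fun y : Space d => τ * inner ℝ η y) (τ • innerSL ℝ η) x :=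
    (innerSL ℝ η).hasFDerivAt.const_mul τ
  refine (h1.exp.mul (hh.comp_hasFDerivAt x h2)).congr_fderiv ?_
  ext v
  simp
  ring

theorem contDiff_exp_mul {n : WithTop ℕ∞} {h : ℝ → ℝ} (hh : ContDiff ℝ n h) (κ t τ : ℝ)
    (ρ η : Space d) :
    ContDiff ℝ n fun y : Space d => Real.exp (κ * (inner ℝ ρ y - t)) * h (τ * inner ℝ η y) :=
  ((contDiff_const.mul ((innerSL ℝ ρ).contDiff.sub contDiff_const)).exp).mul
    (hh.comp (contDiff_const.mul (innerSL ℝ η).contDiff))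

theorem gradient_wolffSolution {w : ℝ → ℝ} (hw : Differentiable ℝ w) (t : ℝ) (ρ η : Space d)
    (τ : ℝ) (x : Space d) :
    gradient (wolffSolution w t ρ η τ) x = (τ * Real.exp (τ * (inner ℝ ρ x - t))) •
      (w (τ * inner ℝ η x) • ρ + deriv w (τ * inner ℝ η x) • η) := by
  refine ext_inner_right ℝ fun v => ?_
  rw [inner_gradient]
  have := (hasFDerivAt_exp_mul (κ := τ) (t := t) (ρ := ρ) (hw (τ * inner ℝ η x)).hasDerivAt).fderiv
  rw [show wolffSolution w t ρ η τ = fun y : Space d =>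
    Real.exp (τ * (inner ℝ ρ y - t)) * w (τ * inner ℝ η y) from rfl, this]
  simp [inner_smul_left, inner_add_left]
  ring

theorem norm_smul_add_smul {ρ η : Space d} (hρ : ‖ρ‖ = 1) (hη : ‖η‖ = 1) (ho : inner ℝ ρ η = 0)
    (a b : ℝ) : ‖a • ρ + b • η‖ = √(a ^ 2 + b ^ 2) := by
  rw [← Real.sqrt_sq (norm_nonneg (a • ρ + b • η)), norm_add_sq_real, norm_smul, norm_smul, hρ, hη,
    inner_smul_left, inner_smul_right, ho]
  simp

theorem norm_gradient_wolffSolution {w : ℝ → ℝ} (hw : Differentiable ℝ w) (t : ℝ) {ρ η : Space d}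
    (hρ : ‖ρ‖ = 1) (hη : ‖η‖ = 1) (ho : inner ℝ ρ η = 0) {τ : ℝ} (hτ : 0 < τ) (x : Space d) :
    ‖gradient (wolffSolution w t ρ η τ) x‖ = τ * Real.exp (τ * (inner ℝ ρ x - t)) *
      √(w (τ * inner ℝ η x) ^ 2 + deriv w (τ * inner ℝ η x) ^ 2) := by
  rw [gradient_wolffSolution hw, norm_smul, norm_smul_add_smul hρ hη ho,
    Real.norm_of_nonneg (by positivity)]

theorem IsTest.integral_mul_inner_gradient {Ω : Set (Space d)} {ψ : Space d → ℝ}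
    (hψ : IsTest Ω ψ) {A : Space d → ℝ} (hA : ContDiff ℝ 1 A) (v : Space d) :
    ∫ x in Ω, A x * inner ℝ v (gradient ψ x) = -∫ x in Ω, ψ x * fderiv ℝ A x v := by
  have hw := hasWeakGradient_of_contDiff Ω hA
  have h := congrArg (fun z => inner ℝ v z) (hw.2.2 ψ hψ)
  simp only [inner_neg_right] at h
  rw [← integral_inner (hψ.integrable_smul_gradient hw.1),
    ← integral_inner (hψ.integrable_smul hw.2.1)] at h
  simpa only [inner_smul_right, real_inner_comm (gradient A _) v, inner_gradient] using h

/-- The second component of Wolff's flux. -/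
theorem IsWolffProfile.hasDerivAt_flux {p : ℝ} (hp : 1 < p) {w : ℝ → ℝ} (hw : IsWolffProfile p w)
    (s : ℝ) :
    HasDerivAt (fun s => (w s ^ 2 + deriv w s ^ 2) ^ ((p - 2) / 2) * deriv w s)
      (-(p - 1) * ((w s ^ 2 + deriv w s ^ 2) ^ ((p - 2) / 2) * w s)) s := by
  have hQ := hw.sq_pos hp s
  have h1 := ((hw.hasDerivAt_sq s).rpow_const (p := (p - 2) / 2) (Or.inl hQ.ne')).mul
    (hw.hasDerivAt_deriv s)
  refine h1.congr_deriv ?_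
  have hden := wolffV_denom_pos hp hQ
  rw [Real.rpow_sub_one hQ.ne']
  have hV : wolffV p (w s) (deriv w s) * ((p - 1) * deriv w s ^ 2 + w s ^ 2) =
      (2 * p - 3) * deriv w s ^ 2 + (p - 1) * w s ^ 2 := by
    unfold wolffV
    rw [div_mul_cancel₀ _ hden.ne']
  field_simp
  linear_combination (-w s) * hV

/-- The flux is τ^(p-1) e^((p-1)τ(ρ·x-t)) (aρ + bη), where a and b are Q^((p-2)/2) times w and w',
evaluated at τη·x. Its divergence vanishes because b' = -(p-1)a, which is Wolff's equation. -/
theorem IsWolffProfile.isPHarmonic {p : ℝ} (hp : 1 < p) {w : ℝ → ℝ} (hw : IsWolffProfile p w)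
    (Ω : Set (Space d)) (t : ℝ) {ρ η : Space d}
    (hρ : ‖ρ‖ = 1) (hη : ‖η‖ = 1) (ho : inner ℝ ρ η = 0) {τ : ℝ} (hτ : 0 < τ) :
    IsPHarmonic Ω p (wolffSolution w t ρ η τ) := by
  have hw1 : ContDiff ℝ 1 w := hw.1.of_le (by norm_num)
  have hwd : Differentiable ℝ w := hw1.differentiable (by simp)
  refine ⟨contDiff_exp_mul hw1 τ t τ ρ η, fun ψ hψ => ?_⟩
  set Q : ℝ → ℝ := fun s => w s ^ 2 + deriv w s ^ 2 with hQ
  have hQp : ∀ s, 0 < Q s := hw.sq_pos hp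
  set a : ℝ → ℝ := fun s => Q s ^ ((p - 2) / 2) * w s with ha
  set b : ℝ → ℝ := fun s => Q s ^ ((p - 2) / 2) * deriv w s with hb
  have hQ1 : ContDiff ℝ 1 fun s => Q s ^ ((p - 2) / 2) :=
    ((hw1.pow 2).add (hw.contDiff_deriv.pow 2)).rpow_const_of_ne fun s => (hQp s).ne'
  have ha1 : ContDiff ℝ 1 a := hQ1.mul hw1
  have hb1 : ContDiff ℝ 1 b := hQ1.mul hw.contDiff_deriv
  set κ := (p - 1) * τ with hκ
  set A : Space d → ℝ := fun y => Real.exp (κ * (inner ℝ ρ y - t)) * a (τ * inner ℝ η y) with hA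
  set B : Space d → ℝ := fun y => Real.exp (κ * (inner ℝ ρ y - t)) * b (τ * inner ℝ η y) with hB
  have hA1 : ContDiff ℝ 1 A := contDiff_exp_mul ha1 κ t τ ρ η
  have hB1 : ContDiff ℝ 1 B := contDiff_exp_mul hb1 κ t τ ρ η
  have hflux : ∀ x, ‖gradient (wolffSolution w t ρ η τ) x‖ ^ (p - 2) *
      inner ℝ (gradient (wolffSolution w t ρ η τ) x) (gradient ψ x) =
      τ ^ (p - 1) * (A x * inner ℝ ρ (gradient ψ x) + B x * inner ℝ η (gradient ψ x)) := by
    intro x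
    rw [norm_gradient_wolffSolution hwd t hρ hη ho hτ, gradient_wolffSolution hwd]
    have e1 : (√(Q (τ * inner ℝ η x))) ^ (p - 2) = Q (τ * inner ℝ η x) ^ ((p - 2) / 2) := by
      rw [Real.sqrt_eq_rpow, ← Real.rpow_mul (hQp _).le]
      congr 1
      ring
    have e2 : (τ * Real.exp (τ * (inner ℝ ρ x - t))) ^ (p - 2) *
        (τ * Real.exp (τ * (inner ℝ ρ x - t))) =
        τ ^ (p - 1) * Real.exp (κ * (inner ℝ ρ x - t)) := by
      have hpos : 0 < τ * Real.exp (τ * (inner ℝ ρ x - t)) := by positivity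
      rw [← Real.rpow_add_one hpos.ne', Real.mul_rpow hτ.le (Real.exp_pos _).le, ← Real.exp_mul]
      congr 2 <;> ring
    rw [Real.mul_rpow (by positivity) (Real.sqrt_nonneg _), e1, inner_smul_left, inner_add_left,
      inner_smul_left, inner_smul_left]
    simp only [conj_trivial, hA, hB, ha, hb]
    linear_combination (Q (τ * inner ℝ η x) ^ ((p - 2) / 2) *
      (w (τ * inner ℝ η x) * inner ℝ ρ (gradient ψ x) +
        deriv w (τ * inner ℝ η x) * inner ℝ η (gradient ψ x))) * e2
  simp only [hflux]
  have hint : ∀ {Z : Space d → ℝ} (_ : ContDiff ℝ 1 Z) (v : Space d),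
      IntegrableOn (fun x => Z x * inner ℝ v (gradient ψ x)) Ω := by
    intro Z hZ v
    have := (hψ.integrable_smul_gradient
      (hZ.continuous.locallyIntegrable.locallyIntegrableOn Ω)).const_inner (𝕜 := ℝ) v
    simpa only [inner_smul_right, IntegrableOn] using this
  rw [integral_const_mul, integral_add (hint hA1 ρ) (hint hB1 η),
    hψ.integral_mul_inner_gradient hA1, hψ.integral_mul_inner_gradient hB1]
  have hAB : ∀ x, fderiv ℝ A x ρ = -fderiv ℝ B x η := by
    intro x
    rw [(hasFDerivAt_exp_mul (ha1.differentiable (by simp) _).hasDerivAt).fderiv,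
      (hasFDerivAt_exp_mul (hw.hasDerivAt_flux hp _)).fderiv]
    have ho' : inner ℝ η ρ = 0 := by rw [real_inner_comm]; exact ho
    simp [ho, ho', hρ, hη, ha, hκ, hQ]
    ring
  simp only [hAB, mul_neg, integral_neg]
  ring

end

section

variable {d : ℕ}

/-! ### The indicator function and the enclosure -/

theorem exists_isTest_eq_one {Ω K : Set (Space d)} (hΩ : IsOpen Ω) (hK : IsCompact K)
    (hKΩ : K ⊆ Ω) : ∃ χ, IsTest Ω χ ∧ ∀ x ∈ K, χ x = 1 := by
  obtain ⟨L, hL, hKL, hLΩ⟩ := exists_compact_between hK hΩ hKΩ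
  obtain ⟨χ, h0, h1, -⟩ := exists_contMDiffMap_zero_one_of_isClosed (n := ⊤)
    (modelWithCornersSelf ℝ (Space d)) isOpen_interior.isClosed_compl hK.isClosed
    (Set.disjoint_left.2 fun x hx hxK => hx (hKL hxK))
  have hs : tsupport χ ⊆ L := by
    refine closure_minimal (fun x hx => ?_) hL.isClosed
    by_contra hxL
    exact hx (h0 fun hxi => hxL (interior_subset hxi))
  exact ⟨χ, ⟨χ.contMDiff.contDiff, hL.of_isClosed_subset (isClosed_tsupport _) hs,
    hs.trans hLΩ⟩, fun x hx => h1 hx⟩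

theorem closure_subset_of_disjoint_frontier {X : Type*} [TopologicalSpace X] {D Ω : Set X}
    (hΩ : IsOpen Ω) (hD : D ⊆ Ω) (h : Disjoint (closure D) (frontier Ω)) : closure D ⊆ Ω := by
  intro x hx
  by_contra hxΩ
  refine Set.disjoint_left.1 h hx ?_
  rw [hΩ.frontier_eq]
  exact ⟨closure_mono hD hx, hxΩ⟩

/-- An intersection of open half-spaces. -/
theorem convex_enclosure (Ω : Set (Space d)) (p γ : ℝ) (w : ℝ → ℝ)
    (Λ : BdryData Ω p → BdryData Ω p → ℝ) : Convex ℝ (enclosure Ω p γ w Λ) := by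
  intro x hx y hy a b ha hb hab t ρ η hρ hη ho hn
  exact (convex_halfSpace_lt (innerSL ℝ ρ).isLinear t) (hx t ρ η hρ hη ho hn)
    (hy t ρ η hρ hη ho hn) ha hb hab

/-- Hahn-Banach separation, with the normal vector scaled to unit length. For empty Ω any unit
vector will do. -/
theorem exists_halfSpace_of_notMem (hd : 1 ≤ d) {Ω : Set (Space d)} {x : Space d}
    (hx : x ∉ closure (convexHull ℝ Ω)) :
    ∃ (ρ : Space d) (ε : ℝ), ‖ρ‖ = 1 ∧ 0 < ε ∧ ∀ y ∈ Ω, inner ℝ ρ y - inner ℝ ρ x ≤ -ε := by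
  rcases Ω.eq_empty_or_nonempty with rfl | ⟨y₀, hy₀⟩
  · have : Nontrivial (Space d) := by
      have : Nonempty (Fin d) := ⟨⟨0, hd⟩⟩
      infer_instance
    obtain ⟨ρ, hρ⟩ := exists_norm_eq (Space d) zero_le_one
    exact ⟨ρ, 1, hρ, one_pos, fun y hy => hy.elim⟩
  · obtain ⟨L, u, hL, hu⟩ := geometric_hahn_banach_closed_point
      (convex_convexHull ℝ Ω).closure isClosed_closure hx
    set v := (InnerProductSpace.toDual ℝ (Space d)).symm L with hv
    have hLv : ∀ y, L y = inner ℝ v y := fun y => by rw [hv, InnerProductSpace.toDual_symm_apply]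
    have hmem : ∀ y ∈ Ω, L y < u := fun y hy => hL y (subset_closure (subset_convexHull ℝ Ω hy))
    have hv0 : v ≠ 0 := by
      intro h0
      have h1 := hmem y₀ hy₀
      rw [hLv, h0, inner_zero_left] at h1
      rw [hLv, h0, inner_zero_left] at hu
      linarith
    have hvn : 0 < ‖v‖ := norm_pos_iff.2 hv0
    refine ⟨‖v‖⁻¹ • v, ‖v‖⁻¹ * (L x - u), by
      rw [norm_smul, norm_inv, norm_norm, inv_mul_cancel₀ hvn.ne'], by
      have : 0 < L x - u := by linarith
      positivity, fun y hy => ?_⟩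
    have h1 := hmem y hy
    rw [hLv] at h1
    rw [inner_smul_left, inner_smul_left, hLv]
    simp only [conj_trivial]
    rw [← mul_sub, ← mul_neg]
    exact mul_le_mul_of_nonneg_left (by linarith) (by positivity)

theorem exists_orthogonal_unit (hd : 2 ≤ d) (ρ : Space d) :
    ∃ η : Space d, ‖η‖ = 1 ∧ inner ℝ ρ η = 0 := by
  have hfin : Module.finrank ℝ (Space d) = d := by simp
  have h1 : 0 < Module.finrank ℝ (Submodule.span ℝ {ρ})ᗮ := by
    have h2 := Submodule.finrank_add_finrank_orthogonal (Submodule.span ℝ {ρ})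
    have h3 := finrank_span_le_card (R := ℝ) ({ρ} : Set (Space d))
    rw [Set.toFinset_singleton, Finset.card_singleton] at h3
    omega
  have : Nontrivial (Submodule.span ℝ {ρ})ᗮ := Module.finrank_pos_iff.1 h1
  obtain ⟨η, hη⟩ := exists_norm_eq (Submodule.span ℝ {ρ})ᗮ zero_le_one
  exact ⟨η, hη, Submodule.mem_orthogonal_singleton_iff_inner_right.1 η.2⟩

variable {p γ : ℝ} {w : ℝ → ℝ} {Ω : Set (Space d)} {t : ℝ} {ρ η : Space d}

/-- The gradient of a Wolff solution has no zeros, as w²+w'² > 0. This makes the sign of the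
indicator strict for every τ, not only for large τ. -/
theorem IsWolffProfile.integral_gradient_pos (hp : 1 < p) (hw : IsWolffProfile p w)
    {D : Set (Space d)} (hD : IsOpen D) (hDb : Bornology.IsBounded D) (hne : D.Nonempty)
    (hρ : ‖ρ‖ = 1) (hη : ‖η‖ = 1) (ho : inner ℝ ρ η = 0) {τ : ℝ} (hτ : 0 < τ) :
    0 < ∫ x in D, ‖gradient (wolffSolution w t ρ η τ) x‖ ^ p := by
  have hp0 : 0 < p := by linarith
  have h := hw.isPHarmonic hp D t hρ hη ho hτ
  have hpos : ∀ x, 0 < ‖gradient (wolffSolution w t ρ η τ) x‖ ^ p := by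
    intro x
    rw [norm_gradient_wolffSolution (hw.1.differentiable (by simp)) t hρ hη ho hτ]
    have := hw.sq_pos hp (τ * inner ℝ η x)
    positivity
  rw [setIntegral_pos_iff_support_of_nonneg_ae (Eventually.of_forall fun x => (hpos x).le)
    (integrable_norm_rpow_of_memLp hp0 (h.memLp_gradient hDb))]
  have : Function.support (fun x => ‖gradient (wolffSolution w t ρ η τ) x‖ ^ p) = Set.univ :=
    Set.eq_univ_of_forall fun x => (hpos x).ne'
  rw [this, Set.univ_inter]
  exact hD.measure_pos _ hne

/-- Inclusions that meet the half-space are detected. -/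
theorem IsWolffProfile.detects (hp : 1 < p) (hw : IsWolffProfile p w)
    {Λ : BdryData Ω p → BdryData Ω p → ℝ}
    {D : Set (Space d)} (hD : IsOpen D) (hDb : Bornology.IsBounded D)
    (hρ : ‖ρ‖ = 1) (hη : ‖η‖ = 1) (ho : inner ℝ ρ η = 0) {k : ℝ} (hk : 0 < k)
    (hle : ∀ τ > 0, τ ^ ((d : ℝ) - p) *
      (k * ∫ x in D, ‖gradient (wolffSolution w t ρ η τ) x‖ ^ p) ≤
        |indicator Ω p γ w Λ t ρ η τ|)
    {x : Space d} (hx : x ∈ D) (hxt : t ≤ inner ℝ ρ x) : Detects Ω p γ w Λ t ρ η := by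
  have hp0 : 0 < p := by linarith
  obtain ⟨r, hr, hrD⟩ := Metric.isOpen_iff.1 hD x hx
  obtain ⟨c, C, hc, hcC⟩ := hw.exists_bounds hp
  -- The point x may lie on the boundary of the half-space, so a ball is shifted inwards along ρ. On
  -- it the exponential factor is at least 1.
  set B := Metric.ball (x + (r / 2) • ρ) (r / 2) with hB
  have hBD : B ⊆ D := by
    refine (Metric.ball_subset_ball' ?_).trans hrD
    rw [dist_eq_norm, add_sub_cancel_left, norm_smul, hρ, Real.norm_of_nonneg (by linarith)]
    linarith
  have hBt : ∀ y ∈ B, t ≤ inner ℝ ρ y := by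
    intro y hy
    rw [hB, mem_ball_iff_norm] at hy
    have h1 := abs_real_inner_le_norm ρ (y - (x + (r / 2) • ρ))
    rw [hρ, one_mul, inner_sub_right, inner_add_right, inner_smul_right,
      real_inner_self_eq_norm_sq, hρ] at h1
    have h2 := (abs_le.1 (h1.trans hy.le)).1
    linarith
  have hBvol : 0 < volume.real B := by
    rw [measureReal_def]
    exact ENNReal.toReal_pos (Metric.measure_ball_pos _ _ (by linarith)).ne'
      measure_ball_lt_top.ne
  refine ⟨k * (√c ^ p * volume.real B), by positivity, ?_⟩
  filter_upwards [eventually_ge_atTop 1] with τ hτ1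
  have hτ : 0 < τ := by linarith
  refine le_trans ?_ (hle τ hτ)
  have h := hw.isPHarmonic hp D t hρ hη ho hτ
  have hint := integrable_norm_rpow_of_memLp hp0 (h.memLp_gradient hDb)
  have h1 : τ ^ p * √c ^ p * volume.real B ≤
      ∫ y in D, ‖gradient (wolffSolution w t ρ η τ) y‖ ^ p := by
    calc τ ^ p * √c ^ p * volume.real B = ∫ y in B, τ ^ p * √c ^ p := by
          rw [setIntegral_const, smul_eq_mul, mul_comm]
      _ ≤ ∫ y in B, ‖gradient (wolffSolution w t ρ η τ) y‖ ^ p := by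
          refine setIntegral_mono_on (integrableOn_const measure_ball_lt_top.ne)
            (IntegrableOn.mono_set hint hBD) measurableSet_ball fun y hy => ?_
          rw [← Real.mul_rpow hτ.le (Real.sqrt_nonneg _)]
          refine Real.rpow_le_rpow (by positivity) ?_ hp0.le
          rw [norm_gradient_wolffSolution (hw.1.differentiable (by simp)) t hρ hη ho hτ]
          have he : 1 ≤ Real.exp (τ * (inner ℝ ρ y - t)) :=
            Real.one_le_exp (mul_nonneg hτ.le (by linarith [hBt y hy]))
          have hs := Real.sqrt_le_sqrt (hcC (τ * inner ℝ η y)).1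
          calc τ * √c = τ * 1 * √c := by ring
            _ ≤ _ := by gcongr
      _ ≤ _ := setIntegral_mono_set hint (Eventually.of_forall fun y => by positivity)
          hBD.eventuallyLE
  -- The normalization of the indicator and the growth of |∇f|^p combine to τ^d.
  have h2 : 1 ≤ τ ^ ((d : ℝ) - p) * τ ^ p := by
    rw [← Real.rpow_add hτ, sub_add_cancel]
    exact Real.one_le_rpow hτ1 (Nat.cast_nonneg d)
  calc k * (√c ^ p * volume.real B) = 1 * (k * (√c ^ p * volume.real B)) := by ring
    _ ≤ (τ ^ ((d : ℝ) - p) * τ ^ p) * (k * (√c ^ p * volume.real B)) := by gcongr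
    _ = τ ^ ((d : ℝ) - p) * (k * (τ ^ p * √c ^ p * volume.real B)) := by ring
    _ ≤ _ := by gcongr

/-- Half-spaces away from `Ω` are not detected. -/
theorem IsWolffProfile.not_detects (hp : 1 < p) (hw : IsWolffProfile p w)
    (hΩb : Bornology.IsBounded Ω) {Λ : BdryData Ω p → BdryData Ω p → ℝ} (hγ : 0 < γ)
    (hρ : ‖ρ‖ = 1) (hη : ‖η‖ = 1) (ho : inner ℝ ρ η = 0) {χ : Space d → ℝ} (hχ : IsTest Ω χ)
    (hle : ∀ τ > 0, |indicator Ω p γ w Λ t ρ η τ| ≤ τ ^ ((d : ℝ) - p) *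
      (γ * ∫ x in Ω, ‖gradient (fun y => (1 - χ y) * wolffSolution w t ρ η τ y) x‖ ^ p))
    {ε : ℝ} (hε : 0 < ε) (hfar : ∀ y ∈ Ω, inner ℝ ρ y - t ≤ -ε) :
    ¬ Detects Ω p γ w Λ t ρ η := by
  have hp0 : 0 < p := by linarith
  obtain ⟨c, C, hc, hcC⟩ := hw.exists_bounds hp
  obtain ⟨M₁, hM₁⟩ := hχ.2.1.exists_bound_of_continuous hχ.1.continuous
  obtain ⟨M₂, hM₂⟩ := hΩb.isCompact_closure.exists_bound_of_continuousOn
    hχ.continuous_gradient.continuousOn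
  set M := (1 + |M₁| + |M₂|) * √C with hM
  have hM0 : 0 ≤ M := by positivity
  have hwd : Differentiable ℝ w := hw.1.differentiable (by simp)
  -- In Ω the exponent is at most -ετ, so f and its gradient are both bounded by a constant times τ
  -- e^(-ετ); the factor τ ≥ 1 is superfluous for f. The p-th power times τ^(d-p) gives τ^d
  -- e^(-pετ), which tends to 0.
  have hbound : ∀ τ ≥ 1, ∀ x ∈ Ω,
      ‖gradient (fun y => (1 - χ y) * wolffSolution w t ρ η τ y) x‖ ≤
        M * (τ * Real.exp (-(ε * τ))) := by
    intro τ hτ1 x hx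
    have hτ : 0 < τ := by linarith
    have h := hw.isPHarmonic hp Ω t hρ hη ho hτ
    rw [gradient_mul (χ := fun y => 1 - χ y) ((differentiableAt_const _).sub (hχ.differentiable x))
      (h.contDiff.differentiable (by simp) x)]
    have hgχ : gradient (fun y => 1 - χ y) x = -gradient χ x := by
      simp [gradient, fderiv_const_sub]
    have hexp : Real.exp (τ * (inner ℝ ρ x - t)) ≤ Real.exp (-(ε * τ)) :=
      Real.exp_le_exp.2 (by nlinarith [hfar x hx])
    have hQ := (hcC (τ * inner ℝ η x)).2
    have hsq : √(w (τ * inner ℝ η x) ^ 2 + deriv w (τ * inner ℝ η x) ^ 2) ≤ √C :=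
      Real.sqrt_le_sqrt hQ
    have h1 : ‖gradient (wolffSolution w t ρ η τ) x‖ ≤ τ * Real.exp (-(ε * τ)) * √C := by
      rw [norm_gradient_wolffSolution hwd t hρ hη ho hτ]
      gcongr
    have h2 : |wolffSolution w t ρ η τ x| ≤ τ * Real.exp (-(ε * τ)) * √C := by
      rw [wolffSolution, abs_mul, abs_of_pos (Real.exp_pos _)]
      have h3 : |w (τ * inner ℝ η x)| ≤ √C :=
        Real.abs_le_sqrt (by nlinarith [sq_nonneg (deriv w (τ * inner ℝ η x))])
      calc Real.exp (τ * (inner ℝ ρ x - t)) * |w (τ * inner ℝ η x)| ≤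
            Real.exp (-(ε * τ)) * √C := by gcongr
        _ = 1 * Real.exp (-(ε * τ)) * √C := by ring
        _ ≤ _ := by gcongr
    have h4 : |1 - χ x| ≤ 1 + |M₁| := by
      have := abs_sub (1 : ℝ) (χ x)
      have h5 := hM₁ x
      rw [Real.norm_eq_abs] at h5
      rw [abs_one] at this
      linarith [le_abs_self M₁]
    have h6 : ‖gradient χ x‖ ≤ |M₂| := (hM₂ x (subset_closure hx)).trans (le_abs_self _)
    refine (norm_add_le _ _).trans ?_
    rw [norm_smul, norm_smul, hgχ, norm_neg, Real.norm_eq_abs, Real.norm_eq_abs]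
    calc |1 - χ x| * ‖gradient (wolffSolution w t ρ η τ) x‖ +
          |wolffSolution w t ρ η τ x| * ‖gradient χ x‖
        ≤ (1 + |M₁|) * (τ * Real.exp (-(ε * τ)) * √C) +
          (τ * Real.exp (-(ε * τ)) * √C) * |M₂| := by gcongr
      _ = _ := by rw [hM]; ring
  rintro ⟨c₀, hc₀, hev⟩
  have hlim : Tendsto (fun τ : ℝ => γ * (volume.real Ω * M ^ p) *
      (τ ^ (d : ℝ) * Real.exp (-(p * ε) * τ))) atTop (𝓝 0) := by
    have := (tendsto_rpow_mul_exp_neg_mul_atTop_nhds_zero (d : ℝ) (p * ε) (by positivity)).const_mul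
      (γ * (volume.real Ω * M ^ p))
    rwa [mul_zero] at this
  obtain ⟨τ, h1, h2, h3⟩ := (hev.and ((eventually_ge_atTop 1).and
    (hlim.eventually_lt_const hc₀))).exists
  have hτ : 0 < τ := by linarith
  refine absurd (h1.trans (hle τ hτ)) (not_le.2 (lt_of_le_of_lt ?_ h3))
  have hint : ∫ x in Ω, ‖gradient (fun y => (1 - χ y) * wolffSolution w t ρ η τ y) x‖ ^ p ≤
      (M * (τ * Real.exp (-(ε * τ)))) ^ p * volume.real Ω := by
    refine (le_abs_self _).trans ?_
    rw [← Real.norm_eq_abs]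
    refine norm_setIntegral_le_of_norm_le_const hΩb.measure_lt_top fun x hx => ?_
    rw [Real.norm_of_nonneg (by positivity)]
    exact Real.rpow_le_rpow (norm_nonneg _) (hbound τ h2 x hx) hp0.le
  calc τ ^ ((d : ℝ) - p) * (γ * ∫ x in Ω,
        ‖gradient (fun y => (1 - χ y) * wolffSolution w t ρ η τ y) x‖ ^ p)
      ≤ τ ^ ((d : ℝ) - p) * (γ * ((M * (τ * Real.exp (-(ε * τ)))) ^ p * volume.real Ω)) := by
        gcongr
    _ = γ * (volume.real Ω * M ^ p) * ((τ ^ ((d : ℝ) - p) * τ ^ p) *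
          Real.exp (-(p * ε) * τ)) := by
        rw [Real.mul_rpow hM0 (by positivity), Real.mul_rpow hτ.le (Real.exp_pos _).le,
          ← Real.exp_mul, show -(ε * τ) * p = -(p * ε) * τ by ring]
        ring
    _ = _ := by rw [← Real.rpow_add hτ, sub_add_cancel]

/-- The indicator function for an insulating inclusion. -/
theorem IsWolffProfile.indicator_insulating (hd : 1 ≤ d) (hp : 1 < p) (hw : IsWolffProfile p w)
    (hΩ : IsOpen Ω) (hΩb : Bornology.IsBounded Ω) (hγ : 0 < γ) {σ : Space d → ℝ≥0∞}
    {D : Set (Space d)} (hD : HasLipschitzBoundary D) (hDΩ : closure D ⊆ Ω)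
    (hI : HasInclusions Ω γ σ D ∅)
    (hρ : ‖ρ‖ = 1) (hη : ‖η‖ = 1) (ho : inner ℝ ρ η = 0) {τ : ℝ} (hτ : 0 < τ) :
    τ ^ ((d : ℝ) - p) * (γ * ∫ x in D, ‖gradient (wolffSolution w t ρ η τ) x‖ ^ p) ≤
        -indicator Ω p γ w (dnMap Ω p σ) t ρ η τ ∧
      -indicator Ω p γ w (dnMap Ω p σ) t ρ η τ ≤
        τ ^ ((d : ℝ) - p) * (γ * ∫ x in Ω, ‖gradient (wolffSolution w t ρ η τ) x‖ ^ p) := by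
  have h := hw.isPHarmonic hp Ω t hρ hη ho hτ
  obtain ⟨h1, h2⟩ := h.dnMap_insulating_le hd hΩ hΩb hp hγ hD hDΩ hI
  rw [indicator, h.dnMap_const hΩ hΩb hp hγ, ← mul_neg]
  have : 0 ≤ τ ^ ((d : ℝ) - p) := by positivity
  exact ⟨mul_le_mul_of_nonneg_left (by linarith) this,
    mul_le_mul_of_nonneg_left (by linarith) this⟩

/-- The indicator function for a perfectly conducting inclusion. -/
theorem IsWolffProfile.indicator_superconducting (hd : 1 ≤ d) (hp : 1 < p)
    (hw : IsWolffProfile p w) (hΩ : IsOpen Ω) (hΩb : Bornology.IsBounded Ω) (hγ : 0 < γ)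
    {σ : Space d → ℝ≥0∞} {D : Set (Space d)} (hD : IsOpen D) (hI : HasInclusions Ω γ σ D D)
    {χ : Space d → ℝ} (hχ : IsTest Ω χ) (hχD : ∀ x ∈ D, χ x = 1)
    (hρ : ‖ρ‖ = 1) (hη : ‖η‖ = 1) (ho : inner ℝ ρ η = 0) {τ : ℝ} (hτ : 0 < τ) :
    τ ^ ((d : ℝ) - p) * (γ * (p - 1) * ∫ x in D, ‖gradient (wolffSolution w t ρ η τ) x‖ ^ p) ≤
        indicator Ω p γ w (dnMap Ω p σ) t ρ η τ ∧
      indicator Ω p γ w (dnMap Ω p σ) t ρ η τ ≤ τ ^ ((d : ℝ) - p) *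
        (γ * ∫ x in Ω, ‖gradient (fun y => (1 - χ y) * wolffSolution w t ρ η τ y) x‖ ^ p) := by
  have h := hw.isPHarmonic hp Ω t hρ hη ho hτ
  obtain ⟨h1, h2⟩ := h.le_dnMap_superconducting hd hΩ hΩb hp hγ hD hI hχ hχD
  rw [indicator, h.dnMap_const hΩ hΩb hp hγ]
  have : 0 ≤ τ ^ ((d : ℝ) - p) := by positivity
  have h3 : 0 ≤ γ * ∫ x in Ω, ‖gradient (wolffSolution w t ρ η τ) x‖ ^ p :=
    mul_nonneg hγ.le (integral_nonneg fun x => by positivity)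
  exact ⟨mul_le_mul_of_nonneg_left (by linarith) this,
    mul_le_mul_of_nonneg_left (by linarith) this⟩

end

end PCalderon

end

/-! ### The main theorem -/

theorem mainTheorem3 {d : ℕ} (hd : 2 ≤ d) (p : ℝ) (hp : 1 < p)
    (Ω : Set (PCalderon.Space d)) (hΩ : IsOpen Ω) (hΩb : Bornology.IsBounded Ω)
    (γ : ℝ) (hγ : 0 < γ)
    (σ : PCalderon.Space d → ℝ≥0∞) (hσ : Measurable fun x : Ω => σ x)
    (D₀ Dinf : Set (PCalderon.Space d))
    (hD₀ : D₀ = PCalderon.insulating Ω σ) (hDinf : Dinf = PCalderon.superconducting Ω σ)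
    (hbackground : ∀ x ∈ Ω, x ∉ D₀ ∪ Dinf → σ x = ENNReal.ofReal γ)
    (hone : D₀ = ∅ ∨ Dinf = ∅)
    (hdisj₀ : Disjoint (closure D₀) (frontier Ω))
    (hdisjinf : Disjoint (closure Dinf) (frontier Ω))
    (hdisj : Disjoint (closure D₀) (closure Dinf))
    (hLip : PCalderon.HasLipschitzBoundary (D₀ ∪ Dinf)) :
    (∃ w : ℝ → ℝ, PCalderon.IsWolffProfile p w) ∧
    ∀ w : ℝ → ℝ, PCalderon.IsWolffProfile p w →
      Convex ℝ (PCalderon.enclosure Ω p γ w (PCalderon.dnMap Ω p σ)) ∧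
      convexHull ℝ (D₀ ∪ Dinf) ⊆ PCalderon.enclosure Ω p γ w (PCalderon.dnMap Ω p σ) ∧
      PCalderon.enclosure Ω p γ w (PCalderon.dnMap Ω p σ) ⊆ closure (convexHull ℝ Ω) ∧
      ∀ (t : ℝ) (ρ η : PCalderon.Space d) (τ : ℝ),
        ‖ρ‖ = 1 → ‖η‖ = 1 → inner ℝ ρ η = 0 → 0 < τ →
        (D₀.Nonempty ↔
          PCalderon.indicator Ω p γ w (PCalderon.dnMap Ω p σ) t ρ η τ < 0) ∧
        (Dinf.Nonempty ↔
          0 < PCalderon.indicator Ω p γ w (PCalderon.dnMap Ω p σ) t ρ η τ) := by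
  refine ⟨PCalderon.exists_isWolffProfile hp, fun w hw => ?_⟩
  have hd1 : 1 ≤ d := by omega
  have h₀ : ∀ x ∈ D₀, x ∈ Ω ∧ σ x = 0 := fun x hx => by rw [hD₀] at hx; exact hx
  have hinf : ∀ x ∈ Dinf, x ∈ Ω ∧ σ x = ⊤ := fun x hx => by rw [hDinf] at hx; exact hx
  have hins : Dinf = ∅ → PCalderon.HasLipschitzBoundary D₀ ∧ closure D₀ ⊆ Ω ∧
      PCalderon.HasInclusions Ω γ σ D₀ ∅ := by
    rintro rfl
    rw [Set.union_empty] at hLip hbackground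
    exact ⟨hLip, PCalderon.closure_subset_of_disjoint_frontier hΩ (fun x hx => (h₀ x hx).1) hdisj₀,
      hΩ.measurableSet, hLip.1.measurableSet, .empty, Set.empty_subset _, fun x hx => (h₀ x hx).1,
      hbackground, fun x hx _ => (h₀ x hx).2, fun _ h => h.elim⟩
  have hsup : D₀ = ∅ → ∃ χ, PCalderon.IsTest Ω χ ∧ (∀ x ∈ Dinf, χ x = 1) ∧ IsOpen Dinf ∧
      PCalderon.HasInclusions Ω γ σ Dinf Dinf := by
    rintro rfl
    rw [Set.empty_union] at hLip hbackground
    have hsub : Dinf ⊆ Ω := fun x hx => (hinf x hx).1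
    obtain ⟨χ, hχ, hχ1⟩ := PCalderon.exists_isTest_eq_one hΩ (hΩb.subset hsub).isCompact_closure
      (PCalderon.closure_subset_of_disjoint_frontier hΩ hsub hdisjinf)
    exact ⟨χ, hχ, fun x hx => hχ1 x (subset_closure hx), hLip.1,
      hΩ.measurableSet, hLip.1.measurableSet, hLip.1.measurableSet, le_rfl, hsub,
      hbackground, fun x hx h => (h hx).elim, fun x hx => (hinf x hx).2⟩
  have hrpow : ∀ τ : ℝ, 0 < τ → 0 < τ ^ ((d : ℝ) - p) := fun τ hτ => Real.rpow_pos_of_pos hτ _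
  have hint : ∀ (D : Set (PCalderon.Space d)) (f : PCalderon.Space d → ℝ),
      0 ≤ ∫ x in D, ‖gradient f x‖ ^ p := fun D f =>
    integral_nonneg fun x => Real.rpow_nonneg (norm_nonneg _) _
  have hdetect : ∀ (t : ℝ) (ρ η : PCalderon.Space d), ‖ρ‖ = 1 → ‖η‖ = 1 → inner ℝ ρ η = 0 →
      (∀ x ∈ D₀ ∪ Dinf, t ≤ inner ℝ ρ x →
        PCalderon.Detects Ω p γ w (PCalderon.dnMap Ω p σ) t ρ η) ∧
      ∀ ε > 0, (∀ y ∈ Ω, inner ℝ ρ y - t ≤ -ε) →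
        ¬ PCalderon.Detects Ω p γ w (PCalderon.dnMap Ω p σ) t ρ η := by
    intro t ρ η hρ hη ho
    rcases hone with hne | hne
    · obtain ⟨χ, hχ, hχ1, hDo, hI⟩ := hsup hne
      have hb := fun (τ : ℝ) (hτ : 0 < τ) => hw.indicator_superconducting (t := t) hd1 hp hΩ hΩb hγ
        hDo hI hχ hχ1 hρ hη ho hτ
      have hk : 0 < γ * (p - 1) := mul_pos hγ (by linarith)
      refine ⟨fun x hx hxt => ?_, fun ε hε hfar => ?_⟩
      · rw [hne, Set.empty_union] at hx
        exact hw.detects hp hDo (hΩb.subset hI.inclusion_subset) hρ hη ho hk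
          (fun τ hτ => (hb τ hτ).1.trans (le_abs_self _)) hx hxt
      · refine hw.not_detects hp hΩb hγ hρ hη ho hχ (fun τ hτ => ?_) hε hfar
        rw [abs_of_nonneg ((mul_nonneg (hrpow τ hτ).le (mul_nonneg hk.le (hint _ _))).trans
          (hb τ hτ).1)]
        exact (hb τ hτ).2
    · obtain ⟨hDL, hDc, hI⟩ := hins hne
      have hb := fun (τ : ℝ) (hτ : 0 < τ) => hw.indicator_insulating (t := t) hd1 hp hΩ hΩb hγ
        hDL hDc hI hρ hη ho hτ
      refine ⟨fun x hx hxt => ?_, fun ε hε hfar => ?_⟩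
      · rw [hne, Set.union_empty] at hx
        exact hw.detects hp hDL.1 (hΩb.subset hI.inclusion_subset) hρ hη ho hγ
          (fun τ hτ => (hb τ hτ).1.trans (neg_le_abs _)) hx hxt
      -- The upper bound for an insulator is the energy of f itself, so the cutoff is χ = 0.
      · refine hw.not_detects hp hΩb hγ hρ hη ho (PCalderon.IsTest.zero Ω) (fun τ hτ => ?_) hε hfar
        rw [← abs_neg, abs_of_nonneg ((mul_nonneg (hrpow τ hτ).le
          (mul_nonneg hγ.le (hint _ _))).trans (hb τ hτ).1)]
        simpa only [sub_zero, one_mul] using (hb τ hτ).2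
  have hconv := PCalderon.convex_enclosure Ω p γ w (PCalderon.dnMap Ω p σ)
  refine ⟨hconv, convexHull_min (fun x hx t ρ η hρ hη ho hn => ?_) hconv, fun x hx => ?_, ?_⟩
  · by_contra hlt
    exact hn ((hdetect t ρ η hρ hη ho).1 x hx (not_lt.1 hlt))
  · by_contra hxc
    obtain ⟨ρ, ε, hρ, hε, hfar⟩ := PCalderon.exists_halfSpace_of_notMem hd1 hxc
    obtain ⟨η, hη, ho⟩ := PCalderon.exists_orthogonal_unit hd ρ
    -- The half-space with t = ρ·x has x on its boundary and is not detected; membership of x in the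
    -- enclosure would mean ρ·x < ρ·x.
    exact lt_irrefl _ (hx _ ρ η hρ hη ho ((hdetect _ ρ η hρ hη ho).2 ε hε hfar))
  · intro t ρ η τ hρ hη ho hτ
    have hneg : Dinf = ∅ → _ := fun h => (hw.indicator_insulating (t := t) hd1 hp hΩ hΩb hγ
      (hins h).1 (hins h).2.1 (hins h).2.2 hρ hη ho hτ).1
    have hpos : D₀ = ∅ → τ ^ ((d : ℝ) - p) * (γ * (p - 1) * ∫ x in Dinf,
        ‖gradient (PCalderon.wolffSolution w t ρ η τ) x‖ ^ p) ≤
        PCalderon.indicator Ω p γ w (PCalderon.dnMap Ω p σ) t ρ η τ := by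
      intro h
      obtain ⟨χ, hχ, hχ1, hDo, hI⟩ := hsup h
      exact (hw.indicator_superconducting hd1 hp hΩ hΩb hγ hDo hI hχ hχ1 hρ hη ho hτ).1
    have hk : 0 < γ * (p - 1) := mul_pos hγ (by linarith)
    refine ⟨⟨fun hne => ?_, fun hlt => ?_⟩, ⟨fun hne => ?_, fun hlt => ?_⟩⟩
    · have h := hone.resolve_left hne.ne_empty
      have h1 := hw.integral_gradient_pos (t := t) hp (hins h).1.1
        (hΩb.subset (hins h).2.2.inclusion_subset) hne hρ hη ho hτ
      linarith [hneg h, mul_pos (hrpow τ hτ) (mul_pos hγ h1)]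
    -- If D₀ is empty, the superconducting bound applies, even when both sets are empty, and the
    -- indicator is nonnegative.
    · by_contra hne
      have h := hpos (Set.not_nonempty_iff_eq_empty.1 hne)
      linarith [mul_nonneg (hrpow τ hτ).le (mul_nonneg hk.le
        (hint Dinf (PCalderon.wolffSolution w t ρ η τ)))]
    · have h := hone.resolve_right hne.ne_empty
      obtain ⟨-, -, -, hDo, hI⟩ := hsup h
      have h1 := hw.integral_gradient_pos (t := t) hp hDo
        (hΩb.subset hI.inclusion_subset) hne hρ hη ho hτ
      exact (mul_pos (hrpow τ hτ) (mul_pos hk h1)).trans_le (hpos h)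
    · by_contra hne
      have h := hneg (Set.not_nonempty_iff_eq_empty.1 hne)
      linarith [mul_nonneg (hrpow τ hτ).le (mul_nonneg hγ.le
        (hint D₀ (PCalderon.wolffSolution w t ρ η τ)))]
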